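/- Let $D\subset\mathbb{R}^2$ be the closed unit disk and let $n\ge 2$. An admissible graph $C\subset D$ is a finite union of smooth embedded curves (arcs, or closed curves without vertices) which are disjoint except at their ends, run in the interior of $D$ except possibly at their ends, and are such that exactly three curve ends meet at every interior vertex and exactly one at every vertex on $\partial D$; it decomposes the open disk minus $C$ into $n$ nonempty, pairwise disjoint, open, possibly disconnected regions $R_1,\dots,R_n$, and every curve separates two different regions. Let $C_{ij}$ be the part of $C$ separating $R_i$ from $R_j$, $N_{ij}$ its unit normal pointing into $R_i$, $h_{ij}$ its geodesic curvature with respect to $N_{ij}$, and $\nu_{ij}$ the inner conormal at its end points. Below, sums over $i,j$ run over ordered pairs of adjacent regions. The graph $C$ is *stationary* if $$-\tfrac12\sum_{i,j}\Big\{\int_{C_{ij}}h_{ij}u_{ij}+\sum_{p\in\partial C_{ij}}X(p)\cdot\nu_{ij}(p)\Big\}=0,\qquad u_{ij}=X\cdot N_{ij},$$ for every vector field $X$ along $C$ that is smooth on each curve, single-valued at the vertices and tangent to $\partial D$ at the vertices on $\partial D$, and that preserves areas, i.e. $\sum_j\int_{C_{ij}}u_{ij}=0$ for every $i$. *Pressures*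 of $C$ are numbers $p_1,\dots,p_n$ with $h_{ij}=p_i-p_j$ on every $C_{ij}$. A family of functions $u_{ij}=-u_{ji}\in W^{1,2}(C_{ij})$ is *admissible* if $u_{ij}+u_{jk}+u_{ki}=0$ at every interior vertex, where $R_i,R_j,R_k$ are the three regions meeting there. A stationary graph is *stable* if $Q(u,u)\ge 0$ for every admissible $u$ with $\sum_j\int_{C_{ij}}u_{ij}=0$ for all $i$, where $$Q(u,v)=\tfrac12\sum_{i,j}\Big\{\int_{C_{ij}}\big(u_{ij}'v_{ij}'-h_{ij}^2u_{ij}v_{ij}\big)+\sum_{p\in\partial C_{ij}\cap\operatorname{int}D}q_{ij}(p)\,u_{ij}(p)v_{ij}(p)-\sum_{p\in\partial C_{ij}\cap\partial D}u_{ij}(p)v_{ij}(p)\Big\},$$ and $q_{ij}(p)=(h_{ki}+h_{kj})(p)/\sqrt3$ with $R_k$ the third region at $p$. **Claim.** Let $C$ be a stable graph separating $D$ into $n\ge 2$ regions. Then pressures of $C$ exist, and if $R_i$ is a region of largest pressure, i.e. $p_j\le p_i$ for all $j$, then at most $n-1$ connected components of $R_i$ are not hexagonal. Here a component is *hexagonal*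 if its closure does not meet $\partial D$ and its boundary is connected and consists of exactly six edges of $C$. -/

import Mathlib

open Set Filter Topology MeasureTheory
open scoped ContDiff

noncomputable section

/-- A finite family of smooth curves in the Euclidean plane `ℂ = ℝ²`, parametrised by arc length:
the `e`-th curve is the restriction of `curve e` to `[0, len e]` (the values of `curve e` outside
this interval play no role, except that a closed curve is periodic). A curve is either an arc,
which has two ends, or a closed curve, which has none and closes up smoothly. -/
structure CurveSystem where
  numEdges : ℕ
  isClosed : Fin numEdges → Bool
  len : Fin numEdges → ℝ
  len_pos : ∀ e, 0 < len e
  curve : Fin numEdges → ℝ → ℂ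
  smooth : ∀ e, ContDiff ℝ ∞ (curve e)
  unit_speed : ∀ e, ∀ t ∈ Icc 0 (len e), ‖deriv (curve e) t‖ = 1
  periodic : ∀ e, isClosed e = true → Function.Periodic (curve e) (len e)

namespace CurveSystem

variable (C : CurveSystem)

/-- The parameters of the points of a curve that are not ends of it. -/
def openParams (e : Fin C.numEdges) : Set ℝ :=
  if C.isClosed e then Ico 0 (C.len e) else Ioo 0 (C.len e)

/-- The ends of the arcs: `(e, false)` is the initial and `(e, true)` the final end of `e`. -/
def ends : Finset (Fin C.numEdges × Bool) :=
  Finset.univ.filter fun ε => C.isClosed ε.1 = false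

/-- The parameter at an end. -/
def endParam (ε : Fin C.numEdges × Bool) : ℝ := if ε.2 then C.len ε.1 else 0

/-- The vertex at which an end lies. -/
def endPoint (ε : Fin C.numEdges × Bool) : ℂ := C.curve ε.1 (C.endParam ε)

/-- `1` at initial ends, `-1` at final ends. -/
def endSign (ε : Fin C.numEdges × Bool) : ℝ := if ε.2 then -1 else 1

open Classical in
/-- The ends that lie at the point `p`. -/
def endsAt (p : ℂ) : Finset (Fin C.numEdges × Bool) :=
  C.ends.filter fun ε => C.endPoint ε = p

/-- The union of all the curves. -/
def support : Set ℂ := ⋃ e, C.curve e '' Icc 0 (C.len e)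

/-- The unit tangent. -/
def tangent (e : Fin C.numEdges) (t : ℝ) : ℂ := deriv (C.curve e) t

/-- The unit normal pointing to the left of the curve. -/
def normal (e : Fin C.numEdges) (t : ℝ) : ℂ := Complex.I * C.tangent e t

/-- The geodesic curvature with respect to the left normal. -/
def curvature (e : Fin C.numEdges) (t : ℝ) : ℝ :=
  inner ℝ (deriv (C.tangent e) t) (C.normal e t)

/-- The inner conormal at an end: the unit tangent vector pointing into the arc. -/
def conormal (ε : Fin C.numEdges × Bool) : ℂ :=
  (C.endSign ε : ℂ) * C.tangent ε.1 (C.endParam ε)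

end CurveSystem

/-- An admissible graph in the closed unit disk, with the decomposition of the open unit disk into
`n` (possibly disconnected) regions that it induces. -/
structure AdmissibleGraph (n : ℕ) extends CurveSystem where
  /-- Away from its ends a curve runs in the open disk. -/
  inside : ∀ e, ∀ t ∈ toCurveSystem.openParams e, ‖curve e t‖ < 1
  /-- The curves have no self-intersections and do not meet each other, except at ends. -/
  embedded : ∀ e e' s t, s ∈ toCurveSystem.openParams e → t ∈ toCurveSystem.openParams e' →
    curve e s = curve e' t → e = e' ∧ s = t
  endPoint_ne : ∀ ε ∈ toCurveSystem.ends, ∀ e, ∀ t ∈ toCurveSystem.openParams e,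
    curve e t ≠ toCurveSystem.endPoint ε
  /-- Three curves meet at every interior vertex. -/
  interior_vertex : ∀ ε ∈ toCurveSystem.ends, ‖toCurveSystem.endPoint ε‖ < 1 →
    (toCurveSystem.endsAt (toCurveSystem.endPoint ε)).card = 3
  /-- Just one curve arrives at every boundary vertex. -/
  boundary_vertex : ∀ ε ∈ toCurveSystem.ends, ‖toCurveSystem.endPoint ε‖ = 1 →
    (toCurveSystem.endsAt (toCurveSystem.endPoint ε)).card = 1
  /-- The regions. -/
  region : Fin n → Set ℂ
  region_open : ∀ i, IsOpen (region i)
  region_nonempty : ∀ i, (region i).Nonempty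
  region_disjoint : ∀ i j, i ≠ j → Disjoint (region i) (region j)
  region_cover : ⋃ i, region i = Metric.ball (0 : ℂ) 1 \ toCurveSystem.support
  /-- The regions on the left and on the right of each edge. They are different: the graph is the
  union of the curves that separate two regions. -/
  left : Fin numEdges → Fin n
  right : Fin numEdges → Fin n
  left_ne_right : ∀ e, left e ≠ right e
  left_side : ∀ e, ∀ t ∈ toCurveSystem.openParams e,
    ∀ᶠ s : ℝ in 𝓝[>] 0, curve e t + (s : ℂ) * toCurveSystem.normal e t ∈ region (left e)
  right_side : ∀ e, ∀ t ∈ toCurveSystem.openParams e,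
    ∀ᶠ s : ℝ in 𝓝[>] 0, curve e t - (s : ℂ) * toCurveSystem.normal e t ∈ region (right e)

namespace AdmissibleGraph

variable {n : ℕ} (C : AdmissibleGraph n)

/-! A function on the graph is given by functions `u e` of the arc length of each edge `e`. It
stands for the normal component `u_{ij}` with respect to the normal pointing into `R_i`, where
`i = left e` and `j = right e`; thus `u_{ji} = - u_{ij}` is `- u e`. -/

/-- The sum `∑_j ∫_{C_{ij}} u_{ij}`, i.e. minus the derivative of the area of `R_i`. -/
def flux (u : Fin C.numEdges → ℝ → ℝ) (i : Fin n) : ℝ :=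
  (∑ e with C.left e = i, ∫ t in (0 : ℝ)..C.len e, u e t) -
    ∑ e with C.right e = i, ∫ t in (0 : ℝ)..C.len e, u e t

/-- Infinitesimal variations of the graph inside the disk: vector fields along the graph, smooth on
every edge, single-valued at the vertices, and tangent to the unit circle at boundary vertices. -/
structure IsVariationField (X : Fin C.numEdges → ℝ → ℂ) : Prop where
  smooth : ∀ e, ContDiff ℝ ∞ (X e)
  periodic : ∀ e, C.isClosed e = true → Function.Periodic (X e) (C.len e)
  compatible : ∀ ε ∈ C.ends, ∀ ε' ∈ C.ends, C.endPoint ε = C.endPoint ε' →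
    X ε.1 (C.endParam ε) = X ε'.1 (C.endParam ε')
  tangent : ∀ ε ∈ C.ends, ‖C.endPoint ε‖ = 1 →
    inner ℝ (X ε.1 (C.endParam ε)) (C.endPoint ε) = 0

/-- The normal component of a vector field along the graph. -/
def normalPart (X : Fin C.numEdges → ℝ → ℂ) : Fin C.numEdges → ℝ → ℝ :=
  fun e t => inner ℝ (X e t) (C.normal e t)

/-- The first variation of length. -/
def firstVariation (X : Fin C.numEdges → ℝ → ℂ) : ℝ :=
  -((∑ e, ∫ t in (0 : ℝ)..C.len e, C.curvature e t * C.normalPart X e t) +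
    ∑ ε ∈ C.ends, inner ℝ (X ε.1 (C.endParam ε)) (C.conormal ε))

/-- Stationary graphs: the first variation of length vanishes for all variations that preserve the
areas of the regions. -/
def IsStationary : Prop :=
  ∀ X, C.IsVariationField X → (∀ i, C.flux (C.normalPart X) i = 0) → C.firstVariation X = 0

/-- `p` is a choice of pressures of the regions: `h_{ij} = p_i - p_j` on every `C_{ij}`. -/
def IsPressure (p : Fin n → ℝ) : Prop :=
  ∀ e, ∀ t ∈ Icc 0 (C.len e), C.curvature e t = p (C.left e) - p (C.right e)

/-- Admissible functions: of class `W^{1,2}` on every edge (absolutely continuous with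
square-integrable derivative), and with `u_{ij} + u_{jk} + u_{ki} = 0` at interior vertices. Going
around a vertex, the region on the left of an edge leaving the vertex is on the right of the next
one, so that `u_{ij}, u_{jk}, u_{ki}` are the values `u e` with the sign changed on
edges that arrive at the vertex. -/
structure IsAdmissible (u : Fin C.numEdges → ℝ → ℝ) : Prop where
  absCont : ∀ e, AbsolutelyContinuousOnInterval (u e) 0 (C.len e)
  deriv_memLp : ∀ e, MemLp (deriv (u e)) 2 (volume.restrict (Ioc 0 (C.len e)))
  closed : ∀ e, C.isClosed e = true → u e (C.len e) = u e 0
  vertex : ∀ ε ∈ C.ends, ‖C.endPoint ε‖ < 1 →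
    ∑ ε' ∈ C.endsAt (C.endPoint ε), C.endSign ε' * u ε'.1 (C.endParam ε') = 0

/-- For ends `ε` of an edge of `C_{ij}` and `ε'` of another edge at the same vertex, the curvature
of the latter with respect to its normal pointing into the third region `R_k` at the vertex
(`h_{ki}` or `h_{kj}`). The value is `0` for `ε' = ε`. -/
def curvatureIntoThird (ε ε' : Fin C.numEdges × Bool) : ℝ :=
  if C.left ε'.1 ≠ C.left ε.1 ∧ C.left ε'.1 ≠ C.right ε.1 then
    C.curvature ε'.1 (C.endParam ε')
  else if C.right ε'.1 ≠ C.left ε.1 ∧ C.right ε'.1 ≠ C.right ε.1 then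
    -C.curvature ε'.1 (C.endParam ε')
  else 0

/-- The coefficient `q_{ij} = (h_{ki} + h_{kj}) / √3` at an interior vertex. -/
def q (ε : Fin C.numEdges × Bool) : ℝ :=
  (∑ ε' ∈ C.endsAt (C.endPoint ε), C.curvatureIntoThird ε ε') / √3

open Classical in
/-- The index form. Each edge is counted once, which absorbs the factor `1/2` of the sum over
ordered pairs of regions, and the term `u''` is integrated by parts, which cancels the terms
`∂u/∂ν` at the vertices and gives the form its meaning on `W^{1,2}`. -/
def indexForm (u v : Fin C.numEdges → ℝ → ℝ) : ℝ :=
  (∑ e, ∫ t in (0 : ℝ)..C.len e,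
      (deriv (u e) t * deriv (v e) t - C.curvature e t ^ 2 * u e t * v e t)) +
    (∑ ε ∈ C.ends with ‖C.endPoint ε‖ < 1,
      C.q ε * u ε.1 (C.endParam ε) * v ε.1 (C.endParam ε)) -
    ∑ ε ∈ C.ends with ‖C.endPoint ε‖ = 1, u ε.1 (C.endParam ε) * v ε.1 (C.endParam ε)

/-- Stable graphs. -/
def IsStable : Prop :=
  C.IsStationary ∧
    ∀ u, C.IsAdmissible u → (∀ i, C.flux u i = 0) → 0 ≤ C.indexForm u u

/-- The connected components of a region. -/
def components (i : Fin n) : Set (Set ℂ) :=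
  {Ω | ∃ x ∈ C.region i, Ω = connectedComponentIn (C.region i) x}

/-- The edges of the graph that bound `Ω`. -/
def edgesOf (Ω : Set ℂ) : Set (Fin C.numEdges) :=
  {e | C.curve e '' C.openParams e ⊆ frontier Ω}

/-- Hexagonal components: they do not touch the unit circle, and their boundary is connected and
consists of six edges. -/
def IsHexagonal (Ω : Set ℂ) : Prop :=
  Disjoint (closure Ω) (Metric.sphere (0 : ℂ) 1) ∧ IsConnected (frontier Ω) ∧
    (C.edgesOf Ω).ncard = 6

end AdmissibleGraph

end

noncomputable section

/-! ### Fermi coordinates along a plane curve -/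

/-- Fermi coordinates along a plane curve, with the arc length and the signed distance as the real
and the imaginary part. -/
def fermi (g : ℝ → ℂ) (z : ℂ) : ℂ := g z.re + (z.im : ℂ) * (Complex.I * deriv g z.re)

lemma fermi_zero (g : ℝ → ℂ) : fermi g 0 = g 0 := by simp [fermi]

lemma fermi_ofReal (g : ℝ → ℂ) (t : ℝ) : fermi g t = g t := by simp [fermi]

lemma contDiff_deriv_of_contDiff {g : ℝ → ℂ} (hg : ContDiff ℝ ∞ g) : ContDiff ℝ ∞ (deriv g) :=
  (contDiff_infty_iff_deriv.1 hg).2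

lemma continuous_fermi {g : ℝ → ℂ} (hg : ContDiff ℝ ∞ g) : Continuous (fermi g) := by
  have h1 := hg.continuous
  have h2 := (contDiff_deriv_of_contDiff hg).continuous
  unfold fermi
  fun_prop

/-- The real differential at 0 is g'(0)(dt + i ds), which is complex linear. The map is thus
strictly complex differentiable at this one point, although it need not be holomorphic nearby. -/
lemma hasStrictDerivAt_fermi {g : ℝ → ℂ} (hg : ContDiff ℝ ∞ g) :
    HasStrictDerivAt (fermi g) (deriv g 0) 0 := by
  have h1 : HasStrictDerivAt g (deriv g 0) (0 : ℂ).re :=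
    (hg.contDiffAt (x := 0)).hasStrictDerivAt (by simp)
  have h2 : HasStrictDerivAt (deriv g) (deriv (deriv g) 0) (0 : ℂ).re :=
    ((contDiff_deriv_of_contDiff hg).contDiffAt (x := 0)).hasStrictDerivAt (by simp)
  have hre : HasStrictFDerivAt (fun z : ℂ => z.re) Complex.reCLM 0 :=
    Complex.reCLM.hasStrictFDerivAt
  have him : HasStrictFDerivAt (fun z : ℂ => (z.im : ℂ)) (Complex.ofRealCLM.comp Complex.imCLM) 0 :=
    (Complex.ofRealCLM.comp Complex.imCLM).hasStrictFDerivAt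
  have h3 := h1.hasStrictFDerivAt.comp (0 : ℂ) hre
  have h4 := (h2.hasStrictFDerivAt.comp (0 : ℂ) hre).const_mul Complex.I
  have h5 := h3.add (him.mul h4)
  rw [hasStrictDerivAt_iff_hasStrictFDerivAt]
  have h6 : HasStrictFDerivAt (𝕜 := ℝ) (fermi g)
      ((ContinuousLinearMap.toSpanSingleton ℂ (deriv g 0)).restrictScalars ℝ) 0 := by
    refine h5.congr_fderiv ?_
    ext z
    have hz := Complex.re_add_im z
    simp
    linear_combination (deriv g 0) * hz
  -- The remainder estimate does not involve the scalar field, so it passes from ℝ to ℂ.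
  exact HasStrictFDerivAt.of_isLittleO h6.isLittleO

lemma exists_fermi_estimate {g : ℝ → ℂ} (hg : ContDiff ℝ ∞ g) {η : ℝ} (hη : 0 < η) :
    ∃ r > 0, ∀ z w : ℂ, ‖z‖ < r → ‖w‖ < r →
      ‖fermi g z - fermi g w - deriv g 0 * (z - w)‖ ≤ η * ‖z - w‖ := by
  have h := (hasStrictDerivAt_fermi hg).hasStrictFDerivAt.isLittleO.def hη
  rw [nhds_prod_eq] at h
  obtain ⟨r, hr, hb⟩ := (Metric.nhds_basis_ball.prod_self).eventually_iff.1 h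
  refine ⟨r, hr, fun z w hz hw => ?_⟩
  have := @hb (z, w) ⟨by simpa using hz, by simpa using hw⟩
  simpa [mul_comm] using this

/-- Inverse function theorem: every point near the curve has Fermi coordinates. -/
lemma fermi_image_mem_nhds {g : ℝ → ℂ} (hg : ContDiff ℝ ∞ g) (h0 : deriv g 0 ≠ 0) {r : ℝ}
    (hr : 0 < r) : fermi g '' Metric.ball 0 r ∈ 𝓝 (g 0) := by
  rw [← fermi_zero g, ← (hasStrictDerivAt_fermi hg).map_nhds_eq h0]
  exact image_mem_map (Metric.ball_mem_nhds 0 hr)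

/-- Points which a compact family of points reaches only at parameters in an open set are
approached only from parameters in this set. -/
lemma eventually_param_mem {f : ℝ → ℂ} (hf : Continuous f) {K W : Set ℝ} (hK : IsCompact K)
    (hW : IsOpen W) {x : ℂ} (hx : ∀ t ∈ K, f t = x → t ∈ W) :
    ∀ᶠ y in 𝓝 x, ∀ t ∈ K, f t = y → t ∈ W := by
  have hc : IsClosed (f '' (K \ W)) := ((hK.diff hW).image hf).isClosed
  have hm : x ∈ (f '' (K \ W))ᶜ := by
    rintro ⟨t, ht, rfl⟩
    exact ht.2 (hx t ht.1 rfl)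
  filter_upwards [hc.isOpen_compl.mem_nhds hm] with y hy t ht h
  by_contra hn
  exact hy ⟨t, ⟨ht, hn⟩, h⟩

/-! ### From local to global convexity -/

/-- A connected open set which is locally convex at all points of its closure is convex. -/
lemma convex_of_locally_convex {Ω : Set ℂ} (ho : IsOpen Ω) (hc : IsPreconnected Ω)
    (hl : ∀ x ∈ closure Ω, ∃ r > 0, Convex ℝ (Ω ∩ Metric.ball x r)) : Convex ℝ Ω := by
  -- A segment in the closure with ends in Ω cannot touch the boundary from inside: the parameters
  -- of its points in Ω form an open set, which is shown to be closed in the unit interval.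
  have key : ∀ a ∈ Ω, ∀ b ∈ Ω, segment ℝ a b ⊆ closure Ω → segment ℝ a b ⊆ Ω := by
    intro a ha b hb hab
    have hcont : Continuous (AffineMap.lineMap (k := ℝ) a b) := AffineMap.lineMap_continuous
    have hT : Icc (0 : ℝ) 1 ⊆ AffineMap.lineMap (k := ℝ) a b ⁻¹' Ω := by
      refine (isPreconnected_Icc).subset_of_closure_inter_subset (ho.preimage hcont)
        ⟨0, by simp, by simpa⟩ ?_
      rintro t ⟨ht, htI⟩
      simp only [mem_preimage]
      set x := AffineMap.lineMap (k := ℝ) a b t with hx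
      have hxc : x ∈ closure Ω := by
        apply hab
        rw [segment_eq_image_lineMap]
        exact ⟨t, htI, rfl⟩
      obtain ⟨r, hr, hconv⟩ := hl x hxc
      have hK : IsOpen (Ω ∩ Metric.ball x r) := ho.inter Metric.isOpen_ball
      have hcl : ∀ y ∈ closure Ω, y ∈ Metric.ball x r → y ∈ closure (Ω ∩ Metric.ball x r) := by
        intro y hy hyb
        rw [inter_comm]
        exact Metric.isOpen_ball.inter_closure ⟨hyb, hy⟩
      by_cases hxΩ : x ∈ Ω
      · exact hxΩ
      have ht0 : t ≠ 0 := by rintro rfl; simp [hx] at hxΩ; exact hxΩ ha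
      have ht1 : t ≠ 1 := by rintro rfl; simp [hx] at hxΩ; exact hxΩ hb
      have htO : t ∈ Ioo (0 : ℝ) 1 :=
        ⟨lt_of_le_of_ne htI.1 (Ne.symm ht0), lt_of_le_of_ne htI.2 ht1⟩
      have hnear : AffineMap.lineMap (k := ℝ) a b ⁻¹' Metric.ball x r ∈ 𝓝 t :=
        hcont.continuousAt.preimage_mem_nhds (Metric.ball_mem_nhds _ hr)
      obtain ⟨δ, hδ, hδs⟩ := Metric.mem_nhds_iff.1 (inter_mem hnear (isOpen_Ioo.mem_nhds htO))
      obtain ⟨s, hsΩ, hsd⟩ := Metric.mem_closure_iff.1 ht δ hδ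
      have hsd' : |s - t| < δ := by rwa [dist_comm, Real.dist_eq] at hsd
      have hs := hδs (show s ∈ Metric.ball t δ by simpa [Real.dist_eq] using hsd')
      -- Reflection of s in t: the limit point x is the midpoint of a point of the open convex set
      -- and a point of its closure, hence lies in the set.
      set s' := 2 * t - s with hs'
      have hs'm := hδs (show s' ∈ Metric.ball t δ by
        rw [Metric.mem_ball, Real.dist_eq, hs', show 2 * t - s - t = -(s - t) by ring, abs_neg]
        exact hsd')
      have hs'c : AffineMap.lineMap (k := ℝ) a b s' ∈ closure (Ω ∩ Metric.ball x r) := by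
        refine hcl _ (hab ?_) hs'm.1
        rw [segment_eq_image_lineMap]
        exact ⟨s', ⟨hs'm.2.1.le, hs'm.2.2.le⟩, rfl⟩
      have hsi : AffineMap.lineMap (k := ℝ) a b s ∈ interior (Ω ∩ Metric.ball x r) := by
        rw [hK.interior_eq]; exact ⟨hsΩ, hs.1⟩
      have hmid := hconv.openSegment_interior_closure_subset_interior hsi hs'c
      have : x ∈ openSegment ℝ (AffineMap.lineMap (k := ℝ) a b s)
          (AffineMap.lineMap (k := ℝ) a b s') := by
        refine ⟨1 / 2, 1 / 2, by norm_num, by norm_num, by norm_num, ?_⟩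
        simp only [hx, AffineMap.lineMap_apply_module, hs']
        module
      exact (interior_subset (hmid this)).1
    rw [segment_eq_image_lineMap]
    rintro _ ⟨t, ht, rfl⟩
    exact hT ht
  rw [convex_iff_segment_subset]
  intro a ha
  -- The set of points visible from a is open by compactness of segments and closed in Ω by `key`,
  -- so it is all of Ω by connectedness.
  have hS : Ω ⊆ {b | segment ℝ a b ⊆ Ω} := by
    have hopen : IsOpen {b | segment ℝ a b ⊆ Ω} := by
      have : {b | segment ℝ a b ⊆ Ω} = {b | ∀ t ∈ Icc (0:ℝ) 1, AffineMap.lineMap (k := ℝ) a b t ∈ Ω} := by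
        ext b
        simp only [segment_eq_image_lineMap, mem_ofPred_eq, image_subset_iff]
        rfl
      rw [this, isOpen_iff_mem_nhds]
      intro b hb
      have hcont : Continuous fun q : ℂ × ℝ => AffineMap.lineMap (k := ℝ) a q.1 q.2 := by
        simp only [AffineMap.lineMap_apply_module]
        fun_prop
      refine isCompact_Icc.eventually_forall_of_forall_eventually fun t ht => ?_
      exact hcont.continuousAt.eventually (ho.mem_nhds (hb t ht))
    refine hc.subset_of_closure_inter_subset hopen ⟨a, ha, by simpa⟩ ?_
    rintro b ⟨hb, hbΩ⟩
    refine key a ha b hbΩ ?_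
    rw [segment_eq_image_lineMap]
    rintro _ ⟨t, ht, rfl⟩
    have hcont : Continuous fun b : ℂ => AffineMap.lineMap (k := ℝ) a b t := by
      simp only [AffineMap.lineMap_apply_module]
      fun_prop
    refine closure_minimal ?_ (isClosed_closure.preimage hcont) hb
    intro b' hb'
    apply subset_closure
    apply hb'
    rw [segment_eq_image_lineMap]
    exact ⟨t, ht, rfl⟩
  exact fun b hb => hS hb

/-! ### First variation: multipliers, pressures, equilibrium at vertices -/

namespace AdmissibleGraph

variable {n : ℕ} (C : AdmissibleGraph n)

lemma contDiff_tangent (e : Fin C.numEdges) : ContDiff ℝ ∞ (C.tangent e) :=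
  contDiff_deriv_of_contDiff (C.smooth e)

lemma contDiff_normal (e : Fin C.numEdges) : ContDiff ℝ ∞ (C.normal e) :=
  contDiff_const.mul (C.contDiff_tangent e)

lemma contDiff_curvature (e : Fin C.numEdges) : ContDiff ℝ ∞ (C.curvature e) :=
  (contDiff_deriv_of_contDiff (C.contDiff_tangent e)).inner ℝ (C.contDiff_normal e)

lemma periodic_deriv {f : ℝ → ℂ} {c : ℝ} (h : Function.Periodic f c) :
    Function.Periodic (deriv f) c := by
  intro t
  rw [← deriv_comp_add_const, show (fun x => f (x + c)) = f from funext h]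

lemma periodic_tangent {e : Fin C.numEdges} (h : C.isClosed e = true) :
    Function.Periodic (C.tangent e) (C.len e) :=
  periodic_deriv (C.periodic e h)

lemma periodic_normal {e : Fin C.numEdges} (h : C.isClosed e = true) :
    Function.Periodic (C.normal e) (C.len e) := fun t => by
  simp only [CurveSystem.normal, C.periodic_tangent h t]

lemma periodic_curvature {e : Fin C.numEdges} (h : C.isClosed e = true) :
    Function.Periodic (C.curvature e) (C.len e) := fun t => by
  simp only [CurveSystem.curvature, C.periodic_normal h t, periodic_deriv (C.periodic_tangent h) t]

lemma norm_tangent {e : Fin C.numEdges} {t : ℝ} (ht : t ∈ Icc 0 (C.len e)) :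
    ‖C.tangent e t‖ = 1 := C.unit_speed e t ht

lemma norm_normal {e : Fin C.numEdges} {t : ℝ} (ht : t ∈ Icc 0 (C.len e)) :
    ‖C.normal e t‖ = 1 := by
  simp [CurveSystem.normal, C.norm_tangent ht]

/-- The vector space of variation fields. -/
def variationFields : Submodule ℝ (Fin C.numEdges → ℝ → ℂ) where
  carrier := {X | C.IsVariationField X}
  add_mem' {X Y} hX hY :=
    { smooth := fun e => (hX.smooth e).add (hY.smooth e)
      periodic := fun e he => (hX.periodic e he).add (hY.periodic e he)
      compatible := fun ε hε ε' hε' h => by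
        simp only [Pi.add_apply, hX.compatible ε hε ε' hε' h, hY.compatible ε hε ε' hε' h]
      tangent := fun ε hε h => by
        simp only [Pi.add_apply, inner_add_left, hX.tangent ε hε h, hY.tangent ε hε h, add_zero] }
  zero_mem' :=
    { smooth := fun e => contDiff_const
      periodic := fun e he t => rfl
      compatible := fun _ _ _ _ _ => rfl
      tangent := fun _ _ _ => inner_zero_left _ }
  smul_mem' c X hX :=
    { smooth := fun e => (hX.smooth e).const_smul c
      periodic := fun e he t => by simp only [Pi.smul_apply, hX.periodic e he t]
      compatible := fun ε hε ε' hε' h => by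
        simp only [Pi.smul_apply, hX.compatible ε hε ε' hε' h]
      tangent := fun ε hε h => by
        simp only [Pi.smul_apply, real_inner_smul_left, hX.tangent ε hε h, mul_zero] }

variable {C}

lemma mem_variationFields {X : Fin C.numEdges → ℝ → ℂ} :
    X ∈ C.variationFields ↔ C.IsVariationField X := Iff.rfl

lemma IsVariationField.continuous_normalPart {X : Fin C.numEdges → ℝ → ℂ}
    (hX : C.IsVariationField X) (e : Fin C.numEdges) : Continuous (C.normalPart X e) :=
  ((hX.smooth e).inner ℝ (C.contDiff_normal e)).continuous

variable (C)

lemma normalPart_add (X Y : Fin C.numEdges → ℝ → ℂ) (e : Fin C.numEdges) (t : ℝ) :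
    C.normalPart (X + Y) e t = C.normalPart X e t + C.normalPart Y e t := inner_add_left _ _ _

lemma normalPart_smul (c : ℝ) (X : Fin C.numEdges → ℝ → ℂ) (e : Fin C.numEdges) (t : ℝ) :
    C.normalPart (c • X) e t = c * C.normalPart X e t := real_inner_smul_left _ _ _

/-- The flux of the normal component, as a linear form. -/
def fluxForm (i : Fin n) : C.variationFields →ₗ[ℝ] ℝ where
  toFun X := C.flux (C.normalPart X) i
  map_add' X Y := by
    have h : ∀ e, ∫ t in (0 : ℝ)..C.len e, C.normalPart (X + Y : Fin C.numEdges → ℝ → ℂ) e t =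
        (∫ t in (0 : ℝ)..C.len e, C.normalPart X e t) +
          ∫ t in (0 : ℝ)..C.len e, C.normalPart Y e t := fun e => by
      simp only [normalPart_add]
      exact intervalIntegral.integral_add
        ((IsVariationField.continuous_normalPart (mem_variationFields.1 X.2) e).intervalIntegrable _ _)
        ((IsVariationField.continuous_normalPart (mem_variationFields.1 Y.2) e).intervalIntegrable _ _)
    simp only [flux, Submodule.coe_add, h, Finset.sum_add_distrib]
    ring
  map_smul' c X := by
    simp only [flux, Submodule.coe_smul, normalPart_smul, intervalIntegral.integral_const_mul,
      ← Finset.mul_sum, RingHom.id_apply, smul_eq_mul]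
    ring

/-- The first variation of length, as a linear form. -/
def firstVariationForm : C.variationFields →ₗ[ℝ] ℝ where
  toFun X := C.firstVariation X
  map_add' X Y := by
    have h : ∀ e, ∫ t in (0 : ℝ)..C.len e,
          C.curvature e t * C.normalPart (X + Y : Fin C.numEdges → ℝ → ℂ) e t =
        (∫ t in (0 : ℝ)..C.len e, C.curvature e t * C.normalPart X e t) +
          ∫ t in (0 : ℝ)..C.len e, C.curvature e t * C.normalPart Y e t := fun e => by
      simp only [normalPart_add, mul_add]
      have hc := (C.contDiff_curvature e).continuous
      exact intervalIntegral.integral_add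
        ((hc.mul (IsVariationField.continuous_normalPart (mem_variationFields.1 X.2) e)).intervalIntegrable
          _ _)
        ((hc.mul (IsVariationField.continuous_normalPart (mem_variationFields.1 Y.2) e)).intervalIntegrable
          _ _)
    simp only [firstVariation, Submodule.coe_add, h, Finset.sum_add_distrib, Pi.add_apply,
      inner_add_left]
    ring
  map_smul' c X := by
    simp only [firstVariation, Submodule.coe_smul, normalPart_smul, Pi.smul_apply,
      real_inner_smul_left, mul_left_comm _ c, intervalIntegral.integral_const_mul,
      ← Finset.mul_sum, RingHom.id_apply, smul_eq_mul]
    ring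

variable {C}

/-- Lagrange multipliers for stationary graphs. -/
lemma IsStationary.exists_multipliers (hC : C.IsStationary) : ∃ p : Fin n → ℝ,
    ∀ X, C.IsVariationField X → C.firstVariation X = -∑ i, p i * C.flux (C.normalPart X) i := by
  -- A linear form that vanishes on the common kernel of finitely many linear forms is a combination
  -- of them.
  have h : C.firstVariationForm ∈ Submodule.span ℝ (range C.fluxForm) := by
    refine mem_span_of_iInf_ker_le_ker fun X hX => ?_
    simp only [Submodule.mem_iInf, LinearMap.mem_ker] at hX ⊢
    exact hC X (mem_variationFields.1 X.2) hX
  obtain ⟨c, hc⟩ := (Submodule.mem_span_range_iff_exists_fun ℝ).1 h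
  refine ⟨-c, fun X hX => ?_⟩
  have := DFunLike.congr_fun hc ⟨X, mem_variationFields.2 hX⟩
  simp only [LinearMap.coe_sum, LinearMap.smul_apply, Finset.sum_apply, smul_eq_mul] at this
  rw [show C.firstVariation X = C.firstVariationForm ⟨X, mem_variationFields.2 hX⟩ from rfl, ← this]
  simp [fluxForm]

variable (C)

lemma sum_mul_flux (p : Fin n → ℝ) (u : Fin C.numEdges → ℝ → ℝ) :
    ∑ i, p i * C.flux u i =
      ∑ e, (p (C.left e) - p (C.right e)) * ∫ t in (0 : ℝ)..C.len e, u e t := by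
  have h : ∀ f : Fin C.numEdges → Fin n, ∑ i, p i * ∑ e with f e = i, ∫ t in (0 : ℝ)..C.len e, u e t
      = ∑ e, p (f e) * ∫ t in (0 : ℝ)..C.len e, u e t := fun f => by
    rw [← Finset.sum_fiberwise (g := f)]
    refine Finset.sum_congr rfl fun i _ => ?_
    rw [Finset.mul_sum]
    refine Finset.sum_congr rfl fun e he => ?_
    rw [(Finset.mem_filter.1 he).2]
  simp only [flux, mul_sub, Finset.sum_sub_distrib, h, sub_mul]

variable {C}

/-- The Lagrange multipliers are pressures. -/
lemma isPressure_of_multipliers {p : Fin n → ℝ}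
    (hp : ∀ X, C.IsVariationField X →
      C.firstVariation X = -∑ i, p i * C.flux (C.normalPart X) i) : C.IsPressure p := by
  intro e
  set L := C.len e with hL
  have hLpos : 0 < L := C.len_pos e
  set d : ℝ := p (C.left e) - p (C.right e) with hd
  -- The factor sin² kills the field at the ends, so no conormal terms appear. It has period L, so
  -- the same field serves for closed curves.
  let φ : ℝ → ℝ := fun t => (C.curvature e t - d) * Real.sin (Real.pi * t / L) ^ 2
  have hφs : ContDiff ℝ ∞ φ := by
    have := C.contDiff_curvature e
    have h2 : ContDiff ℝ ∞ fun t : ℝ => Real.sin (Real.pi * t / L) :=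
      Real.contDiff_sin.comp ((contDiff_const.mul contDiff_id).div_const _)
    exact (this.sub contDiff_const).mul (h2.pow 2)
  have hφ0 : φ 0 = 0 := by simp [φ]
  have hφL : φ L = 0 := by simp [φ, hLpos.ne']
  have hφp : C.isClosed e = true → Function.Periodic φ L := fun he t => by
    simp only [φ]
    rw [hL, C.periodic_curvature he t, ← hL,
      show Real.pi * (t + L) / L = Real.pi * t / L + Real.pi by field_simp, Real.sin_add_pi,
      neg_sq]
  let X : Fin C.numEdges → ℝ → ℂ := Pi.single e (fun t => φ t • C.normal e t)
  have hXe : X e = fun t => φ t • C.normal e t := Pi.single_eq_same _ _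
  have hXn : ∀ e', e' ≠ e → X e' = 0 := fun e' h => Pi.single_eq_of_ne h _
  have hXend : ∀ ε : Fin C.numEdges × Bool, X ε.1 (C.endParam ε) = 0 := by
    rintro ⟨e', b⟩
    by_cases h : e' = e
    · subst h
      cases b <;> simp [hXe, CurveSystem.endParam, hφ0, ← hL, hφL]
    · simp [hXn e' h]
  have hX : C.IsVariationField X :=
    { smooth := fun e' => by
        by_cases h : e' = e
        · subst h
          rw [hXe]
          exact hφs.smul (C.contDiff_normal _)
        · rw [hXn e' h]
          exact contDiff_const
      periodic := fun e' he' => by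
        by_cases h : e' = e
        · subst h
          intro t
          simp only [hXe]
          rw [hφp he' t, C.periodic_normal he' t]
        · rw [hXn e' h]
          exact fun t => rfl
      compatible := fun ε _ ε' _ _ => by rw [hXend, hXend]
      tangent := fun ε _ _ => by rw [hXend, inner_zero_left] }
  have hN : ∀ e', e' ≠ e → ∀ t, C.normalPart X e' t = 0 := fun e' h t => by
    simp [normalPart, hXn e' h]
  have hNe : ∀ t ∈ Icc 0 L, C.normalPart X e t = φ t := fun t ht => by
    rw [normalPart, hXe, real_inner_smul_left, real_inner_self_eq_norm_sq, C.norm_normal ht]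
    ring
  have h1 := hp X hX
  rw [C.sum_mul_flux, firstVariation, neg_inj,
    Finset.sum_eq_zero (s := C.ends) (fun ε _ => by rw [hXend, inner_zero_left]), add_zero,
    Finset.sum_eq_single e (fun e' _ h => by simp [hN e' h]) (by simp),
    Finset.sum_eq_single e (fun e' _ h => by simp [hN e' h]) (by simp),
    ← intervalIntegral.integral_const_mul, ← sub_eq_zero] at h1
  have hcN := hX.continuous_normalPart e
  have hcc := (C.contDiff_curvature e).continuous
  rw [← intervalIntegral.integral_sub (f := fun t => C.curvature e t * C.normalPart X e t)
    (g := fun t => (p (C.left e) - p (C.right e)) * C.normalPart X e t)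
    ((hcc.mul hcN).intervalIntegrable _ _)
    ((continuous_const.mul hcN).intervalIntegrable _ _)] at h1
  -- The integrand (curvature - d) · φ is a square, so its vanishing integral forces curvature d
  -- inside the interval; the ends follow by continuity.
  let ψ : ℝ → ℝ := fun t => ((C.curvature e t - d) * Real.sin (Real.pi * t / L)) ^ 2
  have hψc : Continuous ψ := by fun_prop
  have h2 : ∫ t in (0 : ℝ)..L, ψ t = 0 := by
    refine Eq.trans (intervalIntegral.integral_congr fun t ht => ?_) h1
    rw [uIcc_of_le hLpos.le] at ht
    simp only [hNe t ht, ψ, φ]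
    ring
  have h3 : ∀ t ∈ Ioo 0 L, C.curvature e t = d := by
    intro t ht
    by_contra hne
    have hs : 0 < Real.sin (Real.pi * t / L) := by
      apply Real.sin_pos_of_pos_of_lt_pi
      · exact div_pos (mul_pos Real.pi_pos ht.1) hLpos
      · rw [div_lt_iff₀ hLpos]
        exact mul_lt_mul_of_pos_left ht.2 Real.pi_pos
    have : 0 < ∫ t in (0 : ℝ)..L, ψ t := by
      refine intervalIntegral.integral_pos hLpos hψc.continuousOn (fun x _ => sq_nonneg _)
        ⟨t, ⟨ht.1.le, ht.2.le⟩, ?_⟩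
      have : (C.curvature e t - d) ≠ 0 := sub_ne_zero.2 hne
      positivity
    linarith
  have hcl : IsClosed {t | C.curvature e t = d} := isClosed_eq hcc continuous_const
  intro t ht
  have := closure_minimal (s := Ioo 0 L) (fun t ht => h3 t ht) hcl
  rw [closure_Ioo hLpos.ne] at this
  exact this ht

lemma IsStationary.exists_isPressure (hC : C.IsStationary) : ∃ p, C.IsPressure p :=
  let ⟨p, hp⟩ := hC.exists_multipliers
  ⟨p, isPressure_of_multipliers hp⟩

/-- The curvature integrals are exactly the multiplier terms and cancel. What remains holds for all
variation fields, not only for those preserving areas. -/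
lemma IsStationary.sum_inner_conormal (hC : C.IsStationary) {X : Fin C.numEdges → ℝ → ℂ}
    (hX : C.IsVariationField X) :
    ∑ ε ∈ C.ends, inner ℝ (X ε.1 (C.endParam ε)) (C.conormal ε) = 0 := by
  obtain ⟨p, hp⟩ := hC.exists_multipliers
  have h := isPressure_of_multipliers hp
  have h1 := hp X hX
  rw [C.sum_mul_flux, firstVariation, neg_inj] at h1
  have : ∀ e, ∫ t in (0 : ℝ)..C.len e, C.curvature e t * C.normalPart X e t =
      (p (C.left e) - p (C.right e)) * ∫ t in (0 : ℝ)..C.len e, C.normalPart X e t := fun e => by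
    rw [← intervalIntegral.integral_const_mul]
    refine intervalIntegral.integral_congr fun t ht => ?_
    rw [uIcc_of_le (C.len_pos e).le] at ht
    simp only [h e t ht]
  simp only [this] at h1
  linarith

/-- The edges that meet at an interior vertex are in equilibrium. -/
lemma IsStationary.sum_conormal (hC : C.IsStationary) {x : ℂ} (hx : ‖x‖ < 1) :
    ∑ ε ∈ C.endsAt x, C.conormal ε = 0 := by
  classical
  have key : ∀ v : ℂ, ∑ ε ∈ C.endsAt x, inner ℝ v (C.conormal ε) = 0 := by
    intro v
    -- The field is v at the vertex x and 0 at all other vertices; cos² and sin² interpolate along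
    -- each arc, including arcs with both ends at x.
    let X : Fin C.numEdges → ℝ → ℂ := fun e t =>
      if C.isClosed e then 0 else
        (((if C.endPoint (e, false) = x then 1 else 0) *
            Real.cos (Real.pi * t / (2 * C.len e)) ^ 2 +
          (if C.endPoint (e, true) = x then 1 else 0) *
            Real.sin (Real.pi * t / (2 * C.len e)) ^ 2 : ℝ)) • v
    have hXe : ∀ ε ∈ C.ends, X ε.1 (C.endParam ε) = if C.endPoint ε = x then v else 0 := by
      rintro ⟨e, b⟩ hε
      have he : C.isClosed e = false := by simpa [CurveSystem.ends] using hε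
      have hl := (C.len_pos e).ne'
      have : Real.pi * C.len e / (2 * C.len e) = Real.pi / 2 := by field_simp
      cases b <;> simp [X, he, CurveSystem.endParam, this] <;> split_ifs <;> simp
    have hX : C.IsVariationField X :=
      { smooth := fun e => by
          by_cases h : C.isClosed e = true
          · simp only [X, h, if_true]
            exact contDiff_const
          · simp only [X, h]
            have h2 : ContDiff ℝ ∞ fun t : ℝ => Real.pi * t / (2 * C.len e) :=
              (contDiff_const.mul contDiff_id).div_const _
            exact ((contDiff_const.mul ((Real.contDiff_cos.comp h2).pow 2)).add
              (contDiff_const.mul ((Real.contDiff_sin.comp h2).pow 2))).smul contDiff_const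
        periodic := fun e he t => by simp only [X, he, if_true]
        compatible := fun ε hε ε' hε' h => by rw [hXe ε hε, hXe ε' hε', h]
        tangent := fun ε hε h => by
          rw [hXe ε hε, if_neg, inner_zero_left]
          rintro h'
          rw [h'] at h
          linarith }
    rw [CurveSystem.endsAt, Finset.sum_filter]
    refine Eq.trans ?_ (hC.sum_inner_conormal hX)
    refine Finset.sum_congr rfl fun ε hε => ?_
    rw [hXe ε hε]
    split_ifs
    · rfl
    · rw [inner_zero_left]
  -- Testing with the sum itself gives its squared norm.
  have := key (∑ ε ∈ C.endsAt x, C.conormal ε)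
  rw [← inner_sum, inner_self_eq_zero] at this
  exact this

lemma norm_conormal (ε : Fin C.numEdges × Bool) : ‖C.conormal ε‖ = 1 := by
  have h : C.endParam ε ∈ Icc 0 (C.len ε.1) := by
    have := (C.len_pos ε.1).le
    unfold CurveSystem.endParam
    split_ifs <;> simp [this]
  have h2 : ‖(C.endSign ε : ℂ)‖ = 1 := by
    unfold CurveSystem.endSign
    split_ifs <;> simp
  rw [CurveSystem.conormal, norm_mul, h2, C.norm_tangent h, one_mul]

variable (C)

/-! ### Parameters -/

/-- The parameters of the points of a curve that are not ends; all real numbers for a closed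
curve. -/
def interiorParams (e : Fin C.numEdges) : Set ℝ :=
  if C.isClosed e then univ else Ioo 0 (C.len e)

variable {C}

lemma isOpen_interiorParams (e : Fin C.numEdges) : IsOpen (C.interiorParams e) := by
  unfold interiorParams
  split_ifs
  exacts [isOpen_univ, isOpen_Ioo]

lemma isPreconnected_interiorParams (e : Fin C.numEdges) : IsPreconnected (C.interiorParams e) := by
  unfold interiorParams
  split_ifs
  exacts [isPreconnected_univ, isPreconnected_Ioo]

lemma Ioo_subset_interiorParams (e : Fin C.numEdges) : Ioo 0 (C.len e) ⊆ C.interiorParams e := by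
  unfold interiorParams
  split_ifs
  exacts [subset_univ _, subset_rfl]

lemma openParams_subset_interiorParams (e : Fin C.numEdges) :
    C.openParams e ⊆ C.interiorParams e := by
  unfold interiorParams CurveSystem.openParams
  split_ifs
  exacts [subset_univ _, subset_rfl]

lemma Ioo_subset_openParams (e : Fin C.numEdges) : Ioo 0 (C.len e) ⊆ C.openParams e := by
  unfold CurveSystem.openParams
  split_ifs
  exacts [Ioo_subset_Ico_self, subset_rfl]

lemma openParams_subset_Icc (e : Fin C.numEdges) : C.openParams e ⊆ Icc 0 (C.len e) := by
  unfold CurveSystem.openParams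
  split_ifs
  exacts [Ico_subset_Icc_self, Ioo_subset_Icc_self]

lemma half_mem_Ioo (e : Fin C.numEdges) : C.len e / 2 ∈ Ioo 0 (C.len e) :=
  ⟨half_pos (C.len_pos e), half_lt_self (C.len_pos e)⟩

lemma half_mem_interiorParams (e : Fin C.numEdges) : C.len e / 2 ∈ C.interiorParams e :=
  Ioo_subset_interiorParams e (half_mem_Ioo e)

/-- Reduction modulo the period. The clause that k is 0 for arcs lets closed curves and arcs be
treated by one formula. -/
lemma exists_shift_mem_openParams {e : Fin C.numEdges} {t : ℝ} (ht : t ∈ C.interiorParams e) :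
    ∃ k : ℤ, (C.isClosed e = false → k = 0) ∧ t + k * C.len e ∈ C.openParams e := by
  unfold interiorParams at ht
  unfold CurveSystem.openParams
  split_ifs at ht ⊢ with h
  · refine ⟨-toIcoDiv (C.len_pos e) 0 t, by simp [h], ?_⟩
    have := toIcoMod_mem_Ico (C.len_pos e) 0 t
    rw [toIcoMod, zero_add, zsmul_eq_mul] at this
    push_cast
    rwa [neg_mul, ← sub_eq_add_neg]
  · exact ⟨0, fun _ => rfl, by simpa using ht⟩

lemma curve_shift {e : Fin C.numEdges} {k : ℤ} (hk : C.isClosed e = false → k = 0) (t : ℝ) :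
    C.curve e (t + k * C.len e) = C.curve e t := by
  by_cases h : C.isClosed e = true
  · exact (C.periodic e h).int_mul k t
  · rw [hk (by simpa using h)]; simp

lemma tangent_shift {e : Fin C.numEdges} {k : ℤ} (hk : C.isClosed e = false → k = 0) (t : ℝ) :
    C.tangent e (t + k * C.len e) = C.tangent e t := by
  by_cases h : C.isClosed e = true
  · exact (C.periodic_tangent h).int_mul k t
  · rw [hk (by simpa using h)]; simp

lemma norm_tangent_of_mem {e : Fin C.numEdges} {t : ℝ} (ht : t ∈ C.interiorParams e) :
    ‖C.tangent e t‖ = 1 := by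
  obtain ⟨k, hk, hm⟩ := exists_shift_mem_openParams ht
  rw [← tangent_shift hk]
  exact C.norm_tangent (openParams_subset_Icc e hm)

lemma norm_curve_lt_one {e : Fin C.numEdges} {t : ℝ} (ht : t ∈ C.interiorParams e) :
    ‖C.curve e t‖ < 1 := by
  obtain ⟨k, hk, hm⟩ := exists_shift_mem_openParams ht
  rw [← curve_shift hk]
  exact C.inside e _ hm

lemma mem_ends {ε : Fin C.numEdges × Bool} : ε ∈ C.ends ↔ C.isClosed ε.1 = false := by
  simp [CurveSystem.ends]

lemma mem_endsAt {ε : Fin C.numEdges × Bool} {x : ℂ} :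
    ε ∈ C.endsAt x ↔ ε ∈ C.ends ∧ C.endPoint ε = x := by
  simp [CurveSystem.endsAt]

lemma endParam_mem_Icc (ε : Fin C.numEdges × Bool) : C.endParam ε ∈ Icc 0 (C.len ε.1) := by
  have := (C.len_pos ε.1).le
  unfold CurveSystem.endParam
  split_ifs <;> simp [this]

lemma Icc_cases {e : Fin C.numEdges} {s : ℝ} (hs : s ∈ Icc 0 (C.len e)) :
    s ∈ C.openParams e ∨ (C.isClosed e = true ∧ s = C.len e) ∨
      ∃ b, (e, b) ∈ C.ends ∧ s = C.endParam (e, b) := by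
  by_cases h : C.isClosed e = true
  · by_cases h1 : s = C.len e
    · exact Or.inr (Or.inl ⟨h, h1⟩)
    · left
      rw [CurveSystem.openParams, if_pos h]
      exact ⟨hs.1, lt_of_le_of_ne hs.2 h1⟩
  · have h' : C.isClosed e = false := by simpa using h
    by_cases h1 : s = C.len e
    · exact Or.inr (Or.inr ⟨true, mem_ends.2 h', by simpa [CurveSystem.endParam] using h1⟩)
    by_cases h0 : s = 0
    · exact Or.inr (Or.inr ⟨false, mem_ends.2 h', by simpa [CurveSystem.endParam] using h0⟩)
    left
    rw [CurveSystem.openParams, if_neg h]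
    exact ⟨lt_of_le_of_ne hs.1 (Ne.symm h0), lt_of_le_of_ne hs.2 h1⟩

lemma curve_mem_support {e : Fin C.numEdges} {t : ℝ} (ht : t ∈ C.interiorParams e) :
    C.curve e t ∈ C.support := by
  obtain ⟨k, hk, hm⟩ := exists_shift_mem_openParams ht
  rw [← curve_shift hk]
  exact mem_iUnion.2 ⟨e, _, openParams_subset_Icc e hm, rfl⟩

lemma mem_support_iff {y : ℂ} :
    y ∈ C.support ↔ ∃ e, ∃ t ∈ Icc 0 (C.len e), C.curve e t = y := by
  simp [CurveSystem.support]

lemma isCompact_support : IsCompact C.support :=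
  isCompact_iUnion fun e => isCompact_Icc.image (C.smooth e).continuous

lemma exists_of_mem_support {y : ℂ} (hy : y ∈ C.support) :
    (∃ e, ∃ t ∈ C.openParams e, C.curve e t = y) ∨ ∃ ε ∈ C.ends, C.endPoint ε = y := by
  obtain ⟨e, t, ht, rfl⟩ := mem_support_iff.1 hy
  rcases Icc_cases ht with h | ⟨h, rfl⟩ | ⟨b, hb, rfl⟩
  · exact Or.inl ⟨e, t, h, rfl⟩
  · refine Or.inl ⟨e, 0, ?_, ?_⟩
    · rw [CurveSystem.openParams, if_pos h]
      exact ⟨le_rfl, C.len_pos e⟩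
    · have := C.periodic e h 0
      rw [zero_add] at this
      exact this.symm
  · exact Or.inr ⟨_, hb, rfl⟩

lemma endPoint_mem_support (ε : Fin C.numEdges × Bool) : C.endPoint ε ∈ C.support :=
  mem_support_iff.2 ⟨ε.1, _, endParam_mem_Icc ε, rfl⟩

/-- Embeddedness carried over from `openParams` to `interiorParams` against the full closed
interval: the only coincidences are those caused by the period of a closed curve. -/
lemma eq_of_curve_eq {e e' : Fin C.numEdges} {s t : ℝ} (ht : t ∈ C.interiorParams e)
    (hs : s ∈ Icc 0 (C.len e')) (h : C.curve e' s = C.curve e t) :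
    e' = e ∧ ∃ k : ℤ, (C.isClosed e = false → k = 0) ∧ t = s + k * C.len e := by
  obtain ⟨k, hk, hm⟩ := exists_shift_mem_openParams ht
  rcases Icc_cases hs with h1 | ⟨h1, rfl⟩ | ⟨b, hb, rfl⟩
  · obtain ⟨rfl, h2⟩ := C.embedded e' e s _ h1 hm (by rw [h, curve_shift hk])
    refine ⟨rfl, -k, fun h => by simp [hk h], ?_⟩
    push_cast
    linarith
  · have h0 : (0 : ℝ) ∈ C.openParams e' := by
      rw [CurveSystem.openParams, if_pos h1]
      exact ⟨le_rfl, C.len_pos e'⟩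
    have hp := C.periodic e' h1 0
    rw [zero_add] at hp
    obtain ⟨rfl, h2⟩ := C.embedded e' e 0 _ h0 hm (by rw [← hp, h, curve_shift hk])
    refine ⟨rfl, -k - 1, fun h => by simp [h] at h1, ?_⟩
    push_cast
    linarith
  · exact absurd (by rw [curve_shift hk, ← h]; rfl) (C.endPoint_ne _ hb e _ hm)

/-- Near an interior point of an edge the graph consists of a short piece of the edge. -/
lemma eventually_near_interior {e : Fin C.numEdges} {t₀ : ℝ} (ht : t₀ ∈ C.interiorParams e)
    {δ : ℝ} (hδ : 0 < δ) :
    ∀ᶠ y in 𝓝 (C.curve e t₀), y ∈ C.support → ∃ t, |t - t₀| < δ ∧ C.curve e t = y := by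
  -- The open set of allowed parameters is empty for the other edges and a union of translated
  -- intervals, one for each admissible period shift, for e itself.
  have h : ∀ e', ∀ᶠ y in 𝓝 (C.curve e t₀), ∀ t ∈ Icc 0 (C.len e'), C.curve e' t = y →
      t ∈ {s : ℝ | e' = e ∧ ∃ k : ℤ, (C.isClosed e = false → k = 0) ∧
        |s + k * C.len e - t₀| < δ} := by
    intro e'
    refine eventually_param_mem (C.smooth e').continuous isCompact_Icc ?_ ?_
    · have : {s : ℝ | e' = e ∧ ∃ k : ℤ, (C.isClosed e = false → k = 0) ∧
          |s + k * C.len e - t₀| < δ} = ⋃ (_ : e' = e), ⋃ k : ℤ,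
            ⋃ (_ : C.isClosed e = false → k = 0), {s | |s + k * C.len e - t₀| < δ} := by
        ext s; simp
      rw [this]
      exact isOpen_iUnion fun _ => isOpen_iUnion fun k => isOpen_iUnion fun _ =>
        isOpen_lt (by fun_prop) continuous_const
    · intro s hs h
      obtain ⟨he, k, hk, hkt⟩ := eq_of_curve_eq ht hs h
      exact ⟨he, k, hk, by rw [← hkt, sub_self, abs_zero]; exact hδ⟩
  filter_upwards [eventually_all.2 h] with y hy hys
  obtain ⟨e', t, ht, rfl⟩ := mem_support_iff.1 hys
  obtain ⟨rfl, k, hk, hkt⟩ := hy e' t ht rfl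
  exact ⟨_, hkt, curve_shift hk t⟩

/-- Near a vertex the graph consists of short pieces of the edges that meet there. -/
lemma eventually_near_endPoint {ε₀ : Fin C.numEdges × Bool} (h₀ : ε₀ ∈ C.ends)
    {δ : ℝ} (hδ : 0 < δ) :
    ∀ᶠ y in 𝓝 (C.endPoint ε₀), y ∈ C.support → ∃ ε ∈ C.endsAt (C.endPoint ε₀), ∃ t,
      0 ≤ t ∧ t < δ ∧ C.endParam ε + C.endSign ε * t ∈ Icc 0 (C.len ε.1) ∧
        C.curve ε.1 (C.endParam ε + C.endSign ε * t) = y := by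
  have h : ∀ e', ∀ᶠ y in 𝓝 (C.endPoint ε₀), ∀ t ∈ Icc 0 (C.len e'), C.curve e' t = y →
      t ∈ {s : ℝ | ∃ b, (e', b) ∈ C.endsAt (C.endPoint ε₀) ∧ |s - C.endParam (e', b)| < δ} := by
    intro e'
    refine eventually_param_mem (C.smooth e').continuous isCompact_Icc ?_ ?_
    · have : {s : ℝ | ∃ b, (e', b) ∈ C.endsAt (C.endPoint ε₀) ∧ |s - C.endParam (e', b)| < δ} =
          ⋃ b, ⋃ (_ : (e', b) ∈ C.endsAt (C.endPoint ε₀)), {s | |s - C.endParam (e', b)| < δ} := by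
        ext s; simp
      rw [this]
      exact isOpen_iUnion fun _ => isOpen_iUnion fun k =>
        isOpen_lt (by fun_prop) continuous_const
    · intro s hs h
      rcases Icc_cases hs with h1 | ⟨h1, rfl⟩ | ⟨b, hb, rfl⟩
      · exact absurd h (C.endPoint_ne _ h₀ e' s h1)
      · have h0 : (0 : ℝ) ∈ C.openParams e' := by
          rw [CurveSystem.openParams, if_pos h1]
          exact ⟨le_rfl, C.len_pos e'⟩
        have hp := C.periodic e' h1 0
        rw [zero_add] at hp
        exact absurd (hp.symm.trans h) (C.endPoint_ne _ h₀ e' 0 h0)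
      · exact ⟨b, mem_endsAt.2 ⟨hb, h⟩, by simpa using hδ⟩
  filter_upwards [eventually_all.2 h] with y hy hys
  obtain ⟨e', t, ht, rfl⟩ := mem_support_iff.1 hys
  obtain ⟨b, hb, hbt⟩ := hy e' t ht rfl
  have hpar : C.endParam (e', b) + C.endSign (e', b) * (C.endSign (e', b) * (t - C.endParam (e', b)))
      = t := by
    unfold CurveSystem.endSign
    split_ifs <;> ring
  refine ⟨(e', b), hb, C.endSign (e', b) * (t - C.endParam (e', b)), ?_, ?_, ?_, ?_⟩
  · cases b <;> simp [CurveSystem.endSign, CurveSystem.endParam, ht.1, ht.2]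
  · refine lt_of_le_of_lt (le_abs_self _) ?_
    rw [abs_mul]
    have : |C.endSign (e', b)| = 1 := by cases b <;> simp [CurveSystem.endSign]
    rwa [this, one_mul]
  · rwa [hpar]
  · rw [hpar]

/-! ### Open sets that are unions of components of the complement of the graph -/

variable (C) in
/-- Open subsets of the open disk minus the graph that contain every connected subset of it which
they meet. -/
structure IsPiece (Ω : Set ℂ) : Prop where
  isOpen : IsOpen Ω
  subset : Ω ⊆ Metric.ball 0 1 \ C.support
  absorbs : ∀ S, IsPreconnected S → S ⊆ Metric.ball 0 1 \ C.support → (S ∩ Ω).Nonempty → S ⊆ Ω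

/-- The regions are open, disjoint and cover the complement of the graph in the disk, so a connected
subset of this complement cannot meet two of them. -/
lemma isPiece_region (i : Fin n) : C.IsPiece (C.region i) where
  isOpen := C.region_open i
  subset := by rw [← C.region_cover]; exact subset_iUnion _ i
  absorbs S hS hSU hne := by
    classical
    refine hS.subset_left_of_subset_union (C.region_open i)
      (isOpen_iUnion fun j => isOpen_iUnion fun (_ : j ≠ i) => C.region_open j) ?_ ?_ hne
    · exact disjoint_iUnion₂_right.2 fun j hj => C.region_disjoint i j hj.symm
    · intro x hx
      have := hSU hx
      rw [← C.region_cover] at this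
      obtain ⟨j, hj⟩ := mem_iUnion.1 this
      by_cases h : j = i
      · exact Or.inl (h ▸ hj)
      · exact Or.inr (mem_iUnion₂.2 ⟨j, h, hj⟩)

lemma subset_region_of_mem_components {i : Fin n} {Ω : Set ℂ} (h : Ω ∈ C.components i) :
    Ω ⊆ C.region i := by
  obtain ⟨x, hx, rfl⟩ := h
  exact connectedComponentIn_subset _ _

lemma isConnected_of_mem_components {i : Fin n} {Ω : Set ℂ} (h : Ω ∈ C.components i) :
    IsConnected Ω := by
  obtain ⟨x, hx, rfl⟩ := h
  exact isConnected_connectedComponentIn_iff.2 hx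

/-- A connected set that meets the component is first absorbed by the region and then by the
component. -/
lemma isPiece_of_mem_components {i : Fin n} {Ω : Set ℂ} (h : Ω ∈ C.components i) :
    C.IsPiece Ω where
  isOpen := by
    obtain ⟨x, hx, rfl⟩ := h
    exact (C.region_open i).connectedComponentIn
  subset := (subset_region_of_mem_components h).trans (isPiece_region i).subset
  absorbs S hS hSU hne := by
    have hsub := subset_region_of_mem_components h
    have hSi := (isPiece_region i).absorbs S hS hSU (hne.mono (inter_subset_inter_right _ hsub))
    obtain ⟨x, hx, rfl⟩ := h
    obtain ⟨y, hyS, hy⟩ := hne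
    rw [connectedComponentIn_eq hy]
    exact hS.subset_connectedComponentIn hyS hSi

lemma disjoint_of_mem_components {i : Fin n} {Ω Ω' : Set ℂ} (h : Ω ∈ C.components i)
    (h' : Ω' ∈ C.components i) (hne : Ω ≠ Ω') : Disjoint Ω Ω' := by
  rw [Set.disjoint_iff_inter_eq_empty]
  by_contra hn
  rw [← Ne, ← nonempty_iff_ne_empty] at hn
  apply hne
  have p := isPiece_of_mem_components h
  have p' := isPiece_of_mem_components h'
  refine subset_antisymm ?_ ?_
  · exact p'.absorbs Ω (isConnected_of_mem_components h).isPreconnected p.subset hn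
  · exact p.absorbs Ω' (isConnected_of_mem_components h').isPreconnected p'.subset
      (by rwa [inter_comm])

/-! ### The two sides of an edge -/

variable (C) in
/-- The set lies along the edge at the given point, on the left if `σ = 1` and on the right if
`σ = -1`. -/
def IsSide (σ : ℝ) (Ω : Set ℂ) (e : Fin C.numEdges) (t : ℝ) : Prop :=
  ∀ᶠ s : ℝ in 𝓝[>] 0, C.curve e t + ((σ * s : ℝ) : ℂ) * C.normal e t ∈ Ω

variable (C) in
/-- Fermi coordinates along an edge, starting at the parameter `a` and running in the direction
given by the sign `σ`. -/
def tube (e : Fin C.numEdges) (a σ : ℝ) (z : ℂ) : ℂ := fermi (fun t => C.curve e (a + σ * t)) z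

lemma deriv_curve_affine (e : Fin C.numEdges) (a σ t : ℝ) :
    deriv (fun t => C.curve e (a + σ * t)) t = σ * C.tangent e (a + σ * t) := by
  have h1 : HasDerivAt (C.curve e) (C.tangent e (a + σ * t)) (a + σ * t) :=
    ((C.smooth e).differentiable (by simp) _).hasDerivAt
  have h2 : HasDerivAt (fun t : ℝ => a + σ * t) σ t := by
    simpa using ((hasDerivAt_id t).const_mul σ).const_add a
  have h3 := h1.scomp t h2
  rw [show (fun t => C.curve e (a + σ * t)) = C.curve e ∘ fun t => a + σ * t from rfl, h3.deriv,
    Complex.real_smul]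

lemma contDiff_curve_affine (e : Fin C.numEdges) (a σ : ℝ) :
    ContDiff ℝ ∞ fun t => C.curve e (a + σ * t) :=
  (C.smooth e).comp (contDiff_const.add (contDiff_const.mul contDiff_id))

lemma tube_apply (e : Fin C.numEdges) (a σ : ℝ) (z : ℂ) :
    C.tube e a σ z =
      C.curve e (a + σ * z.re) + ((σ * z.im : ℝ) : ℂ) * C.normal e (a + σ * z.re) := by
  rw [tube, fermi, deriv_curve_affine, CurveSystem.normal]
  push_cast
  ring

lemma tube_ofReal (e : Fin C.numEdges) (a σ t : ℝ) : C.tube e a σ t = C.curve e (a + σ * t) :=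
  fermi_ofReal _ _

lemma tube_zero (e : Fin C.numEdges) (a σ : ℝ) : C.tube e a σ 0 = C.curve e a := by
  simpa using tube_ofReal e a σ 0

lemma continuous_tube (e : Fin C.numEdges) (a σ : ℝ) : Continuous (C.tube e a σ) :=
  continuous_fermi (contDiff_curve_affine e a σ)

lemma exists_tube_estimate (e : Fin C.numEdges) (a σ : ℝ) {η : ℝ} (hη : 0 < η) :
    ∃ r > 0, ∀ z w : ℂ, ‖z‖ < r → ‖w‖ < r →
      ‖C.tube e a σ z - C.tube e a σ w - σ * C.tangent e a * (z - w)‖ ≤ η * ‖z - w‖ := by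
  have := exists_fermi_estimate (contDiff_curve_affine e a σ) hη
  simp only [deriv_curve_affine, mul_zero, add_zero] at this
  exact this

lemma tube_image_mem_nhds {e : Fin C.numEdges} {a σ : ℝ} (h : ‖σ * C.tangent e a‖ = 1)
    {r : ℝ} (hr : 0 < r) : C.tube e a σ '' Metric.ball 0 r ∈ 𝓝 (C.curve e a) := by
  have := fermi_image_mem_nhds (contDiff_curve_affine e a σ) (r := r) (by
    rw [deriv_curve_affine, mul_zero, add_zero]
    exact norm_ne_zero_iff.1 (by rw [h]; norm_num)) hr
  simp only [mul_zero, add_zero] at this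
  exact this

/-- The differential is an isometry, so a remainder with constant 1/2 < 1 leaves no room for two
preimages. -/
lemma exists_tube_injOn {e : Fin C.numEdges} {a σ : ℝ} (h : ‖σ * C.tangent e a‖ = 1) :
    ∃ r > 0, InjOn (C.tube e a σ) (Metric.ball 0 r) := by
  obtain ⟨r, hr, hE⟩ := exists_tube_estimate e a σ (η := 1 / 2) (by norm_num)
  refine ⟨r, hr, fun z hz w hw hzw => ?_⟩
  have := hE z w (by simpa using hz) (by simpa using hw)
  rw [hzw, sub_self, zero_sub, norm_neg, norm_mul, h, one_mul] at this
  have h0 : ‖z - w‖ ≤ 0 := by linarith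
  exact sub_eq_zero.1 (norm_le_zero_iff.1 h0)

/-- Running backwards also reverses the normal of the tube, so the side is determined by the product
of the two signs. -/
lemma isSide_iff_tube {e : Fin C.numEdges} {a σ u τ : ℝ} {Ω : Set ℂ} :
    C.IsSide (σ * τ) Ω e (a + σ * u) ↔ ∀ᶠ s : ℝ in 𝓝[>] 0, C.tube e a σ ⟨u, τ * s⟩ ∈ Ω := by
  simp only [IsSide, tube_apply, mul_assoc]

lemma not_mem_support_of_isPiece {Ω : Set ℂ} (hΩ : C.IsPiece Ω) {y : ℂ} (hy : y ∈ Ω) :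
    y ∉ C.support := (hΩ.subset hy).2

lemma eventually_mk_norm_lt {u r τ : ℝ} (hu : |u| < r) :
    ∀ᶠ s : ℝ in 𝓝[>] 0, ‖(⟨u, τ * s⟩ : ℂ)‖ < r := by
  have hc : Continuous fun s : ℝ => ‖(⟨u, τ * s⟩ : ℂ)‖ := by
    have : (fun s : ℝ => (⟨u, τ * s⟩ : ℂ)) =
        fun s : ℝ => (u : ℂ) + ((τ * s : ℝ) : ℂ) * Complex.I := by
      ext s
      exact Complex.mk_eq_add_mul_I _ _
    rw [show (fun s : ℝ => ‖(⟨u, τ * s⟩ : ℂ)‖) = (fun z : ℂ => ‖z‖) ∘ fun s : ℝ => ⟨u, τ * s⟩ from rfl,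
      this]
    fun_prop
  have h0 : ‖(⟨u, τ * 0⟩ : ℂ)‖ < r := by
    rw [mul_zero, show (⟨u, 0⟩ : ℂ) = (u : ℂ) from rfl, Complex.norm_real]
    exact hu
  exact nhdsWithin_le_nhds (hc.continuousAt.eventually (gt_mem_nhds h0))

/-- A piece that contains a point of a connected set on one side of an edge lies on this side of
the edge. -/
lemma IsPiece.tube_mem_iff {Ω : Set ℂ} (hΩ : C.IsPiece Ω) {e : Fin C.numEdges} {a σ u τ : ℝ}
    {H : Set ℂ} (hH : IsPreconnected H)
    (hHU : ∀ z ∈ H, C.tube e a σ z ∈ Metric.ball 0 1 \ C.support)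
    (hu : ∀ᶠ s : ℝ in 𝓝[>] 0, (⟨u, τ * s⟩ : ℂ) ∈ H) {z : ℂ} (hz : z ∈ H) :
    C.tube e a σ z ∈ Ω ↔ C.IsSide (σ * τ) Ω e (a + σ * u) := by
  have hS : IsPreconnected (C.tube e a σ '' H) := hH.image _ (continuous_tube e a σ).continuousOn
  have hSU : C.tube e a σ '' H ⊆ Metric.ball 0 1 \ C.support := by
    rintro _ ⟨w, hw, rfl⟩
    exact hHU w hw
  rw [isSide_iff_tube]
  constructor
  · intro h
    have := hΩ.absorbs _ hS hSU ⟨_, mem_image_of_mem _ hz, h⟩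
    filter_upwards [hu] with s hs
    exact this (mem_image_of_mem _ hs)
  · intro h
    obtain ⟨s, hs, hs'⟩ := (h.and hu).exists
    exact hΩ.absorbs _ hS hSU ⟨_, mem_image_of_mem _ hs', hs⟩ (mem_image_of_mem _ hz)

/-- A piece near an interior point of an edge. -/
lemma exists_interior_chart {e : Fin C.numEdges} {t₀ : ℝ} (ht : t₀ ∈ C.interiorParams e) :
    ∃ r > 0, ∀ z : ℂ, ‖z‖ < r → t₀ + z.re ∈ C.interiorParams e ∧ ∀ Ω, C.IsPiece Ω → ∀ u, |u| < r →
      (C.tube e t₀ 1 z ∈ Ω ↔ (0 < z.im ∧ C.IsSide 1 Ω e (t₀ + u)) ∨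
        (z.im < 0 ∧ C.IsSide (-1) Ω e (t₀ + u))) := by
  have hτ : ‖((1 : ℝ) : ℂ) * C.tangent e t₀‖ = 1 := by simpa using norm_tangent_of_mem ht
  obtain ⟨r₁, hr₁, hinj⟩ := exists_tube_injOn hτ
  have hcont := (continuous_tube e t₀ 1).continuousAt (x := 0)
  -- Graph points near the centre come from parameters inside the domain of injectivity of the tube;
  -- hence in these coordinates the graph lies on the real axis.
  have hev : ∀ᶠ z in 𝓝 (0 : ℂ), (C.tube e t₀ 1 z ∈ C.support →
      ∃ t, |t - t₀| < r₁ ∧ C.curve e t = C.tube e t₀ 1 z) := by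
    have := eventually_near_interior ht hr₁
    rw [← tube_zero e t₀ 1] at this
    exact hcont.eventually this
  have hball : ∀ᶠ z in 𝓝 (0 : ℂ), C.tube e t₀ 1 z ∈ Metric.ball 0 1 := by
    refine hcont.eventually (Metric.isOpen_ball.mem_nhds ?_)
    rw [tube_zero]
    simpa using norm_curve_lt_one ht
  have hpar : ∀ᶠ z in 𝓝 (0 : ℂ), t₀ + z.re ∈ C.interiorParams e := by
    have hc : ContinuousAt (fun z : ℂ => t₀ + z.re) 0 := by fun_prop
    exact hc.eventually ((isOpen_interiorParams e).mem_nhds (by simpa using ht))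
  obtain ⟨r₂, hr₂, h₂⟩ := Metric.eventually_nhds_iff_ball.1 (hev.and (hball.and hpar))
  refine ⟨min r₁ r₂, lt_min hr₁ hr₂, fun z hz => ?_⟩
  have hmem : ∀ z : ℂ, ‖z‖ < min r₁ r₂ → C.tube e t₀ 1 z ∈ C.support → z.im = 0 := by
    intro z hz hs
    obtain ⟨t, ht1, ht2⟩ := (h₂ z (by simpa using hz.trans_le (min_le_right _ _))).1 hs
    have : ((t - t₀ : ℝ) : ℂ) = z := by
      refine hinj ?_ ?_ ?_
      · simpa [← Complex.ofReal_sub] using ht1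
      · simpa using hz.trans_le (min_le_left _ _)
      · rw [tube_ofReal, ← ht2]
        congr 1
        ring
    rw [← this, Complex.ofReal_im]
  have hin : ∀ z : ℂ, ‖z‖ < min r₁ r₂ → C.tube e t₀ 1 z ∈ Metric.ball 0 1 := fun z hz =>
    (h₂ z (by simpa using hz.trans_le (min_le_right _ _))).2.1
  refine ⟨(h₂ z (by simpa using hz.trans_le (min_le_right _ _))).2.2, fun Ω hΩ u hu => ?_⟩
  -- Each open half disk is connected and misses the graph, so a piece contains all or nothing of
  -- it.
  have hHc : ∀ τ : ℝ, Convex ℝ (Metric.ball (0 : ℂ) (min r₁ r₂) ∩ {z | 0 < τ * z.im}) := fun τ =>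
    (convex_ball _ _).inter (convex_halfSpace_gt
      (f := fun z : ℂ => τ * z.im) (IsLinearMap.mk (fun x y => by simp [mul_add])
        (fun c x => by simp only [Complex.real_smul, Complex.mul_im, Complex.ofReal_re,
          Complex.ofReal_im, smul_eq_mul]; ring)) 0)
  have hside : ∀ τ : ℝ, τ = 1 ∨ τ = -1 → 0 < τ * z.im →
      (C.tube e t₀ 1 z ∈ Ω ↔ C.IsSide τ Ω e (t₀ + u)) := by
    intro τ hτ' hz'
    have := hΩ.tube_mem_iff (e := e) (a := t₀) (σ := 1) (u := u) (τ := τ) (hHc τ).isPreconnected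
      (fun w hw => ⟨hin w (by simpa using hw.1), fun hs => by
        have h1 := hmem w (by simpa using hw.1) hs
        have h2 : 0 < τ * w.im := hw.2
        rw [h1, mul_zero] at h2
        exact lt_irrefl _ h2⟩)
      (by
        filter_upwards [eventually_mk_norm_lt (τ := τ) hu, self_mem_nhdsWithin] with s hs hs0
        refine ⟨by simpa using hs, ?_⟩
        have hs0 : (0 : ℝ) < s := hs0
        show 0 < τ * (τ * s)
        rcases hτ' with rfl | rfl <;> simpa using hs0)
      (z := z) ⟨by simpa using hz, hz'⟩
    simpa only [one_mul] using this
  rcases lt_trichotomy z.im 0 with h | h | h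
  · rw [hside (-1) (Or.inr rfl) (by linarith)]
    simp [h, h.le]
  · have : C.tube e t₀ 1 z ∈ C.support := by
      have hz' : z = (z.re : ℂ) := Complex.ext rfl (by simpa using h)
      rw [hz', tube_ofReal, one_mul]
      exact curve_mem_support (h₂ z (by simpa using hz.trans_le (min_le_right _ _))).2.2
    simp only [h, lt_irrefl, false_and, or_false, iff_false]
    exact fun hm => not_mem_support_of_isPiece hΩ hm this
  · rw [hside 1 (Or.inl rfl) (by linarith)]
    simp [h, h.le]

end AdmissibleGraph

/-! ### Three unit vectors in equilibrium -/

/-- The rotation by `2π/3`. -/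
def zeta : ℂ := ⟨-1 / 2, √3 / 2⟩

lemma zeta_re : zeta.re = -1 / 2 := rfl
lemma zeta_im : zeta.im = √3 / 2 := rfl

lemma sq_sqrt_three : √3 * √3 = (3 : ℝ) := Real.mul_self_sqrt (by norm_num)

lemma one_add_zeta_add_sq : 1 + zeta + zeta * zeta = 0 := by
  apply Complex.ext
  · simp only [Complex.add_re, Complex.mul_re, Complex.one_re, zeta_re, zeta_im, Complex.zero_re]
    linarith [sq_sqrt_three]
  · simp only [Complex.add_im, Complex.mul_im, Complex.one_im, zeta_re, zeta_im, Complex.zero_im]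
    ring

lemma zeta_cube : zeta * (zeta * zeta) = 1 := by
  linear_combination (zeta - 1) * one_add_zeta_add_sq

lemma conj_zeta : starRingEnd ℂ zeta = zeta * zeta := by
  apply Complex.ext
  · simp only [Complex.mul_re, Complex.conj_re, zeta_re, zeta_im]
    linarith [sq_sqrt_three]
  · simp only [Complex.mul_im, Complex.conj_im, zeta_re, zeta_im]
    ring

lemma norm_one_iff {u : ℂ} : ‖u‖ = 1 ↔ u.re * u.re + u.im * u.im = 1 := by
  rw [← Complex.normSq_apply, Complex.normSq_eq_norm_sq]
  constructor
  · intro h; rw [h]; norm_num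
  · intro h; nlinarith [norm_nonneg u]

lemma mul_conj_of_norm_one {u : ℂ} (h : ‖u‖ = 1) : u * starRingEnd ℂ u = 1 := by
  rw [Complex.mul_conj, Complex.normSq_eq_norm_sq, h]; simp

/-- Three unit vectors in equilibrium form angles of `2π/3`. -/
lemma equilibrium_of_unit_vectors {u v w : ℂ} (hu : ‖u‖ = 1) (hv : ‖v‖ = 1) (hw : ‖w‖ = 1)
    (h : u + v + w = 0) :
    (v = zeta * u ∧ w = zeta * v) ∨ (w = zeta * u ∧ v = zeta * w) := by
  have huu := mul_conj_of_norm_one hu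
  -- With q = v/u, the equations |q| = 1 and |1 + q| = 1 force Re q = -1/2, which leaves the two
  -- primitive cube roots of unity.
  set q := v * starRingEnd ℂ u with hq
  have hqv : v = q * u := by rw [hq]; linear_combination (-v) * huu
  have hq1 : ‖q‖ = 1 := by rw [hq, norm_mul, RCLike.norm_conj, hu, hv, one_mul]
  have hw' : w = -(1 + q) * u := by linear_combination h - hqv
  have hq2 : ‖1 + q‖ = 1 := by
    rw [hw', norm_mul, hu, norm_neg, mul_one] at hw
    exact hw
  rw [norm_one_iff] at hq1 hq2
  simp only [Complex.add_re, Complex.one_re, Complex.add_im, Complex.one_im, zero_add] at hq2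
  have hre : q.re = -1 / 2 := by linarith
  have him : (q.im - √3 / 2) * (q.im + √3 / 2) = 0 := by
    rw [hre] at hq1
    linarith [sq_sqrt_three]
  have h1 := one_add_zeta_add_sq
  rcases mul_eq_zero.1 him with h2 | h2
  · have : q = zeta := Complex.ext hre (by rw [zeta_im]; linarith)
    left
    rw [hw', hqv, this]
    exact ⟨rfl, by linear_combination (-u) * h1⟩
  · have : q = zeta * zeta := by
      rw [← conj_zeta]
      exact Complex.ext hre (by rw [Complex.conj_im, zeta_im]; linarith)
    right
    rw [hw', hqv, this]
    exact ⟨by linear_combination (-u) * h1, by linear_combination (u * zeta) * h1⟩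

/-- Every vector forms an angle of at most `π/3` with one of three unit vectors in equilibrium. -/
lemma exists_re_ge_half (w : ℂ) : ‖w‖ / 2 ≤ w.re ∨
    ‖w‖ / 2 ≤ (w * starRingEnd ℂ zeta).re ∨
    ‖w‖ / 2 ≤ (w * starRingEnd ℂ (zeta * zeta)).re := by
  by_contra! h
  obtain ⟨h1, h2, h3⟩ := h
  have hs := sq_sqrt_three
  have hs0 : 0 < √3 := by positivity
  rw [map_mul, conj_zeta] at h3
  rw [show w * (zeta * zeta * (zeta * zeta)) = w * zeta by
    linear_combination (w * zeta) * zeta_cube] at h3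
  simp only [Complex.mul_re, Complex.conj_re, Complex.conj_im, zeta_re, zeta_im] at h2 h3
  have hn : ‖w‖ ^ 2 = w.re * w.re + w.im * w.im := by
    rw [← Complex.normSq_apply, Complex.normSq_eq_norm_sq]
  have h0 := norm_nonneg w
  have hr1 : -‖w‖ < w.re := by nlinarith
  -- This combines the two failed inequalities for the rotated vectors. Squared, it gives 3(|w| - Re
  -- w) < |w| + Re w, that is Re w > |w|/2, against the first one.
  have hle : √3 * |w.im| < ‖w‖ + w.re := by
    rcases abs_cases w.im with ⟨h, _⟩ | ⟨h, _⟩ <;> rw [h] <;> linarith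
  have hsq : (√3 * |w.im|) ^ 2 = 3 * (w.im * w.im) := by
    rw [mul_pow, sq_abs, sq, hs]; ring
  have : (√3 * |w.im|) ^ 2 < (‖w‖ + w.re) ^ 2 := by
    apply pow_lt_pow_left₀ hle (by positivity) (by norm_num)
  rw [hsq] at this
  nlinarith

/-! ### The two sides of a whole edge -/

namespace AdmissibleGraph

variable {n : ℕ} {C : AdmissibleGraph n}

/-- The side condition is locally constant, since in the chart around a parameter it is decided by
one point on that side, whatever the nearby parameter. The parameter set is connected. -/
lemma isSide_congr {Ω : Set ℂ} (hΩ : C.IsPiece Ω) {e : Fin C.numEdges} {σ t t' : ℝ}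
    (hσ : σ = 1 ∨ σ = -1) (ht : t ∈ C.interiorParams e) (ht' : t' ∈ C.interiorParams e)
    (h : C.IsSide σ Ω e t) : C.IsSide σ Ω e t' := by
  have key : ∀ t₀ ∈ C.interiorParams e, ∃ r > 0, ∀ u, |u| < r →
      (C.IsSide σ Ω e (t₀ + u) ↔ C.IsSide σ Ω e t₀) := by
    intro t₀ ht₀
    obtain ⟨r, hr, hch⟩ := exists_interior_chart ht₀
    refine ⟨r, hr, fun u hu => ?_⟩
    set z : ℂ := ((σ * (r / 2) : ℝ) : ℂ) * Complex.I with hz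
    have hzn : ‖z‖ < r := by
      rw [hz, norm_mul, Complex.norm_I, mul_one, Complex.norm_real, norm_mul]
      have : ‖σ‖ = 1 := by rcases hσ with rfl | rfl <;> simp
      rw [this, Real.norm_eq_abs, abs_of_pos (half_pos hr)]
      linarith
    have hzi : z.im = σ * (r / 2) := by simp [hz]
    have h1 := (hch z hzn).2 Ω hΩ u hu
    have h2 := (hch z hzn).2 Ω hΩ 0 (by simpa using hr)
    rw [h1, add_zero, hzi] at h2
    rcases hσ with rfl | rfl
    · have h3 : ¬ r / 2 < 0 := by linarith
      simpa [h3, hr] using h2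
    · have h3 : ¬ r / 2 < 0 := by linarith
      simpa [h3, hr] using h2
  set S := {s | s ∈ C.interiorParams e ∧ C.IsSide σ Ω e s} with hS
  have hSo : IsOpen S := by
    rw [isOpen_iff_mem_nhds]
    rintro s ⟨hs, hss⟩
    obtain ⟨r, hr, hk⟩ := key s hs
    filter_upwards [(isOpen_interiorParams e).mem_nhds hs, Metric.ball_mem_nhds s hr] with v hv hvr
    refine ⟨hv, ?_⟩
    have := (hk (v - s) (by simpa [Real.dist_eq] using hvr)).2 hss
    rwa [add_sub_cancel] at this
  have := (isPreconnected_interiorParams e).subset_of_closure_inter_subset hSo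
    ⟨t, ht, ht, h⟩ (by
      rintro s ⟨hs, hsO⟩
      obtain ⟨r, hr, hk⟩ := key s hsO
      obtain ⟨v, hv, hvs⟩ := Metric.mem_closure_iff.1 hs r hr
      refine ⟨hsO, (hk (v - s) (by rwa [dist_comm, Real.dist_eq] at hvs)).1 ?_⟩
      rw [add_sub_cancel]
      exact hv.2)
  exact (this ht').2

variable (C) in
/-- The set lies along the edge, on the left if `σ = 1` and on the right if `σ = -1`. -/
def Adj (σ : ℝ) (Ω : Set ℂ) (e : Fin C.numEdges) : Prop := C.IsSide σ Ω e (C.len e / 2)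

lemma isSide_iff_adj {Ω : Set ℂ} (hΩ : C.IsPiece Ω) {e : Fin C.numEdges} {σ t : ℝ}
    (hσ : σ = 1 ∨ σ = -1) (ht : t ∈ C.interiorParams e) : C.IsSide σ Ω e t ↔ C.Adj σ Ω e :=
  ⟨isSide_congr hΩ hσ ht (half_mem_interiorParams e),
    isSide_congr hΩ hσ (half_mem_interiorParams e) ht⟩

lemma endSign_eq (ε : Fin C.numEdges × Bool) : C.endSign ε = 1 ∨ C.endSign ε = -1 := by
  unfold CurveSystem.endSign
  split_ifs <;> simp

lemma neg_endSign_eq (ε : Fin C.numEdges × Bool) : -C.endSign ε = 1 ∨ -C.endSign ε = -1 := by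
  unfold CurveSystem.endSign
  split_ifs <;> simp

lemma adj_mono {Ω Ω' : Set ℂ} (h : Ω ⊆ Ω') {e : Fin C.numEdges} {σ : ℝ} (ha : C.Adj σ Ω e) :
    C.Adj σ Ω' e := Filter.Eventually.mono ha fun _ hs => h hs

lemma inter_nonempty_of_adj {Ω Ω' : Set ℂ} {e : Fin C.numEdges} {σ : ℝ} (h : C.Adj σ Ω e)
    (h' : C.Adj σ Ω' e) : (Ω ∩ Ω').Nonempty :=
  let ⟨_, hs⟩ := (h.and h').exists
  ⟨_, hs⟩

lemma adj_left (e : Fin C.numEdges) : C.Adj 1 (C.region (C.left e)) e := by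
  have := C.left_side e _ (Ioo_subset_openParams e (half_mem_Ioo e))
  simpa [Adj, IsSide] using this

lemma adj_right (e : Fin C.numEdges) : C.Adj (-1) (C.region (C.right e)) e := by
  have := C.right_side e _ (Ioo_subset_openParams e (half_mem_Ioo e))
  simpa [Adj, IsSide, sub_eq_add_neg] using this

lemma region_eq_of_adj {e : Fin C.numEdges} {σ : ℝ} {i j : Fin n} (h : C.Adj σ (C.region i) e)
    (h' : C.Adj σ (C.region j) e) : i = j := by
  by_contra hne
  obtain ⟨x, hx, hx'⟩ := inter_nonempty_of_adj h h'
  exact disjoint_left.1 (C.region_disjoint i j hne) hx hx'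

variable (C) in
/-- The region on the left of an edge that leaves its given end. -/
def leftOf (ε : Fin C.numEdges × Bool) : Fin n := if ε.2 then C.right ε.1 else C.left ε.1

variable (C) in
/-- The region on the right of an edge that leaves its given end. -/
def rightOf (ε : Fin C.numEdges × Bool) : Fin n := if ε.2 then C.left ε.1 else C.right ε.1

lemma leftOf_ne_rightOf (ε : Fin C.numEdges × Bool) : C.leftOf ε ≠ C.rightOf ε := by
  unfold leftOf rightOf
  split_ifs
  exacts [(C.left_ne_right _).symm, C.left_ne_right _]

lemma adj_leftOf (ε : Fin C.numEdges × Bool) :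
    C.Adj (C.endSign ε) (C.region (C.leftOf ε)) ε.1 := by
  unfold leftOf CurveSystem.endSign
  split_ifs
  exacts [adj_right _, adj_left _]

lemma adj_rightOf (ε : Fin C.numEdges × Bool) :
    C.Adj (-C.endSign ε) (C.region (C.rightOf ε)) ε.1 := by
  unfold rightOf CurveSystem.endSign
  split_ifs
  · rw [neg_neg]; exact adj_left _
  · exact adj_right _

/-! ### Vertices -/

/-- The three edges that meet at an interior vertex. -/
lemma IsStationary.exists_endsAt_eq (hC : C.IsStationary) {ε : Fin C.numEdges × Bool} {x : ℂ}
    (hx : ‖x‖ < 1) (hε : ε ∈ C.endsAt x) : ∃ ε' ε'', C.endsAt x = {ε, ε', ε''} ∧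
      ε ≠ ε' ∧ ε ≠ ε'' ∧ ε' ≠ ε'' ∧ C.conormal ε' = zeta * C.conormal ε ∧
        C.conormal ε'' = zeta * C.conormal ε' ∧ C.conormal ε = zeta * C.conormal ε'' := by
  classical
  have h3 : (C.endsAt x).card = 3 := by
    obtain ⟨h1, rfl⟩ := mem_endsAt.1 hε
    exact C.interior_vertex ε h1 hx
  have h2 : ((C.endsAt x).erase ε).card = 2 := by
    rw [Finset.card_erase_of_mem hε, h3]
  obtain ⟨a, b, hab, hE⟩ := Finset.card_eq_two.1 h2
  have ha : a ≠ ε := (Finset.mem_erase.1 (by rw [hE]; simp : a ∈ (C.endsAt x).erase ε)).1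
  have hb : b ≠ ε := (Finset.mem_erase.1 (by rw [hE]; simp : b ∈ (C.endsAt x).erase ε)).1
  have hE' : C.endsAt x = {ε, a, b} := by rw [← hE, Finset.insert_erase hε]
  have hsum := hC.sum_conormal hx
  rw [hE', Finset.sum_insert (by simp [ha.symm, hb.symm]), Finset.sum_pair hab, ← add_assoc] at hsum
  rcases equilibrium_of_unit_vectors (norm_conormal _) (norm_conormal _) (norm_conormal _) hsum with
    ⟨h4, h5⟩ | ⟨h4, h5⟩
  · refine ⟨a, b, hE', ha.symm, hb.symm, hab, h4, h5, ?_⟩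
    rw [h5, h4]
    linear_combination (-C.conormal ε) * zeta_cube
  · refine ⟨b, a, by rw [hE', Finset.pair_comm], hb.symm, ha.symm, hab.symm, h4, h5, ?_⟩
    rw [h5, h4]
    linear_combination (-C.conormal ε) * zeta_cube

lemma IsStationary.re_conormal (hC : C.IsStationary) {ε ε' : Fin C.numEdges × Bool} {x : ℂ}
    (hx : ‖x‖ < 1) (hε : ε ∈ C.endsAt x) (hε' : ε' ∈ C.endsAt x) (hne : ε' ≠ ε) :
    (C.conormal ε' * starRingEnd ℂ (C.conormal ε)).re = -1 / 2 := by
  obtain ⟨a, b, hE, -, -, -, h1, h2, -⟩ := hC.exists_endsAt_eq hx hε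
  have hu := mul_conj_of_norm_one (norm_conormal (C := C) ε)
  rw [hE] at hε'
  simp only [Finset.mem_insert, Finset.mem_singleton, hne, false_or] at hε'
  rcases hε' with rfl | rfl
  · rw [h1, mul_assoc, hu, mul_one, zeta_re]
  · rw [h2, h1, mul_assoc, mul_assoc, hu, mul_one, ← conj_zeta, Complex.conj_re, zeta_re]

variable (C) in
/-- Fermi coordinates along an edge, starting from one of its ends. -/
def endTube (ε : Fin C.numEdges × Bool) (z : ℂ) : ℂ := C.tube ε.1 (C.endParam ε) (C.endSign ε) z

lemma endTube_zero (ε : Fin C.numEdges × Bool) : C.endTube ε 0 = C.endPoint ε := tube_zero _ _ _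

lemma endTube_ofReal (ε : Fin C.numEdges × Bool) (t : ℝ) :
    C.endTube ε t = C.curve ε.1 (C.endParam ε + C.endSign ε * t) := tube_ofReal _ _ _ _

lemma continuous_endTube (ε : Fin C.numEdges × Bool) : Continuous (C.endTube ε) :=
  continuous_tube _ _ _

lemma exists_endTube_estimate (ε : Fin C.numEdges × Bool) {η : ℝ} (hη : 0 < η) :
    ∃ r > 0, ∀ z w : ℂ, ‖z‖ < r → ‖w‖ < r →
      ‖C.endTube ε z - C.endTube ε w - C.conormal ε * (z - w)‖ ≤ η * ‖z - w‖ :=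
  exists_tube_estimate ε.1 _ _ hη

lemma endTube_image_mem_nhds (ε : Fin C.numEdges × Bool) {r : ℝ} (hr : 0 < r) :
    C.endTube ε '' Metric.ball 0 r ∈ 𝓝 (C.endPoint ε) :=
  tube_image_mem_nhds (norm_conormal ε) hr

lemma endParam_add_mem {ε : Fin C.numEdges × Bool} {t : ℝ} (ht : 0 < t)
    (ht' : t < C.len ε.1) : C.endParam ε + C.endSign ε * t ∈ Ioo 0 (C.len ε.1) := by
  unfold CurveSystem.endParam CurveSystem.endSign
  split_ifs <;> constructor <;> linarith

/-- The part of a short cone around an edge at a vertex that lies on the graph is the edge. -/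
lemma IsStationary.exists_cone (hC : C.IsStationary) {ε : Fin C.numEdges × Bool}
    (hε : ε ∈ C.ends) (hx : ‖C.endPoint ε‖ < 1) : ∃ r > 0, ∀ z : ℂ, ‖z‖ < r → 0 < z.re →
      |z.im| < 2 * z.re → C.endTube ε z ∈ Metric.ball 0 1 ∧ (C.endTube ε z ∈ C.support → z.im = 0) := by
  have hεx : ε ∈ C.endsAt (C.endPoint ε) := mem_endsAt.2 ⟨hε, rfl⟩
  -- Near the vertex every edge is within relative error 1/10 of its tangent ray; this suffices to
  -- separate the cone from the other two edges.
  choose ρ hρ hE using fun ε' : Fin C.numEdges × Bool =>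
    exists_endTube_estimate (C := C) ε' (η := 1 / 10) (by norm_num)
  obtain ⟨δ, hδ, hδρ⟩ : ∃ δ > 0, ∀ ε', δ ≤ ρ ε' := by
    have : ∀ᶠ δ : ℝ in 𝓝[>] 0, ∀ ε', δ ≤ ρ ε' := by
      rw [eventually_all]
      intro ε'
      exact nhdsWithin_le_nhds (ge_mem_nhds (hρ ε'))
    obtain ⟨δ, h1, h2⟩ := (this.and self_mem_nhdsWithin).exists
    exact ⟨δ, h2, h1⟩
  have hcont := (continuous_endTube ε).continuousAt (x := 0)
  have hev := hcont.eventually (by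
    rw [endTube_zero]
    exact (eventually_near_endPoint hε hδ).and
      (Metric.isOpen_ball.mem_nhds (by simpa using hx : C.endPoint ε ∈ Metric.ball (0 : ℂ) 1)))
  obtain ⟨r, hr, hrb⟩ := Metric.eventually_nhds_iff_ball.1 hev
  refine ⟨min r δ, lt_min hr hδ, fun z hz hre him => ?_⟩
  obtain ⟨h1, h2⟩ := hrb z (by simpa using hz.trans_le (min_le_left _ _))
  refine ⟨h2, fun hs => ?_⟩
  obtain ⟨ε', hε', t, ht0, htδ, -, ht⟩ := h1 hs
  rw [← endTube_ofReal] at ht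
  have hzδ := hz.trans_le (min_le_right r δ)
  have htn : ‖(t : ℂ)‖ = t := by rw [Complex.norm_real, Real.norm_eq_abs, abs_of_nonneg ht0]
  by_cases hne : ε' = ε
  · subst hne
    have := hE ε' z t (hzδ.trans_le (hδρ _)) (by rw [htn]; exact htδ.trans_le (hδρ _))
    rw [ht, sub_self, zero_sub, norm_neg, norm_mul, norm_conormal, one_mul] at this
    have h0 : ‖z - t‖ ≤ 0 := by linarith [norm_nonneg (z - t)]
    have h4 := sub_eq_zero.1 (norm_le_zero_iff.1 h0)
    rw [h4, Complex.ofReal_im]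
  -- A common point of the cone and another edge is impossible: the linear parts differ by at least
  -- Re z + t/2, because that edge has cosine -1/2 with this one. The errors allow at most (|z| +
  -- t)/10, and |z| ≤ 3 Re z in the cone.
  · exfalso
    have e1 := hE ε z 0 (hzδ.trans_le (hδρ _)) (by simpa using hρ ε)
    have e2 := hE ε' t 0 (by rw [htn]; exact htδ.trans_le (hδρ _)) (by simpa using hρ ε')
    rw [endTube_zero, sub_zero] at e1 e2
    rw [htn, (mem_endsAt.1 hε').2, ht] at e2
    have hd : ‖C.conormal ε * z - C.conormal ε' * t‖ ≤ 1 / 10 * (‖z‖ + t) := by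
      have := norm_sub_le (C.endTube ε z - C.endPoint ε - C.conormal ε' * t)
        (C.endTube ε z - C.endPoint ε - C.conormal ε * z)
      rw [show C.endTube ε z - C.endPoint ε - C.conormal ε' * t -
        (C.endTube ε z - C.endPoint ε - C.conormal ε * z) =
          C.conormal ε * z - C.conormal ε' * t by ring] at this
      linarith
    have hre' : z.re + t / 2 ≤ ‖C.conormal ε * z - C.conormal ε' * t‖ := by
      have h5 := Complex.re_le_norm ((C.conormal ε * z - C.conormal ε' * t) *
        starRingEnd ℂ (C.conormal ε))
      rw [norm_mul, RCLike.norm_conj, norm_conormal, mul_one] at h5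
      have h6 : ((C.conormal ε * z - C.conormal ε' * t) * starRingEnd ℂ (C.conormal ε)) =
          z - t * (C.conormal ε' * starRingEnd ℂ (C.conormal ε)) := by
        linear_combination z * mul_conj_of_norm_one (norm_conormal (C := C) ε)
      rw [h6, Complex.sub_re, Complex.re_ofReal_mul, hC.re_conormal hx hεx hε' hne] at h5
      linarith
    have hzn : ‖z‖ ≤ 3 * z.re := by
      have := Complex.norm_le_abs_re_add_abs_im z
      rw [abs_of_pos hre] at this
      linarith
    linarith

/-- A piece near an edge at a vertex. -/
lemma IsStationary.exists_cone_chart (hC : C.IsStationary) {ε : Fin C.numEdges × Bool}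
    (hε : ε ∈ C.ends) (hx : ‖C.endPoint ε‖ < 1) : ∃ r > 0, ∀ z : ℂ, ‖z‖ < r → 0 < z.re →
      |z.im| < 2 * z.re → ∀ Ω, C.IsPiece Ω → (C.endTube ε z ∈ Ω ↔
        (0 < z.im ∧ C.Adj (C.endSign ε) Ω ε.1) ∨ (z.im < 0 ∧ C.Adj (-C.endSign ε) Ω ε.1)) := by
  obtain ⟨r₀, hr₀, hcone⟩ := hC.exists_cone hε hx
  have hl := C.len_pos ε.1
  refine ⟨min r₀ (C.len ε.1), lt_min hr₀ hl, fun z hz hre him Ω hΩ => ?_⟩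
  have hzr := hz.trans_le (min_le_left _ _)
  have hzl := hz.trans_le (min_le_right _ _)
  -- The two open halves of the cone are convex and miss the graph. The slope 2 exceeds tan(π/3) =
  -- √3, so the cones of the three edges overlap and cover the directions at the vertex.
  set H : ℝ → Set ℂ := fun τ => Metric.ball 0 r₀ ∩ {w | 0 < τ * w.im} ∩
    ({w | 0 < w.re} ∩ ({w | 0 < 2 * w.re - w.im} ∩ {w | 0 < 2 * w.re + w.im})) with hHdef
  have hHc : ∀ τ, Convex ℝ (H τ) := by
    intro τ
    refine ((convex_ball _ _).inter (convex_halfSpace_gt (f := fun z : ℂ => τ * z.im) ?_ 0)).inter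
      ((convex_halfSpace_gt (f := fun z : ℂ => z.re) ?_ 0).inter
        ((convex_halfSpace_gt (f := fun z : ℂ => 2 * z.re - z.im) ?_ 0).inter
          (convex_halfSpace_gt (f := fun z : ℂ => 2 * z.re + z.im) ?_ 0)))
    all_goals
      constructor
      · intro x y
        simp only [Complex.add_re, Complex.add_im]
        try ring
      · intro c x
        simp only [Complex.real_smul, Complex.mul_im, Complex.mul_re, Complex.ofReal_re,
          Complex.ofReal_im, smul_eq_mul]
        ring
  have hside : ∀ τ : ℝ, τ = 1 ∨ τ = -1 → 0 < τ * z.im →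
      (C.endTube ε z ∈ Ω ↔ C.Adj (C.endSign ε * τ) Ω ε.1) := by
    intro τ hτ hτz
    set u := min r₀ (C.len ε.1) / 2 with hu
    have hu0 : 0 < u := half_pos (lt_min hr₀ hl)
    have hur : u < r₀ := by have := min_le_left r₀ (C.len ε.1); rw [hu]; linarith
    have hul : u < C.len ε.1 := by have := min_le_right r₀ (C.len ε.1); rw [hu]; linarith
    rw [endTube, hΩ.tube_mem_iff (u := u) (τ := τ) (hHc τ).isPreconnected, isSide_iff_adj hΩ]
    · rcases hτ with rfl | rfl
      · rw [mul_one]; exact endSign_eq ε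
      · rw [mul_neg_one]; exact neg_endSign_eq ε
    · exact Ioo_subset_interiorParams _ (endParam_add_mem hu0 hul)
    · rintro w ⟨⟨hw1, hw2⟩, hw3, hw4, hw5⟩
      simp only [mem_ofPred_eq] at hw2 hw3 hw4 hw5
      have := hcone w (by simpa using hw1) hw3 (abs_lt.2 ⟨by linarith, by linarith⟩)
      refine ⟨this.1, fun hs => ?_⟩
      rw [this.2 hs, mul_zero] at hw2
      exact lt_irrefl _ hw2
    · have h1 : ∀ᶠ s : ℝ in 𝓝[>] 0, s < 2 * u := nhdsWithin_le_nhds (gt_mem_nhds (by linarith))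
      filter_upwards [eventually_mk_norm_lt (u := u) (r := r₀) (τ := τ)
        (by rwa [abs_of_pos hu0]), self_mem_nhdsWithin, h1] with s hs hs0 hs1
      have hs0 : (0 : ℝ) < s := hs0
      refine ⟨⟨by simpa using hs, ?_⟩, ?_, ?_, ?_⟩
      · show 0 < τ * (τ * s)
        rcases hτ with rfl | rfl <;> simpa using hs0
      · exact hu0
      · show 0 < 2 * u - τ * s
        rcases hτ with rfl | rfl <;> linarith
      · show 0 < 2 * u + τ * s
        rcases hτ with rfl | rfl <;> linarith
    · obtain ⟨h1, h2⟩ := abs_lt.1 him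
      refine ⟨⟨by simpa using hzr, hτz⟩, hre, ?_, ?_⟩
      · show 0 < 2 * z.re - z.im
        linarith
      · show 0 < 2 * z.re + z.im
        linarith
  rcases lt_trichotomy z.im 0 with h | h | h
  · rw [hside (-1) (Or.inr rfl) (by linarith), mul_neg_one]
    simp [h, h.le]
  · have : C.endTube ε z ∈ C.support := by
      have hz' : z = (z.re : ℂ) := Complex.ext rfl (by simpa using h)
      have : z.re < C.len ε.1 := (Complex.re_le_norm z).trans_lt hzl
      rw [hz', endTube_ofReal]
      exact curve_mem_support (Ioo_subset_interiorParams _ (endParam_add_mem hre this))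
    simp only [h, lt_irrefl, false_and, or_false, iff_false]
    exact fun hm => not_mem_support_of_isPiece hΩ hm this
  · rw [hside 1 (Or.inl rfl) (by linarith), mul_one]
    simp [h, h.le]

/-- Points near a vertex in the directions of an edge have Fermi coordinates along it. -/
lemma eventually_exists_endTube_eq (ε : Fin C.numEdges × Bool) {r : ℝ} (hr : 0 < r) :
    ∀ᶠ y in 𝓝 (C.endPoint ε), y ≠ C.endPoint ε →
      ‖y - C.endPoint ε‖ / 2 ≤ ((y - C.endPoint ε) * starRingEnd ℂ (C.conormal ε)).re →
      ∃ z : ℂ, ‖z‖ < r ∧ 0 < z.re ∧ |z.im| < 2 * z.re ∧ C.endTube ε z = y ∧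
        ‖(y - C.endPoint ε) * starRingEnd ℂ (C.conormal ε) - z‖ ≤ 1 / 100 * ‖z‖ := by
  obtain ⟨ρ, hρ, hE⟩ := exists_endTube_estimate ε (η := 1 / 100) (by norm_num)
  filter_upwards [endTube_image_mem_nhds ε (lt_min hr hρ)] with y hy hyx hre
  obtain ⟨z, hz, rfl⟩ := hy
  have hz : ‖z‖ < min r ρ := by simpa using hz
  have h1 := hE z 0 (hz.trans_le (min_le_right _ _)) (by simpa using hρ)
  rw [endTube_zero, sub_zero] at h1
  set w := (C.endTube ε z - C.endPoint ε) * starRingEnd ℂ (C.conormal ε) with hw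
  have hwz : ‖w - z‖ ≤ 1 / 100 * ‖z‖ := by
    have : w - z = (C.endTube ε z - C.endPoint ε - C.conormal ε * z) *
        starRingEnd ℂ (C.conormal ε) := by
      linear_combination z * mul_conj_of_norm_one (norm_conormal (C := C) ε)
    rw [this, norm_mul, RCLike.norm_conj, norm_conormal, mul_one]
    exact h1
  have hwn : ‖w‖ = ‖C.endTube ε z - C.endPoint ε‖ := by
    rw [hw, norm_mul, RCLike.norm_conj, norm_conormal, mul_one]
  rw [← hwn] at hre
  have hz0 : 0 < ‖z‖ := by
    rw [norm_pos_iff]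
    rintro rfl
    exact hyx (endTube_zero ε)
  have h2 : ‖z‖ ≤ ‖w‖ + 1 / 100 * ‖z‖ := by
    have := norm_sub_norm_le z w
    rw [norm_sub_rev] at this
    linarith
  have h3 : w.re - z.re ≤ 1 / 100 * ‖z‖ := by
    have := Complex.re_le_norm (w - z)
    rw [Complex.sub_re] at this
    linarith
  -- The cosine 1/2 loses at most 2/100 under the nonlinearity, and 5 · 0.48² > 1 keeps z in the
  -- cone of slope 2.
  have h4 : 48 / 100 * ‖z‖ ≤ z.re := by linarith
  refine ⟨z, hz.trans_le (min_le_left _ _), by linarith, ?_, rfl, hwz⟩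
  have h5 : ‖z‖ ^ 2 = z.re * z.re + z.im * z.im := by
    rw [← Complex.normSq_apply, Complex.normSq_eq_norm_sq]
  apply abs_lt_of_sq_lt_sq _ (by linarith)
  nlinarith

/-- Going around a vertex, the left side of an edge is the right side of the next one. -/
lemma IsStationary.adj_next (hC : C.IsStationary) {ε ε' : Fin C.numEdges × Bool} {x : ℂ}
    (hx : ‖x‖ < 1) (hε : ε ∈ C.endsAt x) (hε' : ε' ∈ C.endsAt x)
    (h : C.conormal ε' = zeta * C.conormal ε) {Ω : Set ℂ} (hΩ : C.IsPiece Ω) :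
    C.Adj (C.endSign ε) Ω ε.1 ↔ C.Adj (-C.endSign ε') Ω ε'.1 := by
  obtain ⟨h1, hp⟩ := mem_endsAt.1 hε
  obtain ⟨h1', hp'⟩ := mem_endsAt.1 hε'
  obtain ⟨r, hr, hch⟩ := hC.exists_cone_chart h1 (by rwa [hp])
  obtain ⟨r', hr', hch'⟩ := hC.exists_cone_chart h1' (by rwa [hp'])
  -- The bisector of the two edges, again a unit vector. A point of the graph's complement in this
  -- direction lies in both cones, on the left of ε and on the right of ε', which links the two side
  -- conditions.
  set v := (1 + zeta) * C.conormal ε with hv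
  have ev := eventually_exists_endTube_eq ε hr
  have ev' := eventually_exists_endTube_eq ε' hr'
  rw [hp] at ev
  rw [hp'] at ev'
  have hu := mul_conj_of_norm_one (norm_conormal (C := C) ε)
  have hlim : Tendsto (fun s : ℝ => x + (s : ℂ) * v) (𝓝[>] 0) (𝓝 x) := by
    have h0 : Continuous fun s : ℝ => x + (s : ℂ) * v := by fun_prop
    have h1 := h0.tendsto 0
    rw [Complex.ofReal_zero, zero_mul, add_zero] at h1
    exact h1.mono_left nhdsWithin_le_nhds
  have hev := hlim.eventually (ev.and ev')
  obtain ⟨s, ⟨hs, hs'⟩, hs0⟩ := (hev.and self_mem_nhdsWithin).exists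
  have hs0 : (0 : ℝ) < s := hs0
  have hs3 := sq_sqrt_three
  have hpos3 : (1 : ℝ) < √3 := by rw [Real.lt_sqrt] <;> norm_num
  have hvn : ‖v‖ = 1 := by
    rw [hv, norm_mul, norm_conormal, mul_one, norm_one_iff]
    simp only [Complex.add_re, Complex.add_im, Complex.one_re, Complex.one_im, zeta_re, zeta_im]
    linarith
  have hsn : ‖x + (s : ℂ) * v - x‖ = s := by
    rw [add_sub_cancel_left, norm_mul, hvn, mul_one, Complex.norm_real, Real.norm_eq_abs,
      abs_of_pos hs0]
  have hne : x + (s : ℂ) * v ≠ x := by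
    intro h0
    rw [h0, sub_self, norm_zero] at hsn
    linarith
  have hw : (x + (s : ℂ) * v - x) * starRingEnd ℂ (C.conormal ε) = (s : ℂ) * (1 + zeta) := by
    rw [hv]
    linear_combination (s : ℂ) * (1 + zeta) * hu
  have hw' : (x + (s : ℂ) * v - x) * starRingEnd ℂ (C.conormal ε') =
      (s : ℂ) * (1 + zeta * zeta) := by
    rw [hv, h, map_mul, conj_zeta]
    linear_combination (s : ℂ) * (1 + zeta) * (zeta * zeta) * hu + (s : ℂ) * zeta_cube
  have hzz : zeta * zeta = starRingEnd ℂ zeta := conj_zeta.symm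
  obtain ⟨z, hzr, hz0, hzi, hzy, hzw⟩ := hs hne (by
    rw [hw, hsn, Complex.re_ofReal_mul, Complex.add_re, Complex.one_re, zeta_re]
    linarith)
  obtain ⟨z', hzr', hz0', hzi', hzy', hzw'⟩ := hs' hne (by
    rw [hw', hzz, hsn, Complex.re_ofReal_mul, Complex.add_re, Complex.one_re, Complex.conj_re,
      zeta_re]
    linarith)
  have hwn : ‖(s : ℂ) * (1 + zeta)‖ = s := by
    rw [← hw, norm_mul, hsn, RCLike.norm_conj, norm_conormal, mul_one]
  have hwn' : ‖(s : ℂ) * (1 + zeta * zeta)‖ = s := by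
    rw [← hw', norm_mul, hsn, RCLike.norm_conj, norm_conormal, mul_one]
  rw [hw] at hzw
  rw [hw'] at hzw'
  have him : 0 < z.im := by
    have h5 := norm_sub_norm_le z ((s : ℂ) * (1 + zeta))
    rw [norm_sub_rev, hwn] at h5
    have h6 := (abs_le.1 ((Complex.abs_im_le_norm _).trans hzw)).2
    rw [Complex.sub_im, Complex.im_ofReal_mul, Complex.add_im, Complex.one_im, zeta_im] at h6
    nlinarith
  have him' : z'.im < 0 := by
    have h5 := norm_sub_norm_le z' ((s : ℂ) * (1 + zeta * zeta))
    rw [norm_sub_rev, hwn'] at h5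
    have h6 := (abs_le.1 ((Complex.abs_im_le_norm _).trans hzw')).1
    rw [hzz, Complex.sub_im, Complex.im_ofReal_mul, Complex.add_im, Complex.one_im,
      Complex.conj_im, zeta_im] at h6
    nlinarith
  have e1 := hch z hzr hz0 hzi Ω hΩ
  have e2 := hch' z' hzr' hz0' hzi' Ω hΩ
  rw [hzy] at e1
  rw [hzy', e1] at e2
  simpa [him, him.le, him', him'.le, not_lt.2 him.le, not_lt.2 him'.le] using e2

lemma IsStationary.leftOf_eq_rightOf (hC : C.IsStationary) {ε ε' : Fin C.numEdges × Bool} {x : ℂ}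
    (hx : ‖x‖ < 1) (hε : ε ∈ C.endsAt x) (hε' : ε' ∈ C.endsAt x)
    (h : C.conormal ε' = zeta * C.conormal ε) : C.leftOf ε = C.rightOf ε' :=
  region_eq_of_adj ((hC.adj_next hx hε hε' h (isPiece_region _)).1 (adj_leftOf ε)) (adj_rightOf ε')

/-- The directions of the edges at a vertex cover all directions. -/
lemma IsStationary.exists_near_direction (hC : C.IsStationary) {x : ℂ} (hx : ‖x‖ < 1)
    {ε : Fin C.numEdges × Bool} (hε : ε ∈ C.endsAt x) (y : ℂ) :
    ∃ ε' ∈ C.endsAt x, ‖y - x‖ / 2 ≤ ((y - x) * starRingEnd ℂ (C.conormal ε')).re := by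
  obtain ⟨a, b, hE, -, -, -, h1, h2, -⟩ := hC.exists_endsAt_eq hx hε
  have := exists_re_ge_half ((y - x) * starRingEnd ℂ (C.conormal ε))
  rw [norm_mul, RCLike.norm_conj, norm_conormal, mul_one] at this
  rcases this with h | h | h
  · exact ⟨ε, hε, h⟩
  · refine ⟨a, by rw [hE]; simp, ?_⟩
    rw [h1, map_mul, mul_comm (starRingEnd ℂ zeta), ← mul_assoc]
    exact h
  · refine ⟨b, by rw [hE]; simp, ?_⟩
    rw [h2, h1, ← mul_assoc, map_mul, mul_comm (starRingEnd ℂ (zeta * zeta)), ← mul_assoc]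
    exact h

/-- Points near a vertex have Fermi coordinates along one of the edges that meet there. -/
lemma IsStationary.eventually_exists_cone (hC : C.IsStationary) {x : ℂ} (hx : ‖x‖ < 1)
    {ε : Fin C.numEdges × Bool} (hε : ε ∈ C.endsAt x) {r : ℝ} (hr : 0 < r) :
    ∀ᶠ y in 𝓝 x, y ≠ x → ∃ ε' ∈ C.endsAt x, ∃ z : ℂ, ‖z‖ < r ∧ 0 < z.re ∧ |z.im| < 2 * z.re ∧
      C.endTube ε' z = y := by
  have : ∀ᶠ y in 𝓝 x, ∀ ε' : Fin C.numEdges × Bool, ε' ∈ C.endsAt x → y ≠ x →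
      ‖y - x‖ / 2 ≤ ((y - x) * starRingEnd ℂ (C.conormal ε')).re →
      ∃ z : ℂ, ‖z‖ < r ∧ 0 < z.re ∧ |z.im| < 2 * z.re ∧ C.endTube ε' z = y := by
    rw [eventually_all]
    intro ε'
    by_cases hε' : ε' ∈ C.endsAt x
    · have h := eventually_exists_endTube_eq ε' hr
      rw [(mem_endsAt.1 hε').2] at h
      filter_upwards [h] with y hy _ h1 h2
      obtain ⟨z, a, b, c, d, -⟩ := hy h1 h2
      exact ⟨z, a, b, c, d⟩
    · exact Eventually.of_forall fun y h => absurd h hε'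
  filter_upwards [this] with y hy hne
  obtain ⟨ε', hε', h⟩ := hC.exists_near_direction hx hε y
  exact ⟨ε', hε', hy ε' hε' hne h⟩

/-! ### Pushing the boundary of a component inwards -/

open Classical in
variable (C) in
/-- `1` if the set lies along the edge, on the side given by the sign, `0` otherwise. -/
def adjInd (σ : ℝ) (Ω : Set ℂ) (e : Fin C.numEdges) : ℝ := if C.Adj σ Ω e then 1 else 0

variable (C) in
/-- The normal component of the variation that moves the boundary of a set with unit speed. -/
def pushIn (Ω : Set ℂ) (e : Fin C.numEdges) : ℝ := C.adjInd 1 Ω e - C.adjInd (-1) Ω e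

lemma adjInd_congr {Ω : Set ℂ} {σ σ' : ℝ} {e e' : Fin C.numEdges}
    (h : C.Adj σ Ω e ↔ C.Adj σ' Ω e') : C.adjInd σ Ω e = C.adjInd σ' Ω e' := by
  by_cases hc : C.Adj σ Ω e
  · simp [adjInd, hc, h.1 hc]
  · simp [adjInd, hc, mt h.2 hc]

lemma adjInd_nonneg (σ : ℝ) (Ω : Set ℂ) (e : Fin C.numEdges) : 0 ≤ C.adjInd σ Ω e := by
  unfold adjInd
  split_ifs <;> norm_num

lemma endSign_mul_pushIn (Ω : Set ℂ) (ε : Fin C.numEdges × Bool) :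
    C.endSign ε * C.pushIn Ω ε.1 =
      C.adjInd (C.endSign ε) Ω ε.1 - C.adjInd (-C.endSign ε) Ω ε.1 := by
  unfold pushIn CurveSystem.endSign
  split_ifs
  · rw [neg_neg]; ring
  · ring

lemma leftOf_eq_of_adj {i : Fin n} {Ω : Set ℂ} (h : Ω ∈ C.components i)
    {ε : Fin C.numEdges × Bool} (ha : C.Adj (C.endSign ε) Ω ε.1) : C.leftOf ε = i :=
  region_eq_of_adj (adj_leftOf ε) (adj_mono (subset_region_of_mem_components h) ha)

lemma rightOf_eq_of_adj {i : Fin n} {Ω : Set ℂ} (h : Ω ∈ C.components i)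
    {ε : Fin C.numEdges × Bool} (ha : C.Adj (-C.endSign ε) Ω ε.1) : C.rightOf ε = i :=
  region_eq_of_adj (adj_rightOf ε) (adj_mono (subset_region_of_mem_components h) ha)

/-- A component lies in one region, and every edge separates two different regions. -/
lemma not_adj_both {i : Fin n} {Ω : Set ℂ} (h : Ω ∈ C.components i)
    {ε : Fin C.numEdges × Bool} (ha : C.Adj (C.endSign ε) Ω ε.1) :
    ¬ C.Adj (-C.endSign ε) Ω ε.1 := fun hb =>
  leftOf_ne_rightOf ε ((leftOf_eq_of_adj h ha).trans (rightOf_eq_of_adj h hb).symm)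

lemma adjInd_mul_adjInd_neg {i : Fin n} {Ω : Set ℂ} (h : Ω ∈ C.components i)
    (ε : Fin C.numEdges × Bool) :
    C.adjInd (C.endSign ε) Ω ε.1 * C.adjInd (-C.endSign ε) Ω ε.1 = 0 := by
  unfold adjInd
  split_ifs with h1 h2
  · exact absurd h2 (not_adj_both h h1)
  all_goals norm_num

lemma pushIn_sq {i : Fin n} {Ω : Set ℂ} (h : Ω ∈ C.components i)
    (ε : Fin C.numEdges × Bool) : C.pushIn Ω ε.1 ^ 2 =
      C.adjInd (C.endSign ε) Ω ε.1 + C.adjInd (-C.endSign ε) Ω ε.1 := by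
  have h1 : C.pushIn Ω ε.1 ^ 2 = (C.endSign ε * C.pushIn Ω ε.1) ^ 2 := by
    rcases endSign_eq ε with h | h <;> rw [h] <;> ring
  have h0 := adjInd_mul_adjInd_neg h ε
  have hi : ∀ σ, C.adjInd σ Ω ε.1 ^ 2 = C.adjInd σ Ω ε.1 := fun σ => by
    unfold adjInd
    split_ifs <;> norm_num
  rw [h1, endSign_mul_pushIn, sub_sq, hi, hi]
  linear_combination (-2) * h0

/-- The supports are disjoint: on the same side of an edge the two components would intersect, and
on opposite sides they would put one region on both sides. This makes the index form diagonal. -/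
lemma pushIn_mul_pushIn {i : Fin n} {Ω Ω' : Set ℂ} (h : Ω ∈ C.components i)
    (h' : Ω' ∈ C.components i) (hne : Ω ≠ Ω') (e : Fin C.numEdges) :
    C.pushIn Ω e * C.pushIn Ω' e = 0 := by
  have hd := disjoint_of_mem_components h h' hne
  have key : ∀ σ, C.Adj σ Ω e → ¬ C.Adj σ Ω' e := fun σ ha hb => by
    obtain ⟨x, hx, hx'⟩ := inter_nonempty_of_adj ha hb
    exact disjoint_left.1 hd hx hx'
  have e1 : ∀ {Ω}, Ω ∈ C.components i → C.Adj 1 Ω e → C.left e = i := fun h ha =>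
    region_eq_of_adj (adj_left e) (adj_mono (subset_region_of_mem_components h) ha)
  have e2 : ∀ {Ω}, Ω ∈ C.components i → C.Adj (-1) Ω e → C.right e = i := fun h ha =>
    region_eq_of_adj (adj_right e) (adj_mono (subset_region_of_mem_components h) ha)
  have key2 : C.Adj 1 Ω e → ¬ C.Adj (-1) Ω' e := fun ha hb =>
    C.left_ne_right e ((e1 h ha).trans (e2 h' hb).symm)
  have key3 : C.Adj (-1) Ω e → ¬ C.Adj 1 Ω' e := fun ha hb =>
    C.left_ne_right e ((e1 h' hb).trans (e2 h ha).symm)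
  unfold pushIn adjInd
  by_cases h1 : C.Adj 1 Ω e
  · simp [key _ h1, key2 h1]
  by_cases h2 : C.Adj (-1) Ω e
  · simp [key _ h2, key3 h2]
  simp [h1, h2]

/-- Each term is the left indicator minus the right one. The left side of an edge is the right side
of the next, so the sum around the vertex telescopes. -/
lemma IsStationary.sum_endsAt_pushIn (hC : C.IsStationary) {Ω : Set ℂ} (hΩ : C.IsPiece Ω) {x : ℂ}
    (hx : ‖x‖ < 1) {ε : Fin C.numEdges × Bool} (hε : ε ∈ C.endsAt x) :
    ∑ ε' ∈ C.endsAt x, C.endSign ε' * C.pushIn Ω ε'.1 = 0 := by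
  obtain ⟨a, b, hE, hne1, hne2, hne3, h1, h2, h3⟩ := hC.exists_endsAt_eq hx hε
  have ha : a ∈ C.endsAt x := by rw [hE]; simp
  have hb : b ∈ C.endsAt x := by rw [hE]; simp
  rw [hE, Finset.sum_insert (by simp [hne1, hne2]), Finset.sum_pair hne3]
  simp only [endSign_mul_pushIn]
  rw [adjInd_congr (hC.adj_next hx hε ha h1 hΩ), adjInd_congr (hC.adj_next hx ha hb h2 hΩ),
    adjInd_congr (hC.adj_next hx hb hε h3 hΩ)]
  ring

lemma isAdmissible_const {w : Fin C.numEdges → ℝ}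
    (hw : ∀ ε ∈ C.ends, ‖C.endPoint ε‖ < 1 →
      ∑ ε' ∈ C.endsAt (C.endPoint ε), C.endSign ε' * w ε'.1 = 0) :
    C.IsAdmissible fun e _ => w e where
  absCont e := ((LipschitzWith.const (w e)).lipschitzOnWith (s := uIcc 0 (C.len e)))
    |>.absolutelyContinuousOnInterval
  deriv_memLp e := by simp
  closed _ _ := rfl
  vertex := hw

/-! ### The index form on functions that are constant on every edge -/

open Classical in
variable (C) in
/-- The index form of a function with constant value on each edge, as a linear form in the squares
of the values. -/
def indexQuad (p : Fin n → ℝ) (W : Fin C.numEdges → ℝ) : ℝ :=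
  (∑ e, -(C.len e * (p (C.left e) - p (C.right e)) ^ 2 * W e)) +
    (∑ ε ∈ C.ends with ‖C.endPoint ε‖ < 1, C.q ε * W ε.1) -
    ∑ ε ∈ C.ends with ‖C.endPoint ε‖ = 1, W ε.1

lemma indexForm_const {p : Fin n → ℝ} (hp : C.IsPressure p) (w : Fin C.numEdges → ℝ) :
    C.indexForm (fun e _ => w e) (fun e _ => w e) = C.indexQuad p fun e => w e ^ 2 := by
  have h1 : ∀ e, ∫ t in (0 : ℝ)..C.len e, (deriv (fun _ : ℝ => w e) t * deriv (fun _ : ℝ => w e) t -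
      C.curvature e t ^ 2 * w e * w e) =
        -(C.len e * (p (C.left e) - p (C.right e)) ^ 2 * w e ^ 2) := by
    intro e
    rw [intervalIntegral.integral_congr
      (g := fun _ => -((p (C.left e) - p (C.right e)) ^ 2 * w e ^ 2))]
    · rw [intervalIntegral.integral_const, smul_eq_mul]
      ring
    · intro t ht
      rw [uIcc_of_le (C.len_pos e).le] at ht
      simp only [deriv_const, hp e t ht]
      ring
  simp only [indexForm, indexQuad, h1]
  simp only [mul_assoc, ← sq]

lemma indexQuad_sum (p : Fin n → ℝ) {ι : Type*} (s : Finset ι) (a : ι → ℝ)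
    (W : ι → Fin C.numEdges → ℝ) :
    C.indexQuad p (fun e => ∑ k ∈ s, a k * W k e) = ∑ k ∈ s, a k * C.indexQuad p (W k) := by
  simp only [indexQuad, mul_sub, mul_add, Finset.sum_add_distrib, Finset.sum_sub_distrib]
  congr 1
  · congr 1
    · simp only [Finset.mul_sum, ← Finset.sum_neg_distrib]
      rw [Finset.sum_comm]
      exact Finset.sum_congr rfl fun k _ => Finset.sum_congr rfl fun e _ => by ring
    · simp only [Finset.mul_sum]
      rw [Finset.sum_comm]
      exact Finset.sum_congr rfl fun k _ => Finset.sum_congr rfl fun e _ => by ring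
  · simp only [Finset.mul_sum]
    rw [Finset.sum_comm]

lemma curvatureIntoThird_self (ε : Fin C.numEdges × Bool) : C.curvatureIntoThird ε ε = 0 := by
  simp [curvatureIntoThird]

lemma left_right_cases (ε : Fin C.numEdges × Bool) :
    (C.left ε.1 = C.leftOf ε ∧ C.right ε.1 = C.rightOf ε) ∨
      (C.left ε.1 = C.rightOf ε ∧ C.right ε.1 = C.leftOf ε) := by
  unfold leftOf rightOf
  split_ifs <;> simp

/-- Here k is the third region and m the one that ε' shares with ε. The normal into k fixes the
sign, whatever the parametrisation of the edge of ε'. -/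
lemma curvatureIntoThird_eq {p : Fin n → ℝ} (hp : C.IsPressure p)
    {ε ε' : Fin C.numEdges × Bool} {k m : Fin n} (h1 : k ≠ C.leftOf ε) (h2 : k ≠ C.rightOf ε)
    (h3 : (C.leftOf ε' = k ∧ C.rightOf ε' = m) ∨ (C.leftOf ε' = m ∧ C.rightOf ε' = k))
    (h4 : m = C.leftOf ε ∨ m = C.rightOf ε) :
    C.curvatureIntoThird ε ε' = p k - p m := by
  have hk : k ≠ C.left ε.1 ∧ k ≠ C.right ε.1 := by
    rcases left_right_cases ε with ⟨h, h'⟩ | ⟨h, h'⟩ <;> rw [h, h'] <;> tauto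
  have hm : m = C.left ε.1 ∨ m = C.right ε.1 := by
    rcases left_right_cases ε with ⟨h, h'⟩ | ⟨h, h'⟩ <;> rw [h, h'] <;> tauto
  have h5 : (C.left ε'.1 = k ∧ C.right ε'.1 = m) ∨ (C.left ε'.1 = m ∧ C.right ε'.1 = k) := by
    rcases left_right_cases ε' with ⟨h, h'⟩ | ⟨h, h'⟩ <;> rw [h, h'] <;> tauto
  unfold curvatureIntoThird
  rw [hp ε'.1 _ (endParam_mem_Icc ε')]
  rcases h5 with ⟨h, h'⟩ | ⟨h, h'⟩
  · rw [if_pos (by rw [h]; exact hk), h, h']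
  · rw [if_neg (by rw [h]; tauto), if_pos (by rw [h']; exact hk), h, h']
    ring

/-- The sectors in cyclic order are those to the left of ε, ε' and ε''. The edge ε bounds the first
and the last, so the sector left of ε' is the third region. -/
lemma IsStationary.q_eq (hC : C.IsStationary) {p : Fin n → ℝ} (hp : C.IsPressure p) {x : ℂ}
    (hx : ‖x‖ < 1) {ε ε' ε'' : Fin C.numEdges × Bool} (hE : C.endsAt x = {ε, ε', ε''})
    (hne1 : ε ≠ ε') (hne2 : ε ≠ ε'') (hne3 : ε' ≠ ε'') (h1 : C.conormal ε' = zeta * C.conormal ε)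
    (h2 : C.conormal ε'' = zeta * C.conormal ε') (h3 : C.conormal ε = zeta * C.conormal ε'') :
    C.q ε = (2 * p (C.leftOf ε') - p (C.leftOf ε) - p (C.leftOf ε'')) / √3 := by
  have m1 : ε ∈ C.endsAt x := by rw [hE]; simp
  have m2 : ε' ∈ C.endsAt x := by rw [hE]; simp
  have m3 : ε'' ∈ C.endsAt x := by rw [hE]; simp
  have r1 := hC.leftOf_eq_rightOf hx m1 m2 h1
  have r2 := hC.leftOf_eq_rightOf hx m2 m3 h2
  have r3 := hC.leftOf_eq_rightOf hx m3 m1 h3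
  have n1 := leftOf_ne_rightOf ε
  have n2 := leftOf_ne_rightOf ε'
  have n3 := leftOf_ne_rightOf ε''
  rw [← r3] at n1
  rw [← r1] at n2
  rw [← r2] at n3
  rw [q, (mem_endsAt.1 m1).2, hE, Finset.sum_insert (by simp [hne1, hne2]), Finset.sum_pair hne3,
    curvatureIntoThird_self,
    curvatureIntoThird_eq hp (k := C.leftOf ε') (m := C.leftOf ε) n2 (by rw [← r3]; exact n3.symm)
      (Or.inl ⟨rfl, r1.symm⟩) (Or.inl rfl),
    curvatureIntoThird_eq hp (k := C.leftOf ε') (m := C.leftOf ε'') n2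
      (by rw [← r3]; exact n3.symm) (Or.inr ⟨rfl, r2.symm⟩) (Or.inr r3)]
  congr 1
  ring

/-- The contribution of a vertex to the index form is not positive at the region of largest
pressure. -/
lemma IsStationary.sum_q_pushIn_nonpos (hC : C.IsStationary) {p : Fin n → ℝ} (hp : C.IsPressure p)
    {i : Fin n} (hi : ∀ j, p j ≤ p i) {Ω : Set ℂ} (hΩ : Ω ∈ C.components i) {x : ℂ}
    (hx : ‖x‖ < 1) {ε : Fin C.numEdges × Bool} (hε : ε ∈ C.endsAt x) :
    ∑ ε' ∈ C.endsAt x, C.q ε' * C.pushIn Ω ε'.1 ^ 2 ≤ 0 := by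
  obtain ⟨a, b, hE, hne1, hne2, hne3, h1, h2, h3⟩ := hC.exists_endsAt_eq hx hε
  have ha : a ∈ C.endsAt x := by rw [hE]; simp
  have hb : b ∈ C.endsAt x := by rw [hE]; simp
  have hP := isPiece_of_mem_components hΩ
  have hE2 : C.endsAt x = {a, b, ε} := by rw [hE]; ext; simp; tauto
  have hE3 : C.endsAt x = {b, ε, a} := by rw [hE]; ext; simp; tauto
  rw [hE, Finset.sum_insert (by simp [hne1, hne2]), Finset.sum_pair hne3]
  rw [hC.q_eq hp hx hE hne1 hne2 hne3 h1 h2 h3, hC.q_eq hp hx hE2 hne3 hne1.symm hne2.symm h2 h3 h1,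
    hC.q_eq hp hx hE3 hne2.symm hne3.symm hne1 h3 h1 h2]
  simp only [pushIn_sq hΩ]
  rw [← adjInd_congr (hC.adj_next hx hε ha h1 hP), ← adjInd_congr (hC.adj_next hx ha hb h2 hP),
    ← adjInd_congr (hC.adj_next hx hb hε h3 hP)]
  -- Regrouping by sectors: the sector left of ε₁ enters through its two bounding edges, and their
  -- coefficients add up to the other two pressures minus twice its own, divided by √3.
  have key : ∀ (ε₁ : Fin C.numEdges × Bool) (j k : Fin n),
      C.adjInd (C.endSign ε₁) Ω ε₁.1 * (p j + p k - 2 * p (C.leftOf ε₁)) ≤ 0 := by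
    intro ε₁ j k
    unfold adjInd
    split_ifs with h
    · rw [leftOf_eq_of_adj hΩ h]
      linarith [hi j, hi k]
    · simp
  have e1 := key ε (C.leftOf a) (C.leftOf b)
  have e2 := key a (C.leftOf ε) (C.leftOf b)
  have e3 := key b (C.leftOf a) (C.leftOf ε)
  have hs : 0 < √3 := by positivity
  have : ∀ A B D u v w : ℝ, A / √3 * u + (B / √3 * v + D / √3 * w) = (A * u + B * v + D * w) / √3 := by
    intros; ring
  rw [this]
  apply div_nonpos_of_nonpos_of_nonneg _ hs.le
  linarith

/-! ### Flat components and the instability of the others -/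

variable (C) in
/-- A set all of whose adjacent edges have curvature zero and no ends on the unit circle. -/
structure IsFlat (p : Fin n → ℝ) (Ω : Set ℂ) : Prop where
  pressure_eq : ∀ e σ, σ = 1 ∨ σ = -1 → C.Adj σ Ω e → p (C.left e) = p (C.right e)
  norm_endPoint_ne : ∀ ε ∈ C.ends, ∀ σ, σ = 1 ∨ σ = -1 → C.Adj σ Ω ε.1 → ‖C.endPoint ε‖ ≠ 1

lemma pushIn_sq_pos {i : Fin n} {Ω : Set ℂ} (h : Ω ∈ C.components i) {e : Fin C.numEdges} {σ : ℝ}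
    (hσ : σ = 1 ∨ σ = -1) (ha : C.Adj σ Ω e) : 0 < C.pushIn Ω e ^ 2 := by
  have := pushIn_sq h (e, false)
  simp only [CurveSystem.endSign] at this
  rw [this]
  have h1 : C.adjInd σ Ω e = 1 := by simp [adjInd, ha]
  have h2 := adjInd_nonneg (C := C) 1 Ω e
  have h3 := adjInd_nonneg (C := C) (-1) Ω e
  simp only [Bool.false_eq_true, if_false]
  rcases hσ with rfl | rfl <;> linarith

/-- Components of a region of largest pressure that are not flat are unstable. -/
lemma IsStationary.indexQuad_neg (hC : C.IsStationary) {p : Fin n → ℝ} (hp : C.IsPressure p)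
    {i : Fin n} (hi : ∀ j, p j ≤ p i) {Ω : Set ℂ} (hΩ : Ω ∈ C.components i)
    (hflat : ¬ C.IsFlat p Ω) : C.indexQuad p (fun e => C.pushIn Ω e ^ 2) < 0 := by
  classical
  have t1 : ∀ e, -(C.len e * (p (C.left e) - p (C.right e)) ^ 2 * C.pushIn Ω e ^ 2) ≤ 0 := fun e => by
    have := (C.len_pos e).le
    have : 0 ≤ C.len e * (p (C.left e) - p (C.right e)) ^ 2 * C.pushIn Ω e ^ 2 := by positivity
    linarith
  have s2 : ∑ ε ∈ C.ends with ‖C.endPoint ε‖ < 1, C.q ε * C.pushIn Ω ε.1 ^ 2 ≤ 0 := by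
    rw [← Finset.sum_fiberwise_of_maps_to (g := C.endPoint)
      (t := (C.ends.filter fun ε => ‖C.endPoint ε‖ < 1).image C.endPoint)
      (fun ε hε => Finset.mem_image_of_mem _ hε)]
    refine Finset.sum_nonpos fun x hx => ?_
    obtain ⟨ε, hε, rfl⟩ := Finset.mem_image.1 hx
    obtain ⟨hε, hεx⟩ := Finset.mem_filter.1 hε
    refine (Finset.sum_congr (Finset.ext fun ε' => ?_) fun _ _ => rfl).trans_le
      (hC.sum_q_pushIn_nonpos hp hi hΩ hεx (mem_endsAt.2 ⟨hε, rfl⟩))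
    simp only [Finset.mem_filter, mem_endsAt]
    constructor
    · rintro ⟨⟨h1, -⟩, h2⟩
      exact ⟨h1, h2⟩
    · rintro ⟨h1, h2⟩
      exact ⟨⟨h1, by rwa [h2]⟩, h2⟩
  have s1 : ∑ e, -(C.len e * (p (C.left e) - p (C.right e)) ^ 2 * C.pushIn Ω e ^ 2) ≤ 0 :=
    Finset.sum_nonpos fun e _ => t1 e
  have s3 : 0 ≤ ∑ ε ∈ C.ends with ‖C.endPoint ε‖ = 1, C.pushIn Ω ε.1 ^ 2 :=
    Finset.sum_nonneg fun ε _ => sq_nonneg _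
  -- All three groups of terms are nonpositive, so a nonnegative total leaves no room for a curved
  -- edge or an end on the circle.
  by_contra hneg
  apply hflat
  unfold indexQuad at hneg
  constructor
  · intro e σ hσ ha
    by_contra hne
    have hlt : ∑ e, -(C.len e * (p (C.left e) - p (C.right e)) ^ 2 * C.pushIn Ω e ^ 2) < 0 := by
      refine Finset.sum_neg' (fun e _ => t1 e) ⟨e, Finset.mem_univ _, ?_⟩
      have h1 := pushIn_sq_pos hΩ hσ ha
      have h2 : 0 < (p (C.left e) - p (C.right e)) ^ 2 :=
        sq_pos_of_ne_zero (sub_ne_zero.2 hne)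
      have := C.len_pos e
      have : 0 < C.len e * (p (C.left e) - p (C.right e)) ^ 2 * C.pushIn Ω e ^ 2 := by positivity
      linarith
    apply hneg
    linarith
  · intro ε hε σ hσ ha h1
    have hlt : 0 < ∑ ε ∈ C.ends with ‖C.endPoint ε‖ = 1, C.pushIn Ω ε.1 ^ 2 :=
      Finset.sum_pos' (fun ε _ => sq_nonneg _)
        ⟨ε, Finset.mem_filter.2 ⟨hε, h1⟩, pushIn_sq_pos hΩ hσ ha⟩
    apply hneg
    linarith

lemma flux_const (w : Fin C.numEdges → ℝ) (j : Fin n) : C.flux (fun e _ => w e) j =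
    (∑ e with C.left e = j, C.len e * w e) - ∑ e with C.right e = j, C.len e * w e := by
  simp [flux]

lemma sum_flux_const (w : Fin C.numEdges → ℝ) : ∑ j, C.flux (fun e _ => w e) j = 0 := by
  have := C.sum_mul_flux (fun _ => 1) (fun e _ => w e)
  simpa using this

/-- In a stable graph there are less than `n` components of the region of largest pressure that are
not flat. -/
lemma IsStable.encard_not_isFlat_le (hn : 0 < n) (hC : C.IsStable) {p : Fin n → ℝ}
    (hp : C.IsPressure p) {i : Fin n} (hi : ∀ j, p j ≤ p i) :
    {Ω | Ω ∈ C.components i ∧ ¬ C.IsFlat p Ω}.encard ≤ ((n - 1 : ℕ) : ℕ∞) := by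
  by_contra hlt
  rw [not_le] at hlt
  have hle : (n : ℕ∞) ≤ {Ω | Ω ∈ C.components i ∧ ¬ C.IsFlat p Ω}.encard := by
    have := Order.add_one_le_of_lt hlt
    have hcast : ((n - 1 : ℕ) : ℕ∞) + 1 = n := by exact_mod_cast Nat.sub_add_cancel hn
    rwa [hcast] at this
  obtain ⟨T, hT, hTc⟩ := exists_subset_encard_eq hle
  have hfin : T.Finite := finite_of_encard_eq_coe hTc
  have hcard : Nat.card T = n := by
    rw [Nat.card_coe_set_eq, ncard, hTc]; rfl
  have := hfin.to_subtype
  let f : Fin n ≃ T := (Finite.equivFinOfCardEq hcard).symm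
  have hf : ∀ k, (f k : Set ℂ) ∈ C.components i := fun k => (hT (f k).2).1
  have hff : ∀ k, ¬ C.IsFlat p (f k : Set ℂ) := fun k => (hT (f k).2).2
  let w : (Fin n → ℝ) → Fin C.numEdges → ℝ := fun a e => ∑ k, a k * C.pushIn (f k) e
  let L : (Fin n → ℝ) →ₗ[ℝ] (Fin n → ℝ) :=
    { toFun := fun a j => C.flux (fun e _ => w a e) j
      map_add' := fun a b => by
        ext j
        simp only [flux_const, w, Pi.add_apply, add_mul, Finset.sum_add_distrib, mul_add]
        ring
      map_smul' := fun c a => by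
        ext j
        simp only [flux_const, w, Pi.smul_apply, smul_eq_mul, mul_assoc, ← Finset.mul_sum,
          mul_left_comm _ c, RingHom.id_apply]
        ring }
  -- The fluxes always sum to zero, so the n by n system misses a basis vector and has a nontrivial
  -- kernel. This is why the bound is n - 1.
  have hL : ¬ Function.Surjective L := by
    intro hs
    obtain ⟨a, ha⟩ := hs (Pi.single ⟨0, hn⟩ 1)
    have h1 := sum_flux_const (C := C) (w a)
    have h2 : ∀ j, C.flux (fun e _ => w a e) j = (Pi.single ⟨0, hn⟩ 1 : Fin n → ℝ) j :=
      fun j => congrFun ha j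
    simp only [h2] at h1
    simp at h1
  rw [← LinearMap.injective_iff_surjective, ← LinearMap.ker_eq_bot] at hL
  obtain ⟨a, haL, ha⟩ := Submodule.exists_mem_ne_zero_of_ne_bot hL
  have hflux : ∀ j, C.flux (fun e _ => w a e) j = 0 := fun j => congrFun (LinearMap.mem_ker.1 haL) j
  have hadm : C.IsAdmissible fun e _ => w a e := by
    refine isAdmissible_const fun ε hε hx => ?_
    have : ∀ ε' : Fin C.numEdges × Bool, C.endSign ε' * w a ε'.1 =
        ∑ k, a k * (C.endSign ε' * C.pushIn (f k) ε'.1) := fun ε' => by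
      simp only [w, Finset.mul_sum]
      exact Finset.sum_congr rfl fun k _ => by ring
    simp only [this]
    rw [Finset.sum_comm]
    refine Finset.sum_eq_zero fun k _ => ?_
    rw [← Finset.mul_sum, hC.1.sum_endsAt_pushIn (isPiece_of_mem_components (hf k)) hx
      (mem_endsAt.2 ⟨hε, rfl⟩), mul_zero]
  have hQ := hC.2 _ hadm hflux
  rw [indexForm_const hp] at hQ
  -- Disjoint supports remove the mixed products.
  have hsq : (fun e => w a e ^ 2) = fun e => ∑ k, a k ^ 2 * C.pushIn (f k) e ^ 2 := by
    ext e
    simp only [w]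
    rw [sq, Finset.sum_mul_sum]
    refine Finset.sum_congr rfl fun k _ => ?_
    rw [Finset.sum_eq_single k]
    · ring
    · intro l _ hl
      have := pushIn_mul_pushIn (hf k) (hf l)
        (fun h => hl (f.injective (Subtype.ext h)).symm) e
      linear_combination a k * a l * this
    · simp
  rw [hsq, indexQuad_sum] at hQ
  have hneg : ∀ k, C.indexQuad p (fun e => C.pushIn (f k) e ^ 2) < 0 := fun k =>
    hC.1.indexQuad_neg hp hi (hf k) (hff k)
  obtain ⟨k, hk⟩ := Function.ne_iff.1 ha
  have : ∑ k, a k ^ 2 * C.indexQuad p (fun e => C.pushIn (f k) e ^ 2) < 0 :=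
    Finset.sum_neg' (fun k _ => mul_nonpos_of_nonneg_of_nonpos (sq_nonneg _) (hneg k).le)
      ⟨k, Finset.mem_univ _, mul_neg_of_pos_of_neg (sq_pos_of_ne_zero hk) (hneg k)⟩
  linarith

/-! ### Closures of pieces -/

/-- A small ball around x avoids the graph and meets Ω, hence is absorbed by it. -/
lemma IsPiece.mem_of_mem_closure {Ω : Set ℂ} (hΩ : C.IsPiece Ω) {x : ℂ} (hx : x ∈ closure Ω)
    (hxU : x ∈ Metric.ball 0 1 \ C.support) : x ∈ Ω := by
  have ho : IsOpen (Metric.ball (0 : ℂ) 1 \ C.support) :=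
    Metric.isOpen_ball.sdiff isCompact_support.isClosed
  obtain ⟨r, hr, hb⟩ := Metric.isOpen_iff.1 ho x hxU
  obtain ⟨y, hy, hyb⟩ := mem_closure_iff.1 hx _ Metric.isOpen_ball (Metric.mem_ball_self hr)
  exact hΩ.absorbs _ (convex_ball x r).isPreconnected hb ⟨y, hy, hyb⟩ (Metric.mem_ball_self hr)

lemma IsPiece.norm_le_one {Ω : Set ℂ} (hΩ : C.IsPiece Ω) {x : ℂ} (hx : x ∈ closure Ω) :
    ‖x‖ ≤ 1 := by
  have := closure_mono (hΩ.subset.trans sdiff_subset) hx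
  simpa using Metric.closure_ball_subset_closedBall this

lemma mem_closure_of_adj {Ω : Set ℂ} (hΩ : C.IsPiece Ω) {e : Fin C.numEdges} {σ : ℝ}
    (hσ : σ = 1 ∨ σ = -1) (h : C.Adj σ Ω e) {t : ℝ} (ht : t ∈ C.interiorParams e) :
    C.curve e t ∈ closure Ω := by
  have h1 := (isSide_iff_adj hΩ hσ ht).2 h
  have h2 : Tendsto (fun s : ℝ => C.curve e t + ((σ * s : ℝ) : ℂ) * C.normal e t) (𝓝[>] 0)
      (𝓝 (C.curve e t)) := by
    have hc : Continuous fun s : ℝ => C.curve e t + ((σ * s : ℝ) : ℂ) * C.normal e t := by fun_prop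
    have := hc.tendsto 0
    rw [mul_zero, Complex.ofReal_zero, zero_mul, add_zero] at this
    exact this.mono_left nhdsWithin_le_nhds
  exact mem_closure_of_tendsto h2 h1

lemma mem_closure_of_adj_of_mem_Icc {Ω : Set ℂ} (hΩ : C.IsPiece Ω) {e : Fin C.numEdges} {σ : ℝ}
    (hσ : σ = 1 ∨ σ = -1) (h : C.Adj σ Ω e) {t : ℝ} (ht : t ∈ Icc 0 (C.len e)) :
    C.curve e t ∈ closure Ω := by
  have hcl : IsClosed (C.curve e ⁻¹' closure Ω) :=
    isClosed_closure.preimage (C.smooth e).continuous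
  have := closure_minimal (s := Ioo 0 (C.len e)) (fun t ht =>
    mem_closure_of_adj hΩ hσ h (Ioo_subset_interiorParams e ht)) hcl
  rw [closure_Ioo (C.len_pos e).ne] at this
  exact this ht

/-- In the chart at such a point Ω contains a point of one of the two half disks. -/
lemma exists_adj_of_mem_closure {Ω : Set ℂ} (hΩ : C.IsPiece Ω) {e : Fin C.numEdges} {t : ℝ}
    (ht : t ∈ C.interiorParams e) (h : C.curve e t ∈ closure Ω) :
    ∃ σ, (σ = 1 ∨ σ = -1) ∧ C.Adj σ Ω e := by
  obtain ⟨r, hr, hch⟩ := exists_interior_chart ht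
  have hτ : ‖((1 : ℝ) : ℂ) * C.tangent e t‖ = 1 := by simpa using norm_tangent_of_mem ht
  obtain ⟨_, ⟨z, hz, rfl⟩, hy⟩ := mem_closure_iff_nhds.1 h _ (tube_image_mem_nhds hτ hr)
  have hz : ‖z‖ < r := by simpa using hz
  have := ((hch z hz).2 Ω hΩ 0 (by simpa using hr)).1 hy
  rw [add_zero, isSide_iff_adj hΩ (Or.inl rfl) ht, isSide_iff_adj hΩ (Or.inr rfl) ht] at this
  rcases this with h | h
  · exact ⟨1, Or.inl rfl, h.2⟩
  · exact ⟨-1, Or.inr rfl, h.2⟩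

lemma norm_endPoint_le_one (ε : Fin C.numEdges × Bool) : ‖C.endPoint ε‖ ≤ 1 := by
  have hcl : IsClosed {t : ℝ | ‖C.curve ε.1 t‖ ≤ 1} :=
    isClosed_le (C.smooth ε.1).continuous.norm continuous_const
  have := closure_minimal (s := Ioo 0 (C.len ε.1)) (fun t ht =>
    (norm_curve_lt_one (Ioo_subset_interiorParams ε.1 ht)).le) hcl
  rw [closure_Ioo (C.len_pos _).ne] at this
  exact this (endParam_mem_Icc ε)

/-- A piece whose closure contains an interior vertex is one of the three sectors there. -/
lemma IsStationary.exists_adj_of_endPoint_mem_closure (hC : C.IsStationary) {Ω : Set ℂ}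
    (hΩ : C.IsPiece Ω) {x : ℂ} (hx : ‖x‖ < 1) {ε : Fin C.numEdges × Bool} (hε : ε ∈ C.endsAt x)
    (h : x ∈ closure Ω) : ∃ ε' ∈ C.endsAt x, C.Adj (C.endSign ε') Ω ε'.1 := by
  have hch : ∀ ε' : Fin C.numEdges × Bool, ∃ r > 0, ε' ∈ C.endsAt x → ∀ z : ℂ, ‖z‖ < r →
      0 < z.re → |z.im| < 2 * z.re → (C.endTube ε' z ∈ Ω ↔
        (0 < z.im ∧ C.Adj (C.endSign ε') Ω ε'.1) ∨ (z.im < 0 ∧ C.Adj (-C.endSign ε') Ω ε'.1)) := by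
    intro ε'
    by_cases hε' : ε' ∈ C.endsAt x
    · obtain ⟨h1, h2⟩ := mem_endsAt.1 hε'
      obtain ⟨r, hr, hch⟩ := hC.exists_cone_chart h1 (by rwa [h2])
      exact ⟨r, hr, fun _ z h1 h2 h3 => hch z h1 h2 h3 Ω hΩ⟩
    · exact ⟨1, one_pos, fun h => absurd h hε'⟩
  choose ρ hρ hch using hch
  obtain ⟨δ, hδ, hδρ⟩ : ∃ δ > 0, ∀ ε', δ ≤ ρ ε' := by
    have : ∀ᶠ δ : ℝ in 𝓝[>] 0, ∀ ε', δ ≤ ρ ε' := by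
      rw [eventually_all]
      intro ε'
      exact nhdsWithin_le_nhds (ge_mem_nhds (hρ ε'))
    obtain ⟨δ, h1, h2⟩ := (this.and self_mem_nhdsWithin).exists
    exact ⟨δ, h2, h1⟩
  obtain ⟨y, hy, hyΩ⟩ := mem_closure_iff_nhds.1 h _ (hC.eventually_exists_cone hx hε hδ)
  have hxs : x ∈ C.support := (mem_endsAt.1 hε).2 ▸ endPoint_mem_support ε
  obtain ⟨ε', hε', z, h1, h2, h3, rfl⟩ :=
    hy (fun h => not_mem_support_of_isPiece hΩ hyΩ (h ▸ hxs))
  rcases (hch ε' hε' z (h1.trans_le (hδρ _)) h2 h3).1 hyΩ with ⟨-, ha⟩ | ⟨-, ha⟩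
  · exact ⟨ε', hε', ha⟩
  -- A sector on the right of ε' is on the left of the preceding edge b.
  · obtain ⟨a, b, hE, -, -, -, -, -, h6⟩ := hC.exists_endsAt_eq hx hε'
    have hb : b ∈ C.endsAt x := by rw [hE]; simp
    exact ⟨b, hb, (hC.adj_next hx hb hε' h6 hΩ).2 ha⟩

/-! ### Straight edges -/

/-- An edge without curvature is a line segment. -/
lemma straight_of_curvature_eq_zero {e : Fin C.numEdges}
    (h : ∀ t ∈ Icc 0 (C.len e), C.curvature e t = 0) : ∀ t ∈ Icc 0 (C.len e),
      C.tangent e t = C.tangent e 0 ∧ C.curve e t = C.curve e 0 + t * C.tangent e 0 := by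
  have hl := C.len_pos e
  have hT : ∀ t, HasDerivAt (C.tangent e) (deriv (C.tangent e) t) t := fun t =>
    ((C.contDiff_tangent e).differentiable (by simp) t).hasDerivAt
  have h0 : ∀ t ∈ Ioo 0 (C.len e), deriv (C.tangent e) t = 0 := by
    intro t ht
    -- Unit speed makes T' orthogonal to T, and zero curvature makes it orthogonal to iT; hence T' =
    -- 0.
    have h1 : HasDerivAt (fun s => inner ℝ (C.tangent e s) (C.tangent e s)) _ t :=
      (hT t).inner ℝ (hT t)
    have h2 : (fun s => inner ℝ (C.tangent e s) (C.tangent e s)) =ᶠ[𝓝 t] fun _ => (1 : ℝ) := by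
      filter_upwards [isOpen_Ioo.mem_nhds ht] with s hs
      rw [real_inner_self_eq_norm_sq, C.norm_tangent ⟨hs.1.le, hs.2.le⟩]
      norm_num
    have h3 := h1.unique ((hasDerivAt_const t (1 : ℝ)).congr_of_eventuallyEq h2)
    have h4 := h t ⟨ht.1.le, ht.2.le⟩
    rw [CurveSystem.curvature, CurveSystem.normal] at h4
    have h5 := C.norm_tangent (e := e) ⟨ht.1.le, ht.2.le⟩
    rw [norm_one_iff] at h5
    set T := C.tangent e t
    set D := deriv (C.tangent e) t
    simp only [Complex.inner, Complex.mul_re, Complex.conj_re, Complex.conj_im, Complex.I_re,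
      Complex.I_im, Complex.mul_im] at h3 h4
    apply Complex.ext
    · rw [Complex.zero_re]
      linear_combination (-D.re) * h5 + (1 / 2) * T.re * h3 - T.im * h4
    · rw [Complex.zero_im]
      linear_combination (-D.im) * h5 + (1 / 2) * T.im * h3 + T.re * h4
  have h0' : ∀ t ∈ Icc 0 (C.len e), deriv (C.tangent e) t = 0 := by
    have hcl : IsClosed {t | deriv (C.tangent e) t = 0} :=
      isClosed_eq (contDiff_deriv_of_contDiff (C.contDiff_tangent e)).continuous continuous_const
    have := closure_minimal (s := Ioo 0 (C.len e)) h0 hcl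
    rw [closure_Ioo hl.ne] at this
    exact this
  have hconst : ∀ t ∈ Icc 0 (C.len e), C.tangent e t = C.tangent e 0 :=
    constant_of_has_deriv_right_zero (C.contDiff_tangent e).continuous.continuousOn fun t ht => by
      have := hT t
      rw [h0' t ⟨ht.1, ht.2.le⟩] at this
      exact this.hasDerivWithinAt
  have hγ : ∀ t, HasDerivAt (C.curve e) (C.tangent e t) t := fun t =>
    ((C.smooth e).differentiable (by simp) t).hasDerivAt
  have hlin : ∀ t ∈ Icc 0 (C.len e), C.curve e t - t * C.tangent e 0 =
      C.curve e 0 - ((0 : ℝ) : ℂ) * C.tangent e 0 :=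
    constant_of_has_deriv_right_zero (f := fun t : ℝ => C.curve e t - t * C.tangent e 0)
      (by have := (C.smooth e).continuous; fun_prop) fun t ht => by
        have h1 : HasDerivAt (fun t : ℝ => (t : ℂ) * C.tangent e 0) (1 * C.tangent e 0) t :=
          (Complex.ofRealCLM.hasDerivAt (x := t)).mul_const _
        have h2 := (hγ t).sub h1
        rw [hconst t ⟨ht.1, ht.2.le⟩, one_mul, sub_self] at h2
        exact h2.hasDerivWithinAt
  intro t ht
  refine ⟨hconst t ht, ?_⟩
  have := hlin t ht
  rw [Complex.ofReal_zero, zero_mul, sub_zero] at this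
  linear_combination this

variable (C) in
/-- The set lies on the left of the edge that leaves the given end. -/
def IsLeftEnd (Ω : Set ℂ) (ε : Fin C.numEdges × Bool) : Prop :=
  ε ∈ C.ends ∧ C.Adj (C.endSign ε) Ω ε.1

variable {p : Fin n → ℝ} {i : Fin n} {Ω : Set ℂ}

lemma IsFlat.straight (hF : C.IsFlat p Ω) (hp : C.IsPressure p) {e : Fin C.numEdges} {σ : ℝ}
    (hσ : σ = 1 ∨ σ = -1) (h : C.Adj σ Ω e) : ∀ t ∈ Icc 0 (C.len e),
      C.tangent e t = C.tangent e 0 ∧ C.curve e t = C.curve e 0 + t * C.tangent e 0 :=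
  straight_of_curvature_eq_zero fun t ht => by
    rw [hp e t ht, hF.pressure_eq e σ hσ h, sub_self]

/-- A line segment of positive length does not return to its starting point. -/
lemma IsFlat.not_isClosed (hF : C.IsFlat p Ω) (hp : C.IsPressure p) {e : Fin C.numEdges} {σ : ℝ}
    (hσ : σ = 1 ∨ σ = -1) (h : C.Adj σ Ω e) : C.isClosed e = false := by
  by_contra hc
  have h1 := C.periodic e (by simpa using hc) 0
  have hl := C.len_pos e
  rw [zero_add, (hF.straight hp hσ h _ (right_mem_Icc.2 hl.le)).2, add_eq_left, mul_eq_zero] at h1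
  rcases h1 with h1 | h1
  · exact hl.ne' (by exact_mod_cast h1)
  · have := C.norm_tangent (e := e) (left_mem_Icc.2 hl.le)
    rw [h1, norm_zero] at this
    norm_num at this

/-- Every edge along Ω can be directed so that Ω is on its left; this replaces edges with signs by
directed edges. -/
lemma IsFlat.exists_isLeftEnd (hF : C.IsFlat p Ω) (hp : C.IsPressure p) {e : Fin C.numEdges}
    {σ : ℝ} (hσ : σ = 1 ∨ σ = -1) (h : C.Adj σ Ω e) : ∃ b, C.IsLeftEnd Ω (e, b) := by
  have hc := hF.not_isClosed hp hσ h
  rcases hσ with rfl | rfl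
  · exact ⟨false, mem_ends.2 hc, by simpa [CurveSystem.endSign] using h⟩
  · exact ⟨true, mem_ends.2 hc, by simpa [CurveSystem.endSign] using h⟩

lemma IsFlat.norm_endPoint_lt (hF : C.IsFlat p Ω) {ε : Fin C.numEdges × Bool} (hε : ε ∈ C.ends)
    {σ : ℝ} (hσ : σ = 1 ∨ σ = -1) (h : C.Adj σ Ω ε.1) : ‖C.endPoint ε‖ < 1 :=
  lt_of_le_of_ne (norm_endPoint_le_one ε) (hF.norm_endPoint_ne ε hε σ hσ h)

lemma endSign_mul_self (ε : Fin C.numEdges × Bool) : (C.endSign ε : ℂ) * C.endSign ε = 1 := by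
  rcases endSign_eq ε with h | h <;> rw [h] <;> simp

lemma IsFlat.tangent_eq (hF : C.IsFlat p Ω) (hp : C.IsPressure p) {ε : Fin C.numEdges × Bool}
    {σ : ℝ} (hσ : σ = 1 ∨ σ = -1) (h : C.Adj σ Ω ε.1) {t : ℝ} (ht : t ∈ Icc 0 (C.len ε.1)) :
    C.tangent ε.1 t = C.endSign ε * C.conormal ε := by
  rw [CurveSystem.conormal, ← mul_assoc, endSign_mul_self, one_mul, (hF.straight hp hσ h t ht).1,
    (hF.straight hp hσ h _ (endParam_mem_Icc ε)).1]

lemma IsFlat.curve_eq (hF : C.IsFlat p Ω) (hp : C.IsPressure p) {ε : Fin C.numEdges × Bool}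
    {σ : ℝ} (hσ : σ = 1 ∨ σ = -1) (h : C.Adj σ Ω ε.1) {t : ℝ} (ht : t ∈ Icc 0 (C.len ε.1)) :
    C.curve ε.1 (C.endParam ε + C.endSign ε * t) = C.endPoint ε + t * C.conormal ε := by
  have hm : C.endParam ε + C.endSign ε * t ∈ Icc 0 (C.len ε.1) := by
    obtain ⟨h1, h2⟩ := ht
    unfold CurveSystem.endParam CurveSystem.endSign
    split_ifs <;> constructor <;> linarith
  have h0 := endParam_mem_Icc ε
  rw [CurveSystem.endPoint, CurveSystem.conormal, (hF.straight hp hσ h _ hm).2,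
    (hF.straight hp hσ h _ h0).2, (hF.straight hp hσ h _ h0).1]
  push_cast
  ring

lemma IsFlat.endTube_eq (hF : C.IsFlat p Ω) (hp : C.IsPressure p) {ε : Fin C.numEdges × Bool}
    {σ : ℝ} (hσ : σ = 1 ∨ σ = -1) (h : C.Adj σ Ω ε.1) {z : ℂ} (hz : z.re ∈ Icc 0 (C.len ε.1)) :
    C.endTube ε z = C.endPoint ε + z * C.conormal ε := by
  have hm : C.endParam ε + C.endSign ε * z.re ∈ Icc 0 (C.len ε.1) := by
    obtain ⟨h1, h2⟩ := hz
    unfold CurveSystem.endParam CurveSystem.endSign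
    split_ifs <;> constructor <;> linarith
  rw [endTube, tube_apply, hF.curve_eq hp hσ h hz, CurveSystem.normal, hF.tangent_eq hp hσ h hm]
  have hz' := Complex.re_add_im z
  have hs := endSign_mul_self ε
  push_cast
  linear_combination C.conormal ε * hz' + (z.im * Complex.I * C.conormal ε) * hs

/-- The other end of an edge. -/
def flipEnd {m : ℕ} (ε : Fin m × Bool) : Fin m × Bool := (ε.1, !ε.2)

lemma endSign_flipEnd (ε : Fin C.numEdges × Bool) : C.endSign (flipEnd ε) = -C.endSign ε := by
  rcases ε with ⟨e, b⟩
  cases b <;> simp [flipEnd, CurveSystem.endSign]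

lemma endParam_flipEnd (ε : Fin C.numEdges × Bool) :
    C.endParam (flipEnd ε) = C.endParam ε + C.endSign ε * C.len ε.1 := by
  rcases ε with ⟨e, b⟩
  cases b <;> simp [flipEnd, CurveSystem.endSign, CurveSystem.endParam]

lemma IsFlat.endPoint_flipEnd (hF : C.IsFlat p Ω) (hp : C.IsPressure p)
    {ε : Fin C.numEdges × Bool} (hε : C.IsLeftEnd Ω ε) :
    C.endPoint (flipEnd ε) = C.endPoint ε + C.len ε.1 * C.conormal ε := by
  rw [CurveSystem.endPoint, endParam_flipEnd]
  exact hF.curve_eq hp (endSign_eq ε) hε.2 (right_mem_Icc.2 (C.len_pos _).le)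

lemma IsFlat.conormal_flipEnd (hF : C.IsFlat p Ω) (hp : C.IsPressure p)
    {ε : Fin C.numEdges × Bool} (hε : C.IsLeftEnd Ω ε) :
    C.conormal (flipEnd ε) = -C.conormal ε := by
  have h1 := hF.tangent_eq hp (endSign_eq ε) hε.2 (endParam_mem_Icc (flipEnd ε))
  have hs := endSign_mul_self ε
  rw [CurveSystem.conormal, endSign_flipEnd, show C.tangent (flipEnd ε).1 = C.tangent ε.1 from rfl,
    h1]
  push_cast
  linear_combination (-C.conormal ε) * hs

/-- Near an interior point of an edge a flat component is a half plane. -/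
lemma IsFlat.exists_half_plane (hF : C.IsFlat p Ω) (hp : C.IsPressure p)
    (hΩ : Ω ∈ C.components i) {ε : Fin C.numEdges × Bool} (hε : C.IsLeftEnd Ω ε) {t : ℝ}
    (ht : t ∈ Ioo 0 (C.len ε.1)) : ∃ r > 0, ∀ y, ‖y - (C.endPoint ε + t * C.conormal ε)‖ < r →
      (y ∈ Ω ↔ 0 < ((y - C.endPoint ε) * starRingEnd ℂ (C.conormal ε)).im) := by
  have hP := isPiece_of_mem_components hΩ
  have hu := mul_conj_of_norm_one (norm_conormal (C := C) ε)
  have hs := endSign_mul_self ε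
  set t₀ := C.endParam ε + C.endSign ε * t with ht₀
  have hm : t₀ ∈ Ioo 0 (C.len ε.1) := endParam_add_mem ht.1 ht.2
  have hmI := Ioo_subset_interiorParams ε.1 hm
  obtain ⟨r, hr, hch⟩ := exists_interior_chart hmI
  refine ⟨min r (min t₀ (C.len ε.1 - t₀)),
    lt_min hr (lt_min hm.1 (by linarith [hm.2])), fun y hy => ?_⟩
  have hcurve : C.curve ε.1 t₀ = C.endPoint ε + t * C.conormal ε :=
    hF.curve_eq hp (endSign_eq ε) hε.2 ⟨ht.1.le, ht.2.le⟩
  set w := (y - C.endPoint ε) * starRingEnd ℂ (C.conormal ε) - t with hw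
  have hwn : ‖w‖ = ‖y - (C.endPoint ε + t * C.conormal ε)‖ := by
    have : w = (y - (C.endPoint ε + t * C.conormal ε)) * starRingEnd ℂ (C.conormal ε) := by
      rw [hw]; linear_combination (t : ℂ) * hu
    rw [this, norm_mul, RCLike.norm_conj, norm_conormal, mul_one]
  -- w measures along the direction that leaves ε, while z measures along the parametrisation of the
  -- edge.
  set z : ℂ := C.endSign ε * w with hz
  have hzn : ‖z‖ = ‖w‖ := by
    rw [hz, norm_mul]
    rcases endSign_eq ε with h | h <;> rw [h] <;> simp
  rw [← hwn, ← hzn] at hy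
  have hy1 := hy.trans_le (min_le_left _ _)
  have hy2 := hy.trans_le ((min_le_right _ _).trans (min_le_left _ _))
  have hy3 := hy.trans_le ((min_le_right _ _).trans (min_le_right _ _))
  have hre := abs_le.1 (Complex.abs_re_le_norm z)
  have hm' : t₀ + 1 * z.re ∈ Icc 0 (C.len ε.1) := ⟨by linarith [hre.1], by linarith [hre.2]⟩
  have htube : C.tube ε.1 t₀ 1 z = y := by
    have hL := hF.straight hp (endSign_eq ε) hε.2
    rw [tube_apply, CurveSystem.normal, hF.tangent_eq hp (endSign_eq ε) hε.2 hm', (hL _ hm').2]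
    have h1 := (hL t₀ ⟨hm.1.le, hm.2.le⟩).2
    have h2 := hF.tangent_eq hp (endSign_eq ε) hε.2 (left_mem_Icc.2 (C.len_pos ε.1).le)
    rw [h2] at h1 ⊢
    have hz' := Complex.re_add_im z
    rw [hcurve] at h1
    push_cast
    linear_combination (-1 : ℂ) * h1 + (C.endSign ε * C.conormal ε) * hz' +
      C.endSign ε * C.conormal ε * hz + (C.conormal ε * w) * hs + C.conormal ε * hw +
        (y - C.endPoint ε) * hu
  have h1 := (hch z hy1).2 Ω hP 0 (by simpa using hr)
  rw [add_zero, htube, isSide_iff_adj hP (Or.inl rfl) hmI, isSide_iff_adj hP (Or.inr rfl) hmI] at h1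
  have hn := not_adj_both hΩ hε.2
  have ha := hε.2
  have hwi : w.im = ((y - C.endPoint ε) * starRingEnd ℂ (C.conormal ε)).im := by
    rw [hw, Complex.sub_im, Complex.ofReal_im, sub_zero]
  have hzi : z.im = C.endSign ε * w.im := by rw [hz, Complex.im_ofReal_mul]
  rw [h1, ← hwi, hzi]
  rcases endSign_eq ε with h | h <;> rw [h] at hn ha ⊢
  · simp [hn, ha]
  · rw [neg_neg] at hn
    simp [hn, ha]

/-- At a vertex a flat component is a sector. -/
lemma IsFlat.exists_sector (hF : C.IsFlat p Ω) (hC : C.IsStationary) (hp : C.IsPressure p)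
    (hΩ : Ω ∈ C.components i) {ε : Fin C.numEdges × Bool} (hε : C.IsLeftEnd Ω ε) :
    ∃ r > 0, ∀ y, ‖y - C.endPoint ε‖ < r →
      (y ∈ Ω ↔ 0 < ((y - C.endPoint ε) * starRingEnd ℂ (C.conormal ε)).im ∧
        ((y - C.endPoint ε) * starRingEnd ℂ (zeta * C.conormal ε)).im < 0) := by
  have hP := isPiece_of_mem_components hΩ
  have hx := hF.norm_endPoint_lt hε.1 (endSign_eq ε) hε.2
  set x := C.endPoint ε with hxdef
  have hm : ε ∈ C.endsAt x := mem_endsAt.2 ⟨hε.1, rfl⟩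
  obtain ⟨a, b, hE, hne1, hne2, hne3, h1, h2, h3⟩ := hC.exists_endsAt_eq hx hm
  have ma : a ∈ C.endsAt x := by rw [hE]; simp
  have mb : b ∈ C.endsAt x := by rw [hE]; simp
  have ha := (hC.adj_next hx hm ma h1 hP).1 hε.2
  -- Ω occupies only the sector between ε and a. It is not adjacent to the third edge b, which may
  -- be curved; only ε and a are known to be straight.
  have hna : ¬ C.Adj (C.endSign a) Ω a.1 := fun h => not_adj_both hΩ h ha
  have hnε : ¬ C.Adj (-C.endSign ε) Ω ε.1 := not_adj_both hΩ hε.2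
  have hnb : ¬ C.Adj (-C.endSign b) Ω b.1 := fun h => hna ((hC.adj_next hx ma mb h2 hP).2 h)
  have hnb' : ¬ C.Adj (C.endSign b) Ω b.1 := fun h => hnε ((hC.adj_next hx mb hm h3 hP).1 h)
  have hax : C.endPoint a = x := (mem_endsAt.1 ma).2
  have hbx : C.endPoint b = x := (mem_endsAt.1 mb).2
  obtain ⟨r₁, hr₁, hch₁⟩ := hC.exists_cone_chart hε.1 hx
  obtain ⟨r₂, hr₂, hch₂⟩ := hC.exists_cone_chart (mem_endsAt.1 ma).1 (by rwa [hax])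
  obtain ⟨r₃, hr₃, hch₃⟩ := hC.exists_cone_chart (mem_endsAt.1 mb).1 (by rwa [hbx])
  have hl1 := C.len_pos ε.1
  have hl2 := C.len_pos a.1
  set ρ := min (min r₁ r₂) (min r₃ (min (C.len ε.1) (C.len a.1))) with hρ
  have hρ0 : 0 < ρ := by simp only [hρ, lt_min_iff]; tauto
  have q1 : ρ ≤ r₁ := (min_le_left _ _).trans (min_le_left _ _)
  have q2 : ρ ≤ r₂ := (min_le_left _ _).trans (min_le_right _ _)
  have q3 : ρ ≤ r₃ := (min_le_right _ _).trans (min_le_left _ _)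
  have q4 : ρ ≤ C.len ε.1 := (min_le_right _ _).trans ((min_le_right _ _).trans (min_le_left _ _))
  have q5 : ρ ≤ C.len a.1 := (min_le_right _ _).trans ((min_le_right _ _).trans (min_le_right _ _))
  obtain ⟨r₀, hr₀, hcov⟩ := Metric.eventually_nhds_iff_ball.1 (hC.eventually_exists_cone hx hm hρ0)
  have hu := mul_conj_of_norm_one (norm_conormal (C := C) ε)
  have hs3 := sq_sqrt_three
  have hs1 : (1.7 : ℝ) < √3 := by rw [Real.lt_sqrt] <;> norm_num
  have hs2 : √3 < (1.8 : ℝ) := by rw [Real.sqrt_lt'] <;> norm_num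
  have tube1 : ∀ z : ℂ, 0 < z.re → ‖z‖ < ρ → C.endTube ε z = x + z * C.conormal ε := by
    intro z hz hzρ
    have := (Complex.re_le_norm z).trans_lt hzρ
    exact hF.endTube_eq hp (endSign_eq ε) hε.2 ⟨hz.le, (this.trans_le q4).le⟩
  have tube2 : ∀ z : ℂ, 0 < z.re → ‖z‖ < ρ → C.endTube a z = x + z * (zeta * C.conormal ε) := by
    intro z hz hzρ
    have := (Complex.re_le_norm z).trans_lt hzρ
    rw [hF.endTube_eq hp (neg_endSign_eq a) ha ⟨hz.le, (this.trans_le q5).le⟩, hax, h1]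
  refine ⟨min r₀ ρ, lt_min hr₀ hρ0, fun y hy => ?_⟩
  set w := (y - x) * starRingEnd ℂ (C.conormal ε) with hw
  have hyw : y = x + w * C.conormal ε := by
    rw [hw]; linear_combination (-(y - x)) * hu
  have hw2 : (y - x) * starRingEnd ℂ (zeta * C.conormal ε) = w * starRingEnd ℂ zeta := by
    rw [map_mul, hw]; ring
  have hwn : ‖w‖ < ρ := by
    rw [hw, norm_mul, RCLike.norm_conj, norm_conormal, mul_one]
    exact hy.trans_le (min_le_right _ _)
  have hw2im : (w * starRingEnd ℂ zeta).im = -(w.re * (√3 / 2)) - w.im / 2 := by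
    simp only [Complex.mul_im, Complex.conj_re, Complex.conj_im, zeta_re, zeta_im]; ring
  have hw2re : (w * starRingEnd ℂ zeta).re = -(w.re / 2) + w.im * (√3 / 2) := by
    simp only [Complex.mul_re, Complex.conj_re, Complex.conj_im, zeta_re, zeta_im]; ring
  rw [hw2, hw2im]
  constructor
  · intro hyΩ
    have hyx : y ≠ x := by
      rintro rfl
      exact not_mem_support_of_isPiece hP hyΩ (endPoint_mem_support ε)
    obtain ⟨ε', hε', z, hz1, hz2, hz3, hzy⟩ := hcov y (by
      simpa [dist_eq_norm] using hy.trans_le (min_le_left _ _)) hyx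
    rw [hE] at hε'
    simp only [Finset.mem_insert, Finset.mem_singleton] at hε'
    rw [← hzy] at hyΩ
    obtain ⟨hz3a, hz3b⟩ := abs_lt.1 hz3
    rcases hε' with rfl | rfl | rfl
    · have hzi : 0 < z.im := by
        have := (hch₁ z (hz1.trans_le q1) hz2 hz3 Ω hP).1 hyΩ
        tauto
      have hwz : w = z := by
        rw [hw, ← hzy, tube1 z hz2 hz1]; linear_combination z * hu
      rw [hwz]
      refine ⟨hzi, ?_⟩
      nlinarith
    · have hzi : z.im < 0 := by
        have := (hch₂ z (hz1.trans_le q2) hz2 hz3 Ω hP).1 hyΩ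
        tauto
      have hwz : w = z * zeta := by
        rw [hw, ← hzy, tube2 z hz2 hz1]; linear_combination (z * zeta) * hu
      rw [hwz]
      simp only [Complex.mul_im, Complex.mul_re, zeta_re, zeta_im]
      constructor <;> nlinarith
    · exfalso
      have := (hch₃ z (hz1.trans_le q3) hz2 hz3 Ω hP).1 hyΩ
      tauto
  · rintro ⟨hi1, hi2⟩
    -- The sector of opening 2π/3 is covered by the left half of the cone of ε and the right half of
    -- the cone of a. Beyond slope 2 the point is measured from a.
    by_cases hcase : w.im < 2 * w.re
    · have hre : 0 < w.re := by linarith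
      rw [hyw, ← tube1 w hre hwn]
      exact (hch₁ w (hwn.trans_le q1) hre (abs_lt.2 ⟨by linarith, hcase⟩) Ω hP).2
        (Or.inl ⟨hi1, hε.2⟩)
    · rw [not_lt] at hcase
      set z := w * starRingEnd ℂ zeta with hz
      have hzn : ‖z‖ < ρ := by
        have : ‖zeta‖ = 1 := by
          rw [norm_one_iff, zeta_re, zeta_im]; linarith
        rw [hz, norm_mul, RCLike.norm_conj, this, mul_one]; exact hwn
      have hre : 0 < z.re := by rw [hw2re]; nlinarith
      have hyz : y = C.endTube a z := by
        rw [tube2 z hre hzn, hyw, hz, conj_zeta]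
        linear_combination (-w * C.conormal ε) * zeta_cube
      rw [hyz]
      refine (hch₂ z (hzn.trans_le q2) hre (abs_lt.2 ⟨?_, ?_⟩) Ω hP).2 (Or.inr ⟨?_, ha⟩)
      · rw [hw2im, hw2re]; nlinarith
      · rw [hw2im, hw2re]; nlinarith
      · rw [hw2im]; exact hi2

end AdmissibleGraph

/-! ### Convexity of flat components -/

lemma convex_setOf_im_pos (x v : ℂ) : Convex ℝ {y : ℂ | 0 < ((y - x) * v).im} := by
  have : {y : ℂ | 0 < ((y - x) * v).im} = {y : ℂ | (x * v).im < (y * v).im} := by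
    ext y
    simp only [mem_ofPred_eq, sub_mul, Complex.sub_im, sub_pos]
  rw [this]
  refine convex_halfSpace_gt (f := fun y : ℂ => (y * v).im) ⟨fun a b => ?_, fun c a => ?_⟩ _
  · simp only [add_mul, Complex.add_im]
  · simp only [Complex.real_smul, mul_assoc, Complex.im_ofReal_mul, smul_eq_mul]

lemma convex_setOf_im_neg (x v : ℂ) : Convex ℝ {y : ℂ | ((y - x) * v).im < 0} := by
  have h := convex_setOf_im_pos x (-v)
  simpa only [mul_neg, Complex.neg_im, neg_pos] using h

namespace AdmissibleGraph

variable {n : ℕ} {C : AdmissibleGraph n} {p : Fin n → ℝ} {i : Fin n} {Ω : Set ℂ}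

/-- A flat component does not touch the graph on the unit circle. -/
lemma IsFlat.not_mem_support (hF : C.IsFlat p Ω) (hΩ : C.IsPiece Ω) {x : ℂ}
    (hx : x ∈ closure Ω) (hx1 : ‖x‖ = 1) : x ∉ C.support := by
  intro hs
  rcases exists_of_mem_support hs with ⟨e, t, ht, rfl⟩ | ⟨ε, hε, rfl⟩
  · have := C.inside e t ht
    linarith
  have hcard := C.boundary_vertex ε hε hx1
  obtain ⟨ε₁, hε₁⟩ := Finset.card_eq_one.1 hcard
  have hεε : ε ∈ C.endsAt (C.endPoint ε) := mem_endsAt.2 ⟨hε, rfl⟩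
  rw [hε₁, Finset.mem_singleton] at hεε
  subst hεε
  have hl := C.len_pos ε.1
  obtain ⟨r, hr, hnear⟩ := Metric.eventually_nhds_iff_ball.1 (eventually_near_endPoint hε hl)
  set B := Metric.ball (C.endPoint ε) r ∩ Metric.ball (0 : ℂ) 1 with hB
  have hBo : IsOpen B := Metric.isOpen_ball.inter Metric.isOpen_ball
  have hBs : ∀ y ∈ B, y ∈ C.support → ∃ t ∈ Ioo 0 (C.len ε.1),
      C.curve ε.1 (C.endParam ε + C.endSign ε * t) = y := by
    rintro y ⟨hy, hy1⟩ hys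
    obtain ⟨ε', hε', t, ht0, htl, -, rfl⟩ := hnear y hy hys
    rw [hε₁, Finset.mem_singleton] at hε'
    subst hε'
    refine ⟨t, ⟨lt_of_le_of_ne ht0 ?_, htl⟩, rfl⟩
    rintro rfl
    rw [mul_zero, add_zero, mem_ball_zero_iff] at hy1
    exact absurd hx1 hy1.ne
  -- Only the edge with this end runs in B, and flatness forbids Ω to lie along it. Hence Ω has no
  -- boundary in B and fills it, although the edge itself enters B.
  have hsub : B ⊆ Ω := by
    refine ((convex_ball _ _).inter (convex_ball _ _)).isPreconnected.subset_of_closure_inter_subset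
      hΩ.isOpen ?_ ?_
    · obtain ⟨y, hy, hyΩ⟩ := mem_closure_iff.1 hx _ Metric.isOpen_ball (Metric.mem_ball_self hr)
      exact ⟨y, ⟨hy, (hΩ.subset hyΩ).1⟩, hyΩ⟩
    · rintro y ⟨hyc, hyB⟩
      refine hΩ.mem_of_mem_closure hyc ⟨hyB.2, fun hys => ?_⟩
      obtain ⟨t, ht, rfl⟩ := hBs y hyB hys
      obtain ⟨σ, hσ, ha⟩ := exists_adj_of_mem_closure hΩ
        (Ioo_subset_interiorParams _ (endParam_add_mem ht.1 ht.2)) hyc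
      exact hF.norm_endPoint_ne ε hε σ hσ ha hx1
  have hlim : Tendsto (fun t : ℝ => C.curve ε.1 (C.endParam ε + C.endSign ε * t)) (𝓝[>] 0)
      (𝓝 (C.endPoint ε)) := by
    have hc : Continuous fun t : ℝ => C.curve ε.1 (C.endParam ε + C.endSign ε * t) :=
      (C.smooth ε.1).continuous.comp (by fun_prop)
    have := hc.tendsto 0
    rw [mul_zero, add_zero] at this
    exact this.mono_left nhdsWithin_le_nhds
  have h1 : ∀ᶠ t : ℝ in 𝓝[>] 0, t < C.len ε.1 := nhdsWithin_le_nhds (gt_mem_nhds hl)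
  obtain ⟨t, ⟨ht1, ht2⟩, ht0⟩ :=
    ((hlim.eventually (Metric.ball_mem_nhds _ hr)).and h1 |>.and self_mem_nhdsWithin).exists
  have hm := Ioo_subset_interiorParams ε.1 (endParam_add_mem ht0 ht2)
  exact not_mem_support_of_isPiece hΩ (hsub ⟨ht1, by simpa using norm_curve_lt_one hm⟩)
    (curve_mem_support hm)

/-- Near a point of the unit circle in its closure a flat component fills the disk. -/
lemma IsFlat.exists_ball_inter_subset (hF : C.IsFlat p Ω) (hΩ : C.IsPiece Ω) {x : ℂ}
    (hx : x ∈ closure Ω) (hx1 : ‖x‖ = 1) :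
    ∃ r > 0, Metric.ball x r ∩ Metric.ball 0 1 ⊆ Ω := by
  have hs := hF.not_mem_support hΩ hx hx1
  obtain ⟨r, hr, hb⟩ := Metric.isOpen_iff.1 isCompact_support.isClosed.isOpen_compl x hs
  obtain ⟨y, hy, hyΩ⟩ := mem_closure_iff.1 hx _ Metric.isOpen_ball (Metric.mem_ball_self hr)
  exact ⟨r, hr, hΩ.absorbs _ ((convex_ball _ _).inter (convex_ball _ _)).isPreconnected
    (fun z hz => ⟨hz.2, hb hz.1⟩) ⟨y, ⟨hy, (hΩ.subset hyΩ).1⟩, hyΩ⟩⟩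

/-- Interior boundary points of a flat component lie on one of its edges or at one of its
vertices. -/
lemma IsFlat.boundary_cases (hF : C.IsFlat p Ω) (hC : C.IsStationary) (hp : C.IsPressure p)
    (hΩ : C.IsPiece Ω) {x : ℂ} (hx : x ∈ closure Ω) (hxΩ : x ∉ Ω) (hx1 : ‖x‖ < 1) :
    ∃ ε, C.IsLeftEnd Ω ε ∧ (x = C.endPoint ε ∨
      ∃ t ∈ Ioo 0 (C.len ε.1), x = C.endPoint ε + t * C.conormal ε) := by
  have hs : x ∈ C.support := by
    by_contra hs
    exact hxΩ (hΩ.mem_of_mem_closure hx ⟨by simpa using hx1, hs⟩)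
  rcases exists_of_mem_support hs with ⟨e, t, ht, rfl⟩ | ⟨ε, hε, rfl⟩
  · obtain ⟨σ, hσ, ha⟩ :=
      exists_adj_of_mem_closure hΩ (openParams_subset_interiorParams e ht) hx
    obtain ⟨b, hb⟩ := hF.exists_isLeftEnd hp hσ ha
    have hc := hF.not_isClosed hp hσ ha
    rw [CurveSystem.openParams, if_neg (by simp [hc])] at ht
    refine ⟨(e, b), hb, Or.inr ⟨C.endSign (e, b) * (t - C.endParam (e, b)), ?_, ?_⟩⟩
    · cases b <;> simp [CurveSystem.endSign, CurveSystem.endParam, ht.1, ht.2]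
    · have hm : C.endSign (e, b) * (t - C.endParam (e, b)) ∈ Icc 0 (C.len e) := by
        cases b <;> simp [CurveSystem.endSign, CurveSystem.endParam, ht.1.le, ht.2.le]
      rw [← hF.curve_eq hp (endSign_eq _) hb.2 hm]
      congr 1
      cases b <;> simp [CurveSystem.endSign, CurveSystem.endParam]
  · obtain ⟨ε', hε', ha⟩ :=
      hC.exists_adj_of_endPoint_mem_closure hΩ hx1 (mem_endsAt.2 ⟨hε, rfl⟩) hx
    exact ⟨ε', ⟨(mem_endsAt.1 hε').1, ha⟩, Or.inl (mem_endsAt.1 hε').2.symm⟩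

/-- Flat components are convex. -/
lemma IsFlat.convex (hF : C.IsFlat p Ω) (hC : C.IsStationary) (hp : C.IsPressure p)
    (hΩ : Ω ∈ C.components i) : Convex ℝ Ω := by
  have hP := isPiece_of_mem_components hΩ
  refine convex_of_locally_convex hP.isOpen (isConnected_of_mem_components hΩ).isPreconnected
    fun x hx => ?_
  by_cases hxΩ : x ∈ Ω
  · obtain ⟨r, hr, hb⟩ := Metric.isOpen_iff.1 hP.isOpen x hxΩ
    exact ⟨r, hr, by rw [inter_eq_right.2 hb]; exact convex_ball x r⟩
  rcases (hP.norm_le_one hx).eq_or_lt with hx1 | hx1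
  · obtain ⟨r, hr, hb⟩ := hF.exists_ball_inter_subset hP hx hx1
    refine ⟨r, hr, ?_⟩
    have : Ω ∩ Metric.ball x r = Metric.ball x r ∩ Metric.ball 0 1 :=
      subset_antisymm (fun y hy => ⟨hy.2, (hP.subset hy.1).1⟩) fun y hy => ⟨hb hy, hy.1⟩
    rw [this]
    exact (convex_ball _ _).inter (convex_ball _ _)
  · obtain ⟨ε, hε, rfl | ⟨t, ht, rfl⟩⟩ := hF.boundary_cases hC hp hP hx hxΩ hx1
    · obtain ⟨r, hr, h⟩ := hF.exists_sector hC hp hΩ hε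
      refine ⟨r, hr, ?_⟩
      have : Ω ∩ Metric.ball (C.endPoint ε) r =
          ({y : ℂ | 0 < ((y - C.endPoint ε) * starRingEnd ℂ (C.conormal ε)).im} ∩
          {y : ℂ | ((y - C.endPoint ε) * starRingEnd ℂ (zeta * C.conormal ε)).im < 0}) ∩
            Metric.ball (C.endPoint ε) r := by
        ext y
        simp only [mem_inter_iff, and_congr_left_iff, Metric.mem_ball, dist_eq_norm]
        exact fun hy => h y hy
      rw [this]
      exact ((convex_setOf_im_pos _ _).inter (convex_setOf_im_neg _ _)).inter (convex_ball _ _)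
    · obtain ⟨r, hr, h⟩ := hF.exists_half_plane hp hΩ hε ht
      refine ⟨r, hr, ?_⟩
      have : Ω ∩ Metric.ball (C.endPoint ε + t * C.conormal ε) r =
          {y : ℂ | 0 < ((y - C.endPoint ε) * starRingEnd ℂ (C.conormal ε)).im} ∩
            Metric.ball (C.endPoint ε + t * C.conormal ε) r := by
        ext y
        simp only [mem_inter_iff, and_congr_left_iff, Metric.mem_ball, dist_eq_norm]
        exact fun hy => h y hy
      rw [this]
      exact (convex_setOf_im_pos _ _).inter (convex_ball _ _)

/-- Flat components do not touch the unit circle. -/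
lemma IsFlat.disjoint_sphere (hF : C.IsFlat p Ω) (hn : 2 ≤ n) (hC : C.IsStationary)
    (hp : C.IsPressure p) (hΩ : Ω ∈ C.components i) :
    Disjoint (closure Ω) (Metric.sphere (0 : ℂ) 1) := by
  have hP := isPiece_of_mem_components hΩ
  have hconv := hF.convex hC hp hΩ
  by_contra hnd
  obtain ⟨x, hx, hx1⟩ := not_disjoint_iff.1 hnd
  have hsph : Metric.sphere (0 : ℂ) 1 ⊆ closure Ω := by
    intro z hz
    by_contra hzc
    have hpre : IsPreconnected (Metric.sphere (0 : ℂ) 1) :=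
      isPreconnected_sphere (by rw [Complex.rank_real_complex]; norm_num) 0 1
    -- On the circle this open set coincides with the closure of Ω, so by connectedness one contact
    -- point yields the whole circle.
    set V := {y : ℂ | ∃ r > 0, Metric.ball y r ∩ Metric.ball 0 1 ⊆ Ω} with hV
    have hVo : IsOpen V := by
      rw [Metric.isOpen_iff]
      rintro y ⟨r, hr, hy⟩
      refine ⟨r / 2, half_pos hr, fun y' hy' => ⟨r / 2, half_pos hr, ?_⟩⟩
      refine subset_trans (inter_subset_inter_left _ (Metric.ball_subset_ball' ?_)) hy
      have : dist y' y < r / 2 := hy'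
      linarith
    have hVc : ∀ y ∈ Metric.sphere (0 : ℂ) 1, y ∈ closure Ω → y ∈ V := fun y hy hyc =>
      hF.exists_ball_inter_subset hP hyc (by simpa using hy)
    obtain ⟨y, hy, ⟨r, hr, hyr⟩, hyc⟩ := hpre V (closure Ω)ᶜ hVo isClosed_closure.isOpen_compl
      (fun y hy => by
        by_cases hyc : y ∈ closure Ω
        · exact Or.inl (hVc y hy hyc)
        · exact Or.inr hyc)
      ⟨x, hx1, hVc x hx1 hx⟩ ⟨z, hz, hzc⟩
    apply hyc
    have hyb : y ∈ closure (Metric.ball (0 : ℂ) 1) := by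
      rw [closure_ball _ one_ne_zero]
      exact Metric.sphere_subset_closedBall hy
    have := Metric.isOpen_ball.inter_closure (s := Metric.ball y r) ⟨Metric.mem_ball_self hr, hyb⟩
    exact closure_mono hyr this
  -- The closed disk is the convex hull of the circle, and an open convex set is the interior of its
  -- closure. This leaves no space for a second region.
  have hball : Metric.ball (0 : ℂ) 1 ⊆ Ω := by
    have h1 : Metric.closedBall (0 : ℂ) 1 ⊆ closure Ω := by
      rw [← convexHull_sphere_eq_closedBall (0 : ℂ) zero_le_one]
      exact convexHull_min hsph hconv.closure
    have h2 := interior_mono h1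
    rw [interior_closedBall _ one_ne_zero,
      hconv.interior_closure_eq_interior_of_nonempty_interior
        (by rw [hP.isOpen.interior_eq]; exact (isConnected_of_mem_components hΩ).nonempty),
      hP.isOpen.interior_eq] at h2
    exact h2
  have : Nontrivial (Fin n) := Fin.nontrivial_iff_two_le.2 hn
  obtain ⟨j, hj⟩ := exists_ne i
  obtain ⟨y, hy⟩ := C.region_nonempty j
  exact disjoint_left.1 (C.region_disjoint j i hj) hy
    (subset_region_of_mem_components hΩ (hball ((isPiece_region j).subset hy).1))

/-- A convex component lies on one side of each of its edges. -/
lemma IsFlat.im_pos (hF : C.IsFlat p Ω) (hC : C.IsStationary) (hp : C.IsPressure p)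
    (hΩ : Ω ∈ C.components i) {ε : Fin C.numEdges × Bool} (hε : C.IsLeftEnd Ω ε) {y : ℂ}
    (hy : y ∈ Ω) : 0 < ((y - C.endPoint ε) * starRingEnd ℂ (C.conormal ε)).im := by
  have hP := isPiece_of_mem_components hΩ
  have hu := mul_conj_of_norm_one (norm_conormal (C := C) ε)
  set τ := C.conormal ε with hτ
  set x := C.endPoint ε with hx
  obtain ⟨r, hr, h⟩ := hF.exists_half_plane hp hΩ hε (half_mem_Ioo ε.1)
  set P := x + ((C.len ε.1 / 2 : ℝ) : ℂ) * τ with hPdef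
  have hPim : ∀ z, ((z - x) * starRingEnd ℂ τ).im = ((z - P) * starRingEnd ℂ τ).im := by
    intro z
    have : (z - x) * starRingEnd ℂ τ =
        (z - P) * starRingEnd ℂ τ + ((C.len ε.1 / 2 : ℝ) : ℂ) := by
      rw [hPdef]; linear_combination ((C.len ε.1 / 2 : ℝ) : ℂ) * hu
    rw [this, Complex.add_im, Complex.ofReal_im, add_zero]
  have hPΩ : P ∉ Ω := by
    intro hm
    have := (h P (by simpa using hr)).1 hm
    rw [hPim, sub_self, zero_mul, Complex.zero_im] at this
    exact lt_irrefl _ this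
  by_contra hneg
  rw [not_lt, hPim] at hneg
  -- Since Ω is open, a point on the wrong side of the line, or on it, can be moved to a point y'
  -- strictly on the wrong side.
  obtain ⟨s, hs, hs0⟩ : ∃ s : ℝ, y - (s : ℂ) * (Complex.I * τ) ∈ Ω ∧ 0 < s := by
    have hc : Continuous fun s : ℝ => y - (s : ℂ) * (Complex.I * τ) := by fun_prop
    have h0 := hc.tendsto 0
    rw [Complex.ofReal_zero, zero_mul, sub_zero] at h0
    have h1 := (h0.mono_left (nhdsWithin_le_nhds (s := Ioi 0))).eventually
      (hP.isOpen.mem_nhds hy)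
    obtain ⟨s, h2, h3⟩ := (h1.and self_mem_nhdsWithin).exists
    exact ⟨s, h2, h3⟩
  set y' := y - (s : ℂ) * (Complex.I * τ) with hy'
  have hy'im : ((y' - P) * starRingEnd ℂ τ).im < 0 := by
    have : (y' - P) * starRingEnd ℂ τ = (y - P) * starRingEnd ℂ τ - (s : ℂ) * Complex.I := by
      rw [hy']; linear_combination (-(s : ℂ) * Complex.I) * hu
    rw [this, Complex.sub_im, Complex.im_ofReal_mul, Complex.I_im]
    linarith
  -- The line from y' through the edge midpoint P is prolonged slightly into Ω. Convexity would then
  -- put P in Ω.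
  obtain ⟨l, hl, hl0⟩ : ∃ l : ℝ, ‖P - (l : ℂ) * (y' - P) - P‖ < r ∧ 0 < l := by
    have hc : Continuous fun l : ℝ => ‖P - (l : ℂ) * (y' - P) - P‖ := by fun_prop
    have h0 := hc.tendsto 0
    rw [Complex.ofReal_zero, zero_mul, sub_zero, sub_self, norm_zero] at h0
    have h1 := (h0.mono_left (nhdsWithin_le_nhds (s := Ioi 0))).eventually (gt_mem_nhds hr)
    obtain ⟨s, h2, h3⟩ := (h1.and self_mem_nhdsWithin).exists
    exact ⟨s, h2, h3⟩
  have hw : P - (l : ℂ) * (y' - P) ∈ Ω := by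
    rw [h _ hl, hPim]
    have : (P - (l : ℂ) * (y' - P) - P) * starRingEnd ℂ τ =
        ((-l : ℝ) : ℂ) * ((y' - P) * starRingEnd ℂ τ) := by push_cast; ring
    rw [this, Complex.im_ofReal_mul]
    nlinarith
  apply hPΩ
  have hseg := (hF.convex hC hp hΩ).segment_subset hw hs
  apply hseg
  refine ⟨1 / (1 + l), l / (1 + l), by positivity, by positivity, by field_simp, ?_⟩
  have : (1 + (l : ℂ)) ≠ 0 := by
    rw [← Complex.ofReal_one, ← Complex.ofReal_add]
    exact_mod_cast (by positivity : (1 + l) ≠ 0)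
  simp only [Complex.real_smul]
  push_cast
  field_simp
  ring

lemma IsFlat.im_nonneg (hF : C.IsFlat p Ω) (hC : C.IsStationary) (hp : C.IsPressure p)
    (hΩ : Ω ∈ C.components i) {ε : Fin C.numEdges × Bool} (hε : C.IsLeftEnd Ω ε) {y : ℂ}
    (hy : y ∈ closure Ω) : 0 ≤ ((y - C.endPoint ε) * starRingEnd ℂ (C.conormal ε)).im := by
  have hcl : IsClosed {y : ℂ | 0 ≤ ((y - C.endPoint ε) * starRingEnd ℂ (C.conormal ε)).im} :=
    isClosed_le continuous_const (by fun_prop)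
  exact closure_minimal (fun y hy => (hF.im_pos hC hp hΩ hε hy).le) hcl hy

end AdmissibleGraph

/-! ### Sixth roots of unity and sextants -/

/-- The rotation by `π/3`. -/
def xi : ℂ := 1 + zeta

lemma xi_re : xi.re = 1 / 2 := by
  rw [xi, Complex.add_re, Complex.one_re, zeta_re]; norm_num

lemma xi_im : xi.im = √3 / 2 := by
  rw [xi, Complex.add_im, Complex.one_im, zeta_im]; ring

lemma xi_eq_neg : xi = -(zeta * zeta) := by
  rw [xi]; linear_combination one_add_zeta_add_sq

lemma xi_sq : xi ^ 2 = xi - 1 := by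
  rw [xi]; linear_combination one_add_zeta_add_sq

lemma xi_cube : xi ^ 3 = -1 := by
  linear_combination (xi + 1) * xi_sq

lemma isPrimitiveRoot_xi : IsPrimitiveRoot xi 6 := by
  refine IsPrimitiveRoot.mk_of_lt xi (by norm_num) ?_ fun l hl hl6 h => ?_
  · linear_combination (xi ^ 3 - 1) * xi_cube
  · have him : xi.im ≠ 0 := by rw [xi_im]; positivity
    have hre := xi_re
    interval_cases l
    · rw [pow_one] at h; rw [h, Complex.one_im] at him; exact him rfl
    · rw [xi_sq] at h
      have := congrArg Complex.im h
      simp only [Complex.sub_im, Complex.one_im, sub_zero] at this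
      exact him this
    · rw [xi_cube] at h; norm_num at h
    · have h4 : xi ^ 4 = -xi := by linear_combination xi * xi_cube
      have := congrArg Complex.im (h4.symm.trans h)
      rw [Complex.neg_im, Complex.one_im, neg_eq_zero] at this
      exact him this
    · have h5 : xi ^ 5 = -(xi - 1) := by linear_combination xi ^ 2 * xi_cube - xi_sq
      have := congrArg Complex.im (h5.symm.trans h)
      rw [Complex.neg_im, Complex.sub_im, Complex.one_im, sub_zero, neg_eq_zero] at this
      exact him this

/-- The sextants cover the plane. -/
lemma exists_sextant {w : ℂ} (hw : w ≠ 0) :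
    ∃ k < 6, ∃ a > (0 : ℝ), ∃ b ≥ (0 : ℝ), w = xi ^ k * (a + b * xi) := by
  -- Coordinates with respect to the basis 1, ξ. The half plane v > 0 together with one boundary ray
  -- consists of three half-open sextants; the opposite half follows from ξ³ = -1.
  have half : ∀ u v : ℝ, (0 < v ∨ (v = 0 ∧ 0 < u)) →
      ∃ k < 3, ∃ a > (0 : ℝ), ∃ b ≥ (0 : ℝ), (u + v * xi : ℂ) = xi ^ k * (a + b * xi) := by
    intro u v h
    by_cases hu : 0 < u
    · refine ⟨0, by norm_num, u, hu, v, ?_, by ring⟩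
      rcases h with h | h
      exacts [h.le, h.1.ge]
    · have hv : 0 < v := by tauto
      by_cases huv : 0 < u + v
      · refine ⟨1, by norm_num, u + v, huv, -u, by linarith, ?_⟩
        push_cast
        linear_combination (u : ℂ) * xi_sq
      · refine ⟨2, by norm_num, v, hv, -u - v, by linarith, ?_⟩
        push_cast
        linear_combination (u : ℂ) * xi_cube + (v : ℂ) * xi_cube - (v : ℂ) * xi_sq
  have hs : √3 ≠ 0 := by positivity
  set v := w.im * 2 / √3 with hv
  set u := w.re - v / 2 with hu
  have hwuv : w = u + v * xi := by
    apply Complex.ext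
    · rw [Complex.add_re, Complex.re_ofReal_mul, Complex.ofReal_re, xi_re, hu]; ring
    · rw [Complex.add_im, Complex.im_ofReal_mul, Complex.ofReal_im, xi_im, hv]; field_simp; ring
  rcases lt_trichotomy v 0 with h | h | h
  · obtain ⟨k, hk, a, ha, b, hb, hab⟩ := half (-u) (-v) (Or.inl (by linarith))
    refine ⟨k + 3, by omega, a, ha, b, hb, ?_⟩
    rw [hwuv, pow_add, xi_cube]
    push_cast at hab
    linear_combination -hab
  · rcases lt_trichotomy u 0 with h' | h' | h'
    · obtain ⟨k, hk, a, ha, b, hb, hab⟩ := half (-u) (-v) (Or.inr ⟨by linarith, by linarith⟩)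
      refine ⟨k + 3, by omega, a, ha, b, hb, ?_⟩
      rw [hwuv, pow_add, xi_cube]
      push_cast at hab
      linear_combination -hab
    · exact absurd (by rw [hwuv, h, h']; simp) hw
    · obtain ⟨k, hk, a, ha, b, hb, hab⟩ := half u v (Or.inr ⟨h, h'⟩)
      exact ⟨k, by omega, a, ha, b, hb, hwuv.trans hab⟩
  · obtain ⟨k, hk, a, ha, b, hb, hab⟩ := half u v (Or.inl h)
    exact ⟨k, by omega, a, ha, b, hb, hwuv.trans hab⟩

/-! ### Flat components are hexagons -/

namespace AdmissibleGraph

variable {n : ℕ} {C : AdmissibleGraph n} {p : Fin n → ℝ} {i : Fin n} {Ω : Set ℂ}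

lemma flipEnd_mem_ends {ε : Fin C.numEdges × Bool} (h : ε ∈ C.ends) : flipEnd ε ∈ C.ends := by
  rw [mem_ends] at h ⊢
  exact h

/-- The boundary of a flat component turns by `π/3` at every vertex. -/
lemma IsFlat.exists_next (hF : C.IsFlat p Ω) (hC : C.IsStationary) (hp : C.IsPressure p)
    (hΩ : Ω ∈ C.components i) {ε : Fin C.numEdges × Bool} (hε : C.IsLeftEnd Ω ε) :
    ∃ ε', C.IsLeftEnd Ω ε' ∧ C.endPoint ε' = C.endPoint ε + C.len ε.1 * C.conormal ε ∧
      C.conormal ε' = xi * C.conormal ε := by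
  have hf : flipEnd ε ∈ C.ends := flipEnd_mem_ends hε.1
  have hx := hF.norm_endPoint_lt hf (endSign_eq ε) hε.2
  obtain ⟨a, b, hE, -, -, -, h1, h2, h3⟩ := hC.exists_endsAt_eq hx (mem_endsAt.2 ⟨hf, rfl⟩)
  -- The edge b precedes the reversed edge around the vertex, so its left side is the right side of
  -- the reversed edge, where Ω lies. Its direction is ζ² times the reversed one, and -ζ² = ξ.
  have hb : b ∈ C.endsAt (C.endPoint (flipEnd ε)) := by rw [hE]; simp
  have hadj : C.Adj (C.endSign b) Ω b.1 := by
    rw [hC.adj_next hx hb (mem_endsAt.2 ⟨hf, rfl⟩) h3 (isPiece_of_mem_components hΩ),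
      endSign_flipEnd, neg_neg]
    exact hε.2
  refine ⟨b, ⟨(mem_endsAt.1 hb).1, hadj⟩, ?_, ?_⟩
  · rw [(mem_endsAt.1 hb).2, hF.endPoint_flipEnd hp hε]
  · rw [h2, h1, hF.conormal_flipEnd hp hε, xi_eq_neg]
    ring

lemma IsFlat.mem_closure (hF : C.IsFlat p Ω) (hp : C.IsPressure p) (hΩ : C.IsPiece Ω)
    {ε : Fin C.numEdges × Bool} (hε : C.IsLeftEnd Ω ε) {t : ℝ} (ht : t ∈ Icc 0 (C.len ε.1)) :
    C.endPoint ε + t * C.conormal ε ∈ closure Ω := by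
  rw [← hF.curve_eq hp (endSign_eq ε) hε.2 ht]
  refine mem_closure_of_adj_of_mem_Icc hΩ (endSign_eq ε) hε.2 ?_
  obtain ⟨h1, h2⟩ := ht
  unfold CurveSystem.endParam CurveSystem.endSign
  split_ifs <;> constructor <;> linarith

/-- The edges of a flat component have different directions. -/
lemma IsFlat.injOn_conormal (hF : C.IsFlat p Ω) (hC : C.IsStationary) (hp : C.IsPressure p)
    (hΩ : Ω ∈ C.components i) : InjOn C.conormal {ε | C.IsLeftEnd Ω ε} := by
  have hP := isPiece_of_mem_components hΩ
  intro ε hε ε' hε' h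
  have hε : C.IsLeftEnd Ω ε := hε
  have hε' : C.IsLeftEnd Ω ε' := hε'
  set τ := C.conormal ε with hτ
  have hu : τ * starRingEnd ℂ τ = 1 := mul_conj_of_norm_one (norm_conormal ε)
  -- The final vertex of one edge lies on the inner side of the other edge and of that edge's
  -- successor. By symmetry the difference of the two final vertices has no component normal to
  -- either of two independent directions, so they coincide.
  have key : ∀ ε₁ ε₂, C.IsLeftEnd Ω ε₁ → C.IsLeftEnd Ω ε₂ → C.conormal ε₁ = τ → C.conormal ε₂ = τ →
      0 ≤ ((C.endPoint (flipEnd ε₂) - C.endPoint (flipEnd ε₁)) * starRingEnd ℂ τ).im ∧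
      0 ≤ ((C.endPoint (flipEnd ε₂) - C.endPoint (flipEnd ε₁)) * starRingEnd ℂ (xi * τ)).im := by
    intro ε₁ ε₂ h₁ h₂ e₁ e₂
    have hy : C.endPoint (flipEnd ε₂) ∈ closure Ω := by
      rw [hF.endPoint_flipEnd hp h₂]
      exact hF.mem_closure hp hP h₂ (right_mem_Icc.2 (C.len_pos _).le)
    obtain ⟨ε₃, h₃, e₃, e₃'⟩ := hF.exists_next hC hp hΩ h₁
    constructor
    · have := hF.im_nonneg hC hp hΩ h₁ hy
      rw [e₁] at this
      have hv : (C.endPoint (flipEnd ε₂) - C.endPoint ε₁) * starRingEnd ℂ τ =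
          (C.endPoint (flipEnd ε₂) - C.endPoint (flipEnd ε₁)) * starRingEnd ℂ τ + C.len ε₁.1 := by
        rw [hF.endPoint_flipEnd hp h₁, e₁]
        linear_combination (C.len ε₁.1 : ℂ) * hu
      rwa [hv, Complex.add_im, Complex.ofReal_im, add_zero] at this
    · have := hF.im_nonneg hC hp hΩ h₃ hy
      rwa [e₃, e₃', e₁, ← e₁, ← hF.endPoint_flipEnd hp h₁, e₁] at this
  obtain ⟨k1, k2⟩ := key ε ε' hε hε' rfl h.symm
  obtain ⟨k3, k4⟩ := key ε' ε hε' hε h.symm rfl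
  set v := (C.endPoint (flipEnd ε') - C.endPoint (flipEnd ε)) * starRingEnd ℂ τ with hv
  have hneg : (C.endPoint (flipEnd ε) - C.endPoint (flipEnd ε')) * starRingEnd ℂ τ = -v := by
    rw [hv]; ring
  have hx1 : (C.endPoint (flipEnd ε') - C.endPoint (flipEnd ε)) * starRingEnd ℂ (xi * τ) =
      v * starRingEnd ℂ xi := by rw [hv, map_mul]; ring
  have hx2 : (C.endPoint (flipEnd ε) - C.endPoint (flipEnd ε')) * starRingEnd ℂ (xi * τ) =
      -(v * starRingEnd ℂ xi) := by rw [hv, map_mul]; ring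
  rw [hneg, Complex.neg_im] at k3
  rw [hx1] at k2
  rw [hx2, Complex.neg_im] at k4
  have hvim : v.im = 0 := by linarith
  have hvx : (v * starRingEnd ℂ xi).im = 0 := by linarith
  rw [Complex.mul_im, Complex.conj_re, Complex.conj_im, xi_re, xi_im, hvim] at hvx
  have hvre : v.re = 0 := by
    have hs : √3 ≠ 0 := by positivity
    have : v.re * √3 = 0 := by linarith
    exact (mul_eq_zero.1 this).resolve_right hs
  have hv0 : v = 0 := Complex.ext hvre hvim
  have hτ0 : starRingEnd ℂ τ ≠ 0 := by
    intro h0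
    rw [h0, mul_zero] at hu
    exact zero_ne_one hu
  have hend : C.endPoint (flipEnd ε') = C.endPoint (flipEnd ε) :=
    sub_eq_zero.1 ((mul_eq_zero.1 hv0).resolve_right hτ0)
  have hf : flipEnd ε ∈ C.ends := flipEnd_mem_ends hε.1
  have hf' : flipEnd ε' ∈ C.ends := flipEnd_mem_ends hε'.1
  have hx := hF.norm_endPoint_lt hf (endSign_eq ε) hε.2
  by_contra hne
  have hne' : flipEnd ε' ≠ flipEnd ε := by
    intro h0
    apply hne
    have e1 := congrArg Prod.fst h0
    have e2 := congrArg Prod.snd h0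
    simp only [flipEnd, Bool.not_inj_iff] at e1 e2
    exact (Prod.ext e1 e2).symm
  -- Two different edges at one vertex have cosine -1/2, whereas equal directions give cosine 1.
  have := hC.re_conormal hx (mem_endsAt.2 ⟨hf, rfl⟩) (mem_endsAt.2 ⟨hf', hend⟩) hne'
  rw [hF.conormal_flipEnd hp hε, hF.conormal_flipEnd hp hε', ← h, map_neg, neg_mul_neg, hu,
    Complex.one_re] at this
  norm_num at this

/-- The directions of the edges of a flat component are obtained from one of them by rotations by
multiples of `π/3`. -/
lemma IsFlat.image_conormal (hF : C.IsFlat p Ω) (hC : C.IsStationary) (hp : C.IsPressure p)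
    (hΩ : Ω ∈ C.components i) {ε₀ : Fin C.numEdges × Bool} (h₀ : C.IsLeftEnd Ω ε₀) :
    C.conormal '' {ε | C.IsLeftEnd Ω ε} =
      (fun k => xi ^ k * C.conormal ε₀) '' (Finset.range 6 : Set ℕ) := by
  have hP := isPiece_of_mem_components hΩ
  have horbit : ∀ k : ℕ, ∃ ε, C.IsLeftEnd Ω ε ∧ C.conormal ε = xi ^ k * C.conormal ε₀ := by
    intro k
    induction k with
    | zero => exact ⟨ε₀, h₀, by simp⟩
    | succ k ih =>
      obtain ⟨ε, hε, h⟩ := ih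
      obtain ⟨ε', hε', -, h'⟩ := hF.exists_next hC hp hΩ hε
      exact ⟨ε', hε', by rw [h', h]; ring⟩
  apply subset_antisymm
  · rintro _ ⟨ε, hε, rfl⟩
    have hε : C.IsLeftEnd Ω ε := hε
    have hu₀ := mul_conj_of_norm_one (norm_conormal (C := C) ε₀)
    have hu := mul_conj_of_norm_one (norm_conormal (C := C) ε)
    -- An arbitrary edge direction is written as a combination, with a > 0 and b ≥ 0, of two
    -- consecutive directions in the orbit; convexity will exclude b > 0.
    obtain ⟨k, hk, a, ha, b, hb, hab⟩ := exists_sextant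
      (w := C.conormal ε * starRingEnd ℂ (C.conormal ε₀)) (by
        rw [← norm_ne_zero_iff, norm_mul, RCLike.norm_conj, norm_conormal, norm_conormal]
        norm_num)
    obtain ⟨ε₁, h₁, e₁⟩ := horbit k
    obtain ⟨ε₂, h₂, e₂, e₂'⟩ := hF.exists_next hC hp hΩ h₁
    have hdec : C.conormal ε = a * C.conormal ε₁ + b * (xi * C.conormal ε₁) := by
      rw [e₁]
      linear_combination C.conormal ε₀ * hab - C.conormal ε * hu₀
    set τ := C.conormal ε₁ with hτ
    have hu₁ : τ * starRingEnd ℂ τ = 1 := mul_conj_of_norm_one (norm_conormal ε₁)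
    set y := C.endPoint ε₂ with hy
    have hyc : y ∈ closure Ω := by
      rw [e₂]
      exact hF.mem_closure hp hP h₁ (right_mem_Icc.2 (C.len_pos _).le)
    -- The heights of m above the two consecutive edges are nonnegative, and y lies on the inner
    -- side of ε. The latter says that the combination of these heights with weights a and b is at
    -- most 0, so both terms vanish.
    have hzero : ∀ t ∈ Icc 0 (C.len ε.1), ∀ m, m = C.endPoint ε + t * C.conormal ε →
        ((m - y) * starRingEnd ℂ τ).im = 0 ∧ b * ((m - y) * starRingEnd ℂ (xi * τ)).im = 0 := by
      intro t ht m hm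
      have hmc : m ∈ closure Ω := hm ▸ hF.mem_closure hp hP hε ht
      have i1 := hF.im_nonneg hC hp hΩ h₁ hmc
      have i2 := hF.im_nonneg hC hp hΩ h₂ hmc
      have i3 := hF.im_nonneg hC hp hΩ hε hyc
      rw [e₂'] at i2
      have hv1 : (m - C.endPoint ε₁) * starRingEnd ℂ τ =
          (m - y) * starRingEnd ℂ τ + C.len ε₁.1 := by
        rw [e₂]; linear_combination (C.len ε₁.1 : ℂ) * hu₁
      rw [← hτ, hv1, Complex.add_im, Complex.ofReal_im, add_zero] at i1
      have hv3 : (y - C.endPoint ε) * starRingEnd ℂ (C.conormal ε) =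
          (t : ℂ) - (a * ((m - y) * starRingEnd ℂ τ) + b * ((m - y) * starRingEnd ℂ (xi * τ))) := by
        have hconj : starRingEnd ℂ (C.conormal ε) =
            a * starRingEnd ℂ τ + b * starRingEnd ℂ (xi * τ) := by
          rw [hdec, map_add, map_mul, map_mul (f := starRingEnd ℂ) (x := (b : ℂ)),
            Complex.conj_ofReal, Complex.conj_ofReal]
        linear_combination starRingEnd ℂ (C.conormal ε) * hm + (t : ℂ) * hu -
          (m - y) * hconj
      rw [hv3, Complex.sub_im, Complex.ofReal_im, Complex.add_im, Complex.im_ofReal_mul,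
        Complex.im_ofReal_mul] at i3
      have j1 := mul_nonneg ha.le i1
      have j2 := mul_nonneg hb i2
      refine ⟨?_, by linarith⟩
      have : a * ((m - y) * starRingEnd ℂ τ).im = 0 := by linarith
      exact (mul_eq_zero.1 this).resolve_left ha.ne'
    have hb0 : b = 0 := by
      by_contra hbne
      -- With b > 0 both heights vanish, so the whole edge would collapse to the vertex y.
      have heq : ∀ t ∈ Icc 0 (C.len ε.1), C.endPoint ε + t * C.conormal ε = y := by
        intro t ht
        obtain ⟨z1, z2⟩ := hzero t ht _ rfl
        replace z2 := (mul_eq_zero.1 z2).resolve_left hbne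
        set v := (C.endPoint ε + t * C.conormal ε - y) * starRingEnd ℂ τ with hv
        rw [show (C.endPoint ε + t * C.conormal ε - y) * starRingEnd ℂ (xi * τ) =
          v * starRingEnd ℂ xi by rw [hv, map_mul]; ring, Complex.mul_im, Complex.conj_re,
          Complex.conj_im, xi_re, xi_im, z1] at z2
        have hvre : v.re = 0 := by
          have hs : √3 ≠ 0 := by positivity
          have : v.re * √3 = 0 := by linarith
          exact (mul_eq_zero.1 this).resolve_right hs
        have hv0 : v = 0 := Complex.ext hvre z1
        have hτ0 : starRingEnd ℂ τ ≠ 0 := by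
          intro h0
          rw [h0, mul_zero] at hu₁
          exact zero_ne_one hu₁
        exact sub_eq_zero.1 ((mul_eq_zero.1 hv0).resolve_right hτ0)
      have hl := C.len_pos ε.1
      have q1 := heq 0 (left_mem_Icc.2 hl.le)
      have q2 := heq (C.len ε.1) (right_mem_Icc.2 hl.le)
      rw [← q1, Complex.ofReal_zero, zero_mul, add_zero, add_eq_left, mul_eq_zero] at q2
      rcases q2 with q2 | q2
      · exact hl.ne' (by exact_mod_cast q2)
      · rw [q2, zero_mul] at hu
        exact zero_ne_one hu
    have ha1 : a = 1 := by
      have h1 := norm_conormal (C := C) ε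
      rw [hdec, hb0, Complex.ofReal_zero, zero_mul, add_zero, norm_mul, hτ, norm_conormal, mul_one,
        Complex.norm_real, Real.norm_eq_abs, abs_of_pos ha] at h1
      exact h1
    refine ⟨k, by simpa using hk, ?_⟩
    rw [hdec, hb0, ha1, e₁]
    simp
  · rintro _ ⟨k, -, rfl⟩
    obtain ⟨ε, hε, h⟩ := horbit k
    exact ⟨ε, hε, h⟩

/-- The edges in the boundary of a flat component. -/
lemma IsFlat.edgesOf_eq (hF : C.IsFlat p Ω) (hp : C.IsPressure p) (hΩ : C.IsPiece Ω) :
    C.edgesOf Ω = Prod.fst '' {ε | C.IsLeftEnd Ω ε} := by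
  ext e
  constructor
  · intro he
    have hm := Ioo_subset_openParams e (half_mem_Ioo e)
    obtain ⟨σ, hσ, ha⟩ := exists_adj_of_mem_closure hΩ (half_mem_interiorParams e)
      (frontier_subset_closure (he (mem_image_of_mem _ hm)))
    obtain ⟨b, hb⟩ := hF.exists_isLeftEnd hp hσ ha
    exact ⟨(e, b), hb, rfl⟩
  · rintro ⟨ε, hε, rfl⟩
    have hε : C.IsLeftEnd Ω ε := hε
    rintro _ ⟨t, ht, rfl⟩
    have ht' := openParams_subset_interiorParams _ ht
    rw [hΩ.isOpen.frontier_eq]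
    exact ⟨mem_closure_of_adj hΩ (endSign_eq ε) hε.2 ht', fun h =>
      not_mem_support_of_isPiece hΩ h (curve_mem_support ht')⟩

/-- Flat components are hexagonal. -/
lemma IsFlat.isHexagonal (hF : C.IsFlat p Ω) (hn : 2 ≤ n) (hC : C.IsStationary)
    (hp : C.IsPressure p) (hΩ : Ω ∈ C.components i) : C.IsHexagonal Ω := by
  have hP := isPiece_of_mem_components hΩ
  have hd := hF.disjoint_sphere hn hC hp hΩ
  have hbdd : Bornology.IsBounded Ω := Metric.isBounded_ball.subset (hP.subset.trans sdiff_subset)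
  have hne := (isConnected_of_mem_components hΩ).nonempty
  have hfr : IsConnected (frontier Ω) := by
    -- The boundary of a bounded convex set with interior is homeomorphic to the circle, hence
    -- connected.
    obtain ⟨h, -, -, hh⟩ := exists_homeomorph_image_interior_closure_frontier_eq_unitBall
      (hF.convex hC hp hΩ) (by rwa [hP.isOpen.interior_eq]) hbdd
    have : frontier Ω = h.symm '' Metric.sphere 0 1 := by
      rw [← hh, ← image_comp]
      simp
    rw [this]
    exact (isConnected_sphere (by rw [Complex.rank_real_complex]; norm_num) 0 zero_le_one).image _
      h.symm.continuous.continuousOn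
  refine ⟨hd, hfr, ?_⟩
  obtain ⟨x, hx⟩ := hfr.nonempty
  rw [hP.isOpen.frontier_eq] at hx
  have hx1 : ‖x‖ < 1 := lt_of_le_of_ne (hP.norm_le_one hx.1) fun h =>
    disjoint_left.1 hd hx.1 (by simpa using h)
  obtain ⟨ε₀, h₀, -⟩ := hF.boundary_cases hC hp hP hx.1 hx.2 hx1
  -- Edges correspond to their left ends, left ends to their directions, and directions to the six
  -- powers of ξ.
  rw [hF.edgesOf_eq hp hP, InjOn.ncard_image,
    ← (hF.injOn_conormal hC hp hΩ).ncard_image, hF.image_conormal hC hp hΩ h₀,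
    InjOn.ncard_image, ncard_coe_finset, Finset.card_range]
  · intro k hk l hl h
    have h0 : C.conormal ε₀ ≠ 0 := by
      rw [← norm_ne_zero_iff, norm_conormal]; norm_num
    exact isPrimitiveRoot_xi.pow_inj (by simpa using hk) (by simpa using hl)
      (mul_right_cancel₀ h0 h)
  · rintro ⟨e, b⟩ hε ⟨e', b'⟩ hε' h
    have hε : C.IsLeftEnd Ω (e, b) := hε
    have hε' : C.IsLeftEnd Ω (e', b') := hε'
    simp only at h
    subst h
    -- If both ends of one edge were left ends, Ω would lie on both sides of it.
    by_contra hne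
    have hb : (e, b') = flipEnd (e, b) := by
      refine Prod.ext rfl ?_
      show b' = !b
      cases b <;> cases b' <;> simp_all
    rw [hb] at hε'
    have := hε'.2
    rw [endSign_flipEnd] at this
    exact not_adj_both hΩ hε.2 this

end AdmissibleGraph

end

theorem mainTheorem3 (n : ℕ) (hn : 2 ≤ n) (C : AdmissibleGraph n) (hC : C.IsStable) :
    (∃ p : Fin n → ℝ, C.IsPressure p) ∧
      ∀ p : Fin n → ℝ, C.IsPressure p → ∀ i : Fin n, (∀ j, p j ≤ p i) →
        {Ω | Ω ∈ C.components i ∧ ¬ C.IsHexagonal Ω}.encard ≤ ((n - 1 : ℕ) : ℕ∞) := by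
  refine ⟨hC.1.exists_isPressure, fun p hp i hi => ?_⟩
  refine (encard_le_encard ?_).trans (hC.encard_not_isFlat_le (by omega) hp hi)
  rintro Ω ⟨hΩ, hnot⟩
  exact ⟨hΩ, fun hF => hnot (hF.isHexagonal hn hC.1 hp hΩ)⟩
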